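/- Let $G$ be a simply connected (in particular connected) nilpotent real Lie group with Lie algebra $\mathfrak g$ (nilpotent: $\operatorname{ad}(Z)$ is nilpotent for every $Z\in\mathfrak g$), so that $\exp:\mathfrak g\to G$ is a diffeomorphism. Let $X\subset\mathfrak g^*$ be a coadjoint orbit of $G$, let $x\in X$, and define $\xi:G\to\mathbf C$ by $\xi(\exp Z)=e^{i\langle x,Z\rangle}$. A *state* of a group $K$ is a (not necessarily continuous) function $m:K\to\mathbf C$ with $m(e)=1$ that is positive-definite, i.e. $\sum_{g,h\in K}\overline{c_g}\,c_h\,m(g^{-1}h)\ge 0$ for all finitely supported $c:K\to\mathbf C$. If $K$ is a Lie group with Lie algebra $\mathfrak k$ and $Y\subset\mathfrak k^*$ is a coadjoint orbit of $K$, a *quantum state* for $Y$ is a state $m$ of $K$ such that $$\Bigl|\sum_{j=1}^n c_j\,m(\exp Z_j)\Bigr|\le\sup_{y\in Y}\Bigl|\sum_{j=1}^n c_j\,e^{i\langle y,Z_j\rangle}\Bigr|$$ for all $n$, all $c_1,\dots,c_n\in\mathbf C$, and all $Z_1,\dots,Z_n\in\mathfrak k$ such that $\langle y,[Z_j,Z_k]\rangle=0$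 for all $y\in Y$ and all $j,k$ (i.e. the hamiltonians $H_{Z_j}=\langle\cdot,Z_j\rangle$ Poisson-commute on $Y$). For a closed subgroup $H\subset G$ with Lie algebra $\mathfrak h$ and a coadjoint orbit $Y\subset X|_{\mathfrak h}\subset\mathfrak h^*$ of $H$, a quantum state $m$ for $X$ is *localized at* $Y$ if $m|_H$ is a quantum state for $Y$. A closed subgroup $H$ is *subordinate to* $x$ if $H$ is connected and $\xi|_H$ is a character of $H$ (then $\{x|_{\mathfrak h}\}$ is a coadjoint orbit of $H$). **Theorem.** Let $H$ be maximal among the closed connected subgroups of $G$ subordinate to $x$. Then there is exactly one quantum state $m$ for $X$ localized at $\{x|_{\mathfrak h}\}$, namely $$m(g)=\begin{cases}\xi(g)&\text{if }g\in H,\\ 0&\text{otherwise.}\end{cases}$$ -/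

import Mathlib

open scoped Manifold ContDiff ComplexOrder ComplexConjugate

noncomputable section

namespace LieQuantum

/-! ### The Lie algebra and the exponential map of a Lie group -/

/-- Over `ℝ` the smoothness `minSmoothness ℝ 3 = 3` that Mathlib asks for, in order to put the Lie
bracket on the tangent space at the identity, is implied by smoothness. -/
instance instLEInftyMinSmoothness : ENat.LEInfty (minSmoothness ℝ 3) :=
  ⟨by rw [minSmoothness_of_isRCLikeNormedField]; exact ENat.LEInfty.out⟩

section Exp

variable (E : Type*) [NormedAddCommGroup E] [NormedSpace ℝ E]
  (G : Type*) [TopologicalSpace G] [ChartedSpace E G] [Group G] [LieGroup 𝓘(ℝ, E) ∞ G]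

/-- The Lie algebra `𝔤 = T_e G` of `G`, with the bracket of left invariant vector fields. -/
abbrev LieAlg : Type _ := GroupLieAlgebra 𝓘(ℝ, E) G

variable {E G}

/-- Left translates of an integral curve of a left invariant vector field are integral curves. -/
theorem isMIntegralCurveOn_mul_left {Z : LieAlg E G} {γ : ℝ → G} {s : Set ℝ}
    (hγ : IsMIntegralCurveOn γ (mulInvariantVectorField Z) s) (g : G) :
    IsMIntegralCurveOn (fun t => g * γ t) (mulInvariantVectorField Z) s := by
  intro t ht
  have hs : ∀ a b : G, MDifferentiableAt 𝓘(ℝ, E) 𝓘(ℝ, E) (fun c : G => a * c) b := fun a b =>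
    ((contMDiff_mul_left (I := 𝓘(ℝ, E)) (n := ∞) (a := a)).contMDiffAt).mdifferentiableAt
      (by simp)
  have h2 := (hs g (γ t)).hasMFDerivAt.comp_hasMFDerivWithinAt t (hγ t ht)
  have key : mulInvariantVectorField Z (g * γ t) =
      mfderiv 𝓘(ℝ, E) 𝓘(ℝ, E) (fun c : G => g * c) (γ t) (mulInvariantVectorField Z (γ t)) := by
    have D : (fun c : G => g * γ t * c) = (fun c => g * c) ∘ (fun c => γ t * c) := by
      ext c; simp [mul_assoc]
    simp only [mulInvariantVectorField]
    rw [D, mfderiv_comp (I' := 𝓘(ℝ, E)) (1 : G) (by simpa using hs g _) (hs (γ t) 1)]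
    exact congrArg (fun b : G => (show E →L[ℝ] E from
      mfderiv 𝓘(ℝ, E) 𝓘(ℝ, E) (fun c : G => g * c) b)
        (mfderiv 𝓘(ℝ, E) 𝓘(ℝ, E) (fun c : G => γ t * c) 1 Z)) (mul_one (γ t))
  refine h2.congr_mfderiv (ContinuousLinearMap.ext fun r => ?_)
  have h3 := map_smul (mfderiv 𝓘(ℝ, E) 𝓘(ℝ, E) (fun c : G => g * c) (γ t)) (show ℝ from r)
    (mulInvariantVectorField Z (γ t))
  rw [← key] at h3
  exact h3

variable [CompleteSpace E]

/-- Left invariant vector fields are complete: each `Z ∈ 𝔤` has an integral curve, defined on all of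
`ℝ`, that starts at the identity (the one-parameter subgroup generated by `Z`). -/
theorem exists_isMIntegralCurve [T2Space G] (Z : LieAlg E G) :
    ∃ γ : ℝ → G, γ 0 = 1 ∧ IsMIntegralCurve γ (mulInvariantVectorField Z) := by
  have hv : ContMDiff 𝓘(ℝ, E) 𝓘(ℝ, E).tangent 1
      (fun g : G => (⟨g, mulInvariantVectorField Z g⟩ : TangentBundle 𝓘(ℝ, E) G)) :=
    (contMDiff_mulInvariantVectorField Z).of_le (by
      rw [minSmoothness_of_isRCLikeNormedField]; norm_num)
  have : IsManifold 𝓘(ℝ, E) 1 G := inferInstance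
  obtain ⟨γ, h0, hγ⟩ := exists_isMIntegralCurveAt_of_contMDiffAt_boundaryless
    (I := 𝓘(ℝ, E)) (v := mulInvariantVectorField Z) 0 (hv.contMDiffAt (x := (1 : G)))
  rw [isMIntegralCurveAt_iff'] at hγ
  obtain ⟨ε, hε, hγ⟩ := hγ
  rw [Real.ball_eq_Ioo, zero_sub, zero_add] at hγ
  exact exists_isMIntegralCurve_of_isMIntegralCurveOn hv hε
    (fun g => ⟨fun t => g * γ t, by simp [h0], isMIntegralCurveOn_mul_left hγ g⟩) 1

/-- The exponential map `exp : 𝔤 → G`: the value at time `1` of the (unique) integral curve through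
the identity of the left invariant vector field defined by `Z`. -/
def lieExp [T2Space G] (Z : LieAlg E G) : G :=
  (exists_isMIntegralCurve Z).choose 1

/-- The exponential map does not depend on the integral curve chosen to define it. -/
theorem lieExp_eq [T2Space G] (Z : LieAlg E G) (γ : ℝ → G) (h0 : γ 0 = 1)
    (hγ : IsMIntegralCurve γ (mulInvariantVectorField Z)) : lieExp Z = γ 1 := by
  have hv : ContMDiff 𝓘(ℝ, E) 𝓘(ℝ, E).tangent 1
      (fun g : G => (⟨g, mulInvariantVectorField Z g⟩ : TangentBundle 𝓘(ℝ, E) G)) :=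
    (contMDiff_mulInvariantVectorField Z).of_le (by
      rw [minSmoothness_of_isRCLikeNormedField]; norm_num)
  have h := (exists_isMIntegralCurve Z).choose_spec
  exact congrFun (isMIntegralCurve_Ioo_eq_of_contMDiff_boundaryless (t₀ := 0) hv h.2 hγ
    (h.1.trans h0.symm)) 1

end Exp

section Coadjoint

variable {E : Type*} [NormedAddCommGroup E] [NormedSpace ℝ E]
  {G : Type*} [TopologicalSpace G] [ChartedSpace E G] [Group G] [LieGroup 𝓘(ℝ, E) ∞ G]

/-- The adjoint action: `Ad g : 𝔤 → 𝔤` is the derivative at the identity of `h ↦ g h g⁻¹`. -/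
def Ad (g : G) : LieAlg E G →L[ℝ] LieAlg E G :=
  (mfderiv 𝓘(ℝ, E) 𝓘(ℝ, E) (fun h : G => g * h * g⁻¹) 1 : E →L[ℝ] E)

/-- The coadjoint action of `g ∈ G` on `x ∈ 𝔤*`: `⟨g(x), Z⟩ = ⟨x, Ad(g⁻¹) Z⟩`. -/
def coAd (g : G) (x : Module.Dual ℝ (LieAlg E G)) : Module.Dual ℝ (LieAlg E G) :=
  x ∘ₗ (Ad g⁻¹ : LieAlg E G →L[ℝ] LieAlg E G).toLinearMap

/-- `X ⊆ 𝔤*` is a coadjoint orbit of `G`. -/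
def IsCoadjointOrbit (X : Set (Module.Dual ℝ (LieAlg E G))) : Prop :=
  ∃ x : Module.Dual ℝ (LieAlg E G), X = Set.range fun g : G => coAd g x

end Coadjoint

/-! ### States and quantum states -/

/-- A state of a group: a positive-definite function `m` with `m(e) = 1`. No continuity is
required. -/
structure IsState {K : Type*} [Group K] (m : K → ℂ) : Prop where
  map_one : m 1 = 1
  nonneg : ∀ c : K →₀ ℂ, 0 ≤ c.sum fun g a => c.sum fun h b => conj a * b * m (g⁻¹ * h)

/-- Quantum states for a set `Y` of linear forms on the Lie algebra `𝔨` of a group `K` (in the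
applications `Y` is a coadjoint orbit of `K`). Here `IsExp Z k` says that `k = exp Z`. The
hamiltonians are the functions `H_Z(y) = ⟨y, Z⟩` on `Y`, whose Poisson bracket is
`{H_Z, H_W} = H_[Z, W]`; so `{H_Z, H_W} = 0` means that `[Z, W]` vanishes on `Y`. -/
structure IsQuantumStateWith {K 𝔨 : Type*} [Group K] [LieRing 𝔨] [LieAlgebra ℝ 𝔨]
    (IsExp : 𝔨 → K → Prop) (Y : Set (Module.Dual ℝ 𝔨)) (m : K → ℂ) : Prop where
  isState : IsState m
  norm_le : ∀ (n : ℕ) (c : Fin n → ℂ) (Z : Fin n → 𝔨) (k : Fin n → K),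
    (∀ j, IsExp (Z j) (k j)) → (∀ i j, ∀ y ∈ Y, y ⁅Z i, Z j⁆ = 0) →
      ‖∑ j, c j * m (k j)‖ ≤
        sSup ((fun y : Module.Dual ℝ 𝔨 => ‖∑ j, c j * Complex.exp (Complex.I * (y (Z j) : ℝ))‖) '' Y)

section Group

variable {E : Type*} [NormedAddCommGroup E] [NormedSpace ℝ E] [CompleteSpace E]
  {G : Type*} [TopologicalSpace G] [ChartedSpace E G] [Group G] [LieGroup 𝓘(ℝ, E) ∞ G] [T2Space G]

/-- Quantum states of the Lie group `G` for the coadjoint orbit `X`. -/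
def IsQuantumState (X : Set (Module.Dual ℝ (LieAlg E G))) (m : G → ℂ) : Prop :=
  IsQuantumStateWith (fun (Z : LieAlg E G) (g : G) => g = lieExp Z) X m

variable (E) in
/-- The Lie algebra `𝔥` of a closed subgroup `H` of `G`: it consists of the `Z ∈ 𝔤` with
`exp(tZ) ∈ H` for all real `t`. For closed `H` these `Z` already form a Lie subalgebra, so that
passing to the Lie subalgebra that they span adds nothing; it spares a proof of that fact here. -/
def subgroupLieAlg (H : Subgroup G) : LieSubalgebra ℝ (LieAlg E G) :=
  LieSubalgebra.lieSpan ℝ (LieAlg E G) {Z | ∀ t : ℝ, lieExp (t • Z) ∈ H}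

/-- The restriction `x|_𝔥` of a linear form `x ∈ 𝔤*` to the Lie algebra of `H`. -/
def restrictDual (H : Subgroup G) (x : Module.Dual ℝ (LieAlg E G)) :
    Module.Dual ℝ (subgroupLieAlg E H) :=
  x ∘ₗ (subgroupLieAlg E H).toSubmodule.subtype

/-- The state `m` of `G` is localized at `Y ⊆ 𝔥*`: its restriction to the closed subgroup `H` is a
quantum state of `H` for `Y`. (The exponential map of `H` is the restriction of that of `G`.) -/
def IsLocalizedAt (H : Subgroup G) (Y : Set (Module.Dual ℝ (subgroupLieAlg E H))) (m : G → ℂ) :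
    Prop :=
  IsQuantumStateWith (fun (Z : subgroupLieAlg E H) (h : H) => (h : G) = lieExp (Z : LieAlg E G)) Y
    (fun h : H => m h)

/-! ### Subordinate subgroups -/

/-- The function `ξ` on `G` with `ξ(exp Z) = exp(i⟨x, Z⟩)`. It is used only when `exp` is bijective
(as it is for simply connected nilpotent groups), and then `Function.invFun lieExp` is its
inverse. -/
def xi (x : Module.Dual ℝ (LieAlg E G)) (g : G) : ℂ :=
  Complex.exp (Complex.I * (x (Function.invFun (lieExp : LieAlg E G → G) g) : ℝ))

/-- `H` is subordinate to `x`: it is a closed connected subgroup and the restriction of `ξ` to `H` is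
a character. (As `ξ` is continuous of modulus one, this means that it is multiplicative on `H`.) -/
structure IsSubordinate (x : Module.Dual ℝ (LieAlg E G)) (H : Subgroup G) : Prop where
  isClosed : IsClosed (H : Set G)
  isConnected : IsConnected (H : Set G)
  map_mul : ∀ h ∈ H, ∀ k ∈ H, xi x (h * k) = xi x h * xi x k

end Group

end LieQuantum

end

noncomputable section

set_option linter.unusedSectionVars false

namespace LieQuantum

/-! ### Polynomial curves -/

section PolyCurve

variable {V W : Type*} [AddCommGroup V] [Module ℝ V] [AddCommGroup W] [Module ℝ W]

/-! Uniqueness. The orbit of `H` is a single point, so the defining inequality for `0` and `log h`,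
with coefficients `ξ(h)` and `-1`, forces `m = ξ` on `H` (`eq_xi_of_isLocalizedAt`). As `|m| = 1`
there, the cyclic vector of the unitary representation attached to `m` is an eigenvector of `H`,
whence `m(hg) = ξ(h) m(g)` and `m(gh) = m(g) ξ(h)`. That `m` vanishes off `H` is proved along the
chain of iterated normalizers `K` of `H`, which reaches `G` by nilpotency. Let `g ∉ H` normalize
`K`. If `g` conjugates `H` into itself, `m(g) ≠ 0` would force `g` to fix `ξ|_H`, and then `𝔥 + ℝ
log g` would contradict maximality. Otherwise some `h' = ghg⁻¹` lies in `K` but not in `H`. Its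
powers lie in distinct cosets of `H`, so they give orthonormal vectors by induction, while
`|m(h'ⁿg)| = |m(ghⁿ)| = |m(g)|` for all `n`; Bessel's inequality then gives `m(g) = 0`
(`eq_zero_of_mem_normalizer`).

Existence. The extension of `ξ|_H` by zero is a coefficient of an induced representation, hence a
state. Its inequality comes from averaging over the orbit. Let `N` be the space `orbitKernel` of
those `Z` whose hamiltonian is constant on the orbit; maximality gives `N ⊆ 𝔥`. For generic `W`, the
phase of `t ↦ exp(i⟨x, Ad(exp tW)V⟩)` is a polynomial, so the mean is `exp(i⟨x,V⟩)` if `V ∈ N` and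
`0` otherwise: in the mean, exponentials behave like characters of `𝔤/N`. The given exponential sum
is averaged against `|Q|²`, where `Q` is a sum of normalized exponentials over a Følner set `S` in
`𝔥/N`. This kills the terms outside `𝔥`, keeps the others up to a factor close to `|S|`, and the
mean of `|Q|²` is `|S|` (`norm_sum_card_le`, `norm_sum_ite_le`).

Foundations. Both halves reduce to linear algebra because `exp` has a continuous inverse `log`, and
`log(exp A exp tB)` is a polynomial in `t` equal to `A + tB` modulo brackets. Polynomiality makes
the Zariski closure of a subordinate subgroup subordinate. Hence a maximal `H` contains the
one-parameter subgroups of its elements, and `𝔥 = log H` is maximal among the subalgebras on whose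
brackets `x` vanishes (`maxSubalgebra`, `le_maxSubalgebra`). -/

variable (V) in
/-- The polynomial curves `ℝ → V` in a real vector space. -/
def polyCurve : Submodule ℝ (ℝ → V) :=
  Submodule.span ℝ (Set.range fun (p : ℕ × V) (t : ℝ) => t ^ p.1 • p.2)

theorem monomial_mem_polyCurve (n : ℕ) (v : V) : (fun t : ℝ => t ^ n • v) ∈ polyCurve V :=
  Submodule.subset_span ⟨(n, v), rfl⟩

theorem const_mem_polyCurve (v : V) : (fun _ : ℝ => v) ∈ polyCurve V := by
  simpa using monomial_mem_polyCurve 0 v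

theorem smul_mem_polyCurve (v : V) : (fun t : ℝ => t • v) ∈ polyCurve V := by
  simpa using monomial_mem_polyCurve 1 v

theorem map_mem_polyCurve (l : V →ₗ[ℝ] W) {f : ℝ → V} (hf : f ∈ polyCurve V) :
    (fun t => l (f t)) ∈ polyCurve W := by
  induction hf using Submodule.span_induction with
  | mem f h =>
    obtain ⟨⟨n, v⟩, rfl⟩ := h
    simp only [map_smul]
    exact monomial_mem_polyCurve n (l v)
  | zero => simpa using const_mem_polyCurve (0 : W)
  | add f g _ _ hf hg => simpa using! add_mem hf hg
  | smul a f _ hf => simpa using! Submodule.smul_mem _ a hf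

theorem comp_mul_mem_polyCurve (a : ℝ) {f : ℝ → V} (hf : f ∈ polyCurve V) :
    (fun t => f (a * t)) ∈ polyCurve V := by
  induction hf using Submodule.span_induction with
  | mem f h =>
    obtain ⟨⟨n, v⟩, rfl⟩ := h
    convert! Submodule.smul_mem _ (a ^ n) (monomial_mem_polyCurve n v) using 2 with t
    simp [mul_pow, mul_smul]
  | zero => simpa using! const_mem_polyCurve (0 : V)
  | add f g _ _ hf hg => simpa using! add_mem hf hg
  | smul c f _ hf => simpa using! Submodule.smul_mem _ c hf

theorem exists_polynomial_of_mem_polyCurve {f : ℝ → ℝ} (hf : f ∈ polyCurve ℝ) :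
    ∃ p : Polynomial ℝ, ∀ t, f t = p.eval t := by
  induction hf using Submodule.span_induction with
  | mem f h =>
    obtain ⟨⟨n, v⟩, rfl⟩ := h
    exact ⟨Polynomial.C v * Polynomial.X ^ n, fun t => by
      rw [Polynomial.eval_mul, Polynomial.eval_C, Polynomial.eval_pow, Polynomial.eval_X,
        mul_comm]
      rfl⟩
  | zero => exact ⟨0, by simp⟩
  | add f g _ _ hf hg =>
    obtain ⟨p, hp⟩ := hf
    obtain ⟨q, hq⟩ := hg
    exact ⟨p + q, fun t => by simp [hp, hq]⟩
  | smul a f _ hf =>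
    obtain ⟨p, hp⟩ := hf
    exact ⟨Polynomial.C a * p, fun t => by simp [hp]⟩

/-- A real polynomial curve that vanishes on an infinite set is zero. -/
theorem eq_zero_of_mem_polyCurve {f : ℝ → ℝ} (hf : f ∈ polyCurve ℝ) {S : Set ℝ}
    (hS : S.Infinite) (h : ∀ t ∈ S, f t = 0) (t : ℝ) : f t = 0 := by
  obtain ⟨p, hp⟩ := exists_polynomial_of_mem_polyCurve hf
  have : p = 0 := Polynomial.eq_zero_of_infinite_isRoot p
    (hS.mono fun t ht => by simpa [Polynomial.IsRoot, ← hp] using h t ht)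
  simp [hp, this]

theorem eq_zero_of_mem_polyCurve_of_nat {f : ℝ → ℝ} (hf : f ∈ polyCurve ℝ)
    (h : ∀ n : ℕ, f n = 0) (t : ℝ) : f t = 0 :=
  eq_zero_of_mem_polyCurve hf (Set.infinite_range_of_injective Nat.cast_injective)
    (by rintro _ ⟨n, rfl⟩; exact h n) t

/-- `f` is the derivative of the curve `Y`, tested against linear forms. -/
def HasWeakDeriv (Y f : ℝ → V) : Prop :=
  ∀ (l : Module.Dual ℝ V) (t : ℝ), HasDerivAt (fun s => l (Y s)) (l (f t)) t

theorem HasWeakDeriv.add {Y f Z g : ℝ → V} (h : HasWeakDeriv Y f) (h' : HasWeakDeriv Z g) :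
    HasWeakDeriv (Y + Z) (f + g) := fun l t => by
  simpa using! (h l t).add (h' l t)

theorem HasWeakDeriv.const_smul {Y f : ℝ → V} (h : HasWeakDeriv Y f) (a : ℝ) :
    HasWeakDeriv (a • Y) (a • f) := fun l t => by
  simpa using! (h l t).const_mul a

theorem hasWeakDeriv_line (A B : V) : HasWeakDeriv (fun t : ℝ => A + t • B) fun _ => B :=
  fun l t => by simpa using ((hasDerivAt_id t).mul_const (l B)).const_add (l A)

theorem exists_antideriv {f : ℝ → V} (hf : f ∈ polyCurve V) :
    ∃ Y ∈ polyCurve V, Y 0 = 0 ∧ HasWeakDeriv Y f := by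
  induction hf using Submodule.span_induction with
  | mem f h =>
    obtain ⟨⟨n, v⟩, rfl⟩ := h
    refine ⟨fun t => t ^ (n + 1) • ((n + 1 : ℝ)⁻¹ • v), monomial_mem_polyCurve _ _, by simp, ?_⟩
    intro l t
    have h := (hasDerivAt_pow (n + 1) t).mul_const ((n + 1 : ℝ)⁻¹ * l v)
    have h0 : (n + 1 : ℝ) ≠ 0 := by positivity
    simp only [map_smul, smul_eq_mul]
    convert! h using 1
    simp
    field_simp
  | zero => exact ⟨0, zero_mem _, rfl, fun l t => by simpa using! hasDerivAt_const t (0 : ℝ)⟩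
  | add f g _ _ hf hg =>
    obtain ⟨Y, hY, hY0, hY'⟩ := hf
    obtain ⟨Z, hZ, hZ0, hZ'⟩ := hg
    exact ⟨Y + Z, add_mem hY hZ, by simp [hY0, hZ0], hY'.add hZ'⟩
  | smul a f _ hf =>
    obtain ⟨Y, hY, hY0, hY'⟩ := hf
    exact ⟨a • Y, Submodule.smul_mem _ a hY, by simp [hY0], hY'.const_smul a⟩

/-- Reduces membership in a subspace to scalar functions, where the facts on real polynomials and
derivatives apply. -/
theorem mem_of_forall_dual {S : Submodule ℝ V} {v : V}
    (h : ∀ l : Module.Dual ℝ V, (∀ s ∈ S, l s = 0) → l v = 0) : v ∈ S := by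
  by_contra hv
  obtain ⟨l, hl, hS⟩ := Submodule.exists_le_ker_of_notMem hv
  exact hl (h l fun s hs => hS hs)

theorem HasWeakDeriv.mem {Y f : ℝ → V} (h : HasWeakDeriv Y f) (h0 : Y 0 = 0) {S : Submodule ℝ V}
    (hS : ∀ t, f t ∈ S) (t : ℝ) : Y t ∈ S := by
  refine mem_of_forall_dual fun l hl => ?_
  have h1 : ∀ t, HasDerivAt (fun s => l (Y s)) 0 t := fun t => by
    simpa [hl _ (hS t)] using h l t
  have h2 := is_const_of_deriv_eq_zero (fun t => (h1 t).differentiableAt) (fun t => (h1 t).deriv) t 0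
  simpa [h0] using h2

end PolyCurve

/-! ### The exponential of `ad` and the derivative of the exponential map -/

section LieAd

variable {L : Type*} [LieRing L] [LieAlgebra ℝ L]

theorem lie_mem_polyCurve {f g : ℝ → L} (hf : f ∈ polyCurve L) (hg : g ∈ polyCurve L) :
    (fun t => ⁅f t, g t⁆) ∈ polyCurve L := by
  induction hf using Submodule.span_induction with
  | mem f h =>
    obtain ⟨⟨n, v⟩, rfl⟩ := h
    induction hg using Submodule.span_induction with
    | mem f h =>
      obtain ⟨⟨m, w⟩, rfl⟩ := h
      simpa [smul_smul, ← pow_add] using monomial_mem_polyCurve (m + n) ⁅v, w⁆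
    | zero => simpa using! const_mem_polyCurve (0 : L)
    | add f g _ _ hf hg => simpa using! add_mem hf hg
    | smul c f _ hf =>
      convert! Submodule.smul_mem _ c hf using 2
      simp [smul_comm c]
  | zero => simpa using! const_mem_polyCurve (0 : L)
  | add f g _ _ hf hg => simpa using! add_mem hf hg
  | smul c f _ hf =>
      convert! Submodule.smul_mem _ c hf using 2
      simp

/-- `Σ_{j ≤ d} tʲ/j! (ad Z)ʲ W`, which is `e^{t ad Z} W` if `d` is large. -/
def expAd (d : ℕ) (t : ℝ) (Z : L) : L →ₗ[ℝ] L :=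
  ∑ j ∈ Finset.range (d + 1), (t ^ j / j.factorial) • (LieAlgebra.ad ℝ L Z) ^ j

/-- `Σ_{j ≤ d} (-1)ʲ/(j+1)! (ad Z)ʲ`, the left logarithmic derivative of `exp` at `Z` if `d` is
large. -/
def dexp (d : ℕ) (Z : L) : L →ₗ[ℝ] L :=
  ∑ j ∈ Finset.range (d + 1), ((-1) ^ j / (j + 1).factorial : ℝ) • (LieAlgebra.ad ℝ L Z) ^ j

theorem expAd_apply (d : ℕ) (t : ℝ) (Z W : L) : expAd d t Z W =
    ∑ j ∈ Finset.range (d + 1), (t ^ j / j.factorial) • ((LieAlgebra.ad ℝ L Z) ^ j) W := by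
  simp [expAd, LinearMap.sum_apply]

theorem dexp_apply (d : ℕ) (Z W : L) : dexp d Z W =
    ∑ j ∈ Finset.range (d + 1),
      ((-1) ^ j / (j + 1).factorial : ℝ) • ((LieAlgebra.ad ℝ L Z) ^ j) W := by
  simp [dexp, LinearMap.sum_apply]

theorem ad_pow_mem_polyCurve {f g : ℝ → L} (hf : f ∈ polyCurve L) (hg : g ∈ polyCurve L) (j : ℕ) :
    (fun t => ((LieAlgebra.ad ℝ L (f t)) ^ j) (g t)) ∈ polyCurve L := by
  induction j with
  | zero => simpa using hg
  | succ j ih => simpa [pow_succ'] using lie_mem_polyCurve hf ih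

theorem dexp_mem_polyCurve (d : ℕ) {f g : ℝ → L} (hf : f ∈ polyCurve L) (hg : g ∈ polyCurve L) :
    (fun t => dexp d (f t) (g t)) ∈ polyCurve L := by
  simp only [dexp_apply]
  have := Submodule.sum_mem (polyCurve L) (t := Finset.range (d + 1)) (fun j _ =>
    Submodule.smul_mem _ ((-1) ^ j / (j + 1).factorial : ℝ) (ad_pow_mem_polyCurve hf hg j))
  convert! this using 2
  simp

theorem expAd_mem_polyCurve (d : ℕ) (t : ℝ) {f g : ℝ → L} (hf : f ∈ polyCurve L)
    (hg : g ∈ polyCurve L) : (fun s => expAd d t (f s) (g s)) ∈ polyCurve L := by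
  simp only [expAd_apply]
  have := Submodule.sum_mem (polyCurve L) (t := Finset.range (d + 1)) (fun j _ =>
    Submodule.smul_mem _ (t ^ j / j.factorial : ℝ) (ad_pow_mem_polyCurve hf hg j))
  convert! this using 2
  simp

theorem expAd_smul (d : ℕ) (t : ℝ) (Z : L) : expAd d 1 (t • Z) = expAd d t Z := by
  simp only [expAd, map_smul, smul_pow, one_pow, smul_smul]
  exact Finset.sum_congr rfl fun j _ => by rw [one_div_mul_eq_div]

/-- `dexp d Z - 1` is a sum of iterated brackets. -/
theorem dexp_sub_mem (d : ℕ) {Z W : L} {S : Submodule ℝ L}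
    (h : ∀ j, ((LieAlgebra.ad ℝ L Z) ^ (j + 1)) W ∈ S) : dexp d Z W - W ∈ S := by
  rw [dexp_apply, Finset.sum_range_succ']
  simpa using Submodule.sum_mem S fun j _ => Submodule.smul_mem _ _ (h j)

open LieModule in
theorem ad_pow_mem_lowerCentralSeries (Z : L) {W : L} {k : ℕ}
    (hW : W ∈ lowerCentralSeries ℝ L L k) (j : ℕ) :
    ((LieAlgebra.ad ℝ L Z) ^ j) W ∈ lowerCentralSeries ℝ L L (k + j) := by
  induction j with
  | zero => simpa using hW
  | succ j ih =>
    rw [pow_succ', ← add_assoc, lowerCentralSeries_succ]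
    exact LieSubmodule.lie_mem_lie (LieSubmodule.mem_top _) ih

-- Every term of `dexp` except the one with `j = 0` contains a bracket. So `dexp` is unipotent along
-- the lower central series, which drives both its injectivity and the successive approximation
-- below.
open LieModule in
theorem dexp_sub_mem_lowerCentralSeries (d : ℕ) (Z : L) {W : L} {k : ℕ}
    (hW : W ∈ lowerCentralSeries ℝ L L k) :
    dexp d Z W - W ∈ lowerCentralSeries ℝ L L (k + 1) :=
  dexp_sub_mem d (S := (lowerCentralSeries ℝ L L (k + 1)).toSubmodule) fun j =>
    antitone_lowerCentralSeries ℝ L L (by lia) (ad_pow_mem_lowerCentralSeries Z hW (j + 1))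

-- By telescoping: the difference of the `(j+1)`-st powers is `[Z, ·]` of the difference of the
-- `j`-th ones plus a bracket with `Z - Z'`.
open LieModule in
theorem dexp_sub_dexp_mem (d : ℕ) {Z Z' : L} (W : L) {k : ℕ}
    (h : Z - Z' ∈ lowerCentralSeries ℝ L L k) :
    dexp d Z W - dexp d Z' W ∈ lowerCentralSeries ℝ L L (k + 1) := by
  have key : ∀ j, ((LieAlgebra.ad ℝ L Z) ^ j) W - ((LieAlgebra.ad ℝ L Z') ^ j) W ∈
      lowerCentralSeries ℝ L L (k + 1) := by
    intro j
    induction j with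
    | zero => simp
    | succ j ih =>
      have h1 : ⁅Z - Z', ((LieAlgebra.ad ℝ L Z') ^ j) W⁆ ∈ lowerCentralSeries ℝ L L (k + 1) := by
        rw [lowerCentralSeries_succ, ← lie_skew]
        exact neg_mem (LieSubmodule.lie_mem_lie (LieSubmodule.mem_top _) h)
      have h2 := LieSubmodule.lie_mem (lowerCentralSeries ℝ L L (k + 1)) (x := Z) ih
      convert add_mem h2 h1 using 1
      simp [pow_succ']
  rw [dexp_apply, dexp_apply, ← Finset.sum_sub_distrib]
  exact sum_mem fun j _ => by rw [← smul_sub]; exact Submodule.smul_mem _ _ (key j)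

variable {d : ℕ}

open LieModule in
theorem ad_pow_eq_zero (hd : lowerCentralSeries ℝ L L d = ⊥) (Z W : L) {j : ℕ} (hj : d ≤ j) :
    ((LieAlgebra.ad ℝ L Z) ^ j) W = 0 := by
  have h := antitone_lowerCentralSeries ℝ L L hj
    (by simpa using ad_pow_mem_lowerCentralSeries Z (W := W) (k := 0) (by simp) j)
  simpa [hd] using h

-- A vector killed by `dexp` descends from each term of the lower central series to the next, since
-- `dexp` is the identity modulo the next term.
open LieModule in
theorem dexp_injective (hd : lowerCentralSeries ℝ L L d = ⊥) (Z : L) :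
    Function.Injective (dexp d Z) := by
  rw [← LinearMap.ker_eq_bot, LinearMap.ker_eq_bot']
  intro W hW
  have : ∀ k, W ∈ lowerCentralSeries ℝ L L k := by
    intro k
    induction k with
    | zero => simp
    | succ k ih => simpa [hW] using dexp_sub_mem_lowerCentralSeries d Z ih
  simpa [hd] using this d

-- Follows from `e^{ad Z} W - W = dexp(-Z) [Z, W]` and the injectivity of `dexp`.
open LieModule in
theorem lie_eq_zero_of_expAd (hd : lowerCentralSeries ℝ L L d = ⊥) {Z W : L}
    (h : expAd d 1 Z W = W) : ⁅Z, W⁆ = 0 := by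
  apply dexp_injective hd (-Z)
  rw [expAd_apply, Finset.sum_range_succ'] at h
  simp only [pow_zero, Module.End.one_apply, Nat.factorial_zero, Nat.cast_one, div_one,
    one_smul, add_eq_right] at h
  have hsucc : ∀ j, ((LieAlgebra.ad ℝ L Z) ^ j) ⁅Z, W⁆ = ((LieAlgebra.ad ℝ L Z) ^ (j + 1)) W :=
    fun j => by rw [pow_succ, Module.End.mul_apply, LieAlgebra.ad_apply]
  have hneg : ∀ j, ((LieAlgebra.ad ℝ L (-Z)) ^ j) ⁅Z, W⁆ =
      ((-1) ^ j : ℝ) • ((LieAlgebra.ad ℝ L Z) ^ (j + 1)) W := by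
    intro j
    rw [← hsucc, ← LinearMap.smul_apply, ← smul_pow, map_neg, neg_one_smul]
  rw [map_zero, ← h, dexp_apply, Finset.sum_range_succ, hneg, ad_pow_eq_zero hd Z W (Nat.le_succ d),
    smul_zero, smul_zero, add_zero]
  refine Finset.sum_congr rfl fun j _ => ?_
  rw [hneg, smul_smul, div_mul_eq_mul_div, ← mul_pow]
  simp

open LieModule in
/-- The logarithm of `exp A exp (t B)` is a polynomial curve: there is a polynomial curve `Y` with
`Y 0 = A` and left logarithmic derivative `B`. -/
theorem exists_polyCurve_dexp (hd : lowerCentralSeries ℝ L L d = ⊥) (A B : L) :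
    ∃ Y ∈ polyCurve L, ∃ f : ℝ → L, HasWeakDeriv Y f ∧ Y 0 = A ∧ (∀ t, dexp d (Y t) (f t) = B) ∧
      ∀ (T : LieSubalgebra ℝ L) (N : Submodule ℝ L), A ∈ T → B ∈ T →
        (∀ v ∈ T, ∀ w ∈ T, ⁅v, w⁆ ∈ N) → ∀ t, Y t ∈ T ∧ Y t - (A + t • B) ∈ N := by
  -- Successive approximation: the equation `dexp(Y) Y' = B` is solved modulo the `k`-th term of the
  -- lower central series, starting from the line `A + tB`. The clause on `T` and `N` is carried
  -- along to control where the solution lies.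
  suffices H : ∀ k, ∃ Y ∈ polyCurve L, ∃ f ∈ polyCurve L, HasWeakDeriv Y f ∧ Y 0 = A ∧
      (∀ t, B - dexp d (Y t) (f t) ∈ lowerCentralSeries ℝ L L k) ∧
      ∀ (T : LieSubalgebra ℝ L) (N : Submodule ℝ L), A ∈ T → B ∈ T →
        (∀ v ∈ T, ∀ w ∈ T, ⁅v, w⁆ ∈ N) → ∀ t, Y t ∈ T ∧ f t ∈ T ∧ Y t - (A + t • B) ∈ N ∧
          f t - B ∈ N by
    obtain ⟨Y, hY, f, -, h1, h2, h3, h4⟩ := H d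
    refine ⟨Y, hY, f, h1, h2, fun t => ?_, fun T N hA hB hN t => ⟨(h4 T N hA hB hN t).1,
      (h4 T N hA hB hN t).2.2.1⟩⟩
    have := h3 t
    rw [hd, LieSubmodule.mem_bot, sub_eq_zero] at this
    exact this.symm
  intro k
  induction k with
  | zero =>
    refine ⟨fun t => A + t • B, add_mem (const_mem_polyCurve A) (smul_mem_polyCurve B), fun _ => B,
      const_mem_polyCurve B, hasWeakDeriv_line A B, by simp, by simp, ?_⟩
    intro T N hA hB hN t
    exact ⟨add_mem hA (T.smul_mem t hB), hB, by simp, by simp⟩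
  | succ k ih =>
    obtain ⟨Y, hY, f, hf, h1, h2, h3, h4⟩ := ih
    have hr : (fun t => B - dexp d (Y t) (f t)) ∈ polyCurve L :=
      sub_mem (const_mem_polyCurve B) (dexp_mem_polyCurve d hY hf)
    -- The correction is the primitive of the defect. It lies in the `k`-th term, so replacing `Y`
    -- by `Y + R` inside `dexp` costs only an error in the next term, while adding the defect to `f`
    -- cancels it modulo that term.
    obtain ⟨R, hR, hR0, hR'⟩ := exists_antideriv hr
    refine ⟨Y + R, add_mem hY hR, _, add_mem hf hr, h1.add hR', by simp [h2, hR0], ?_, ?_⟩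
    · intro t
      have a1 := dexp_sub_dexp_mem d (Z := (Y + R) t) (Z' := Y t) (f t) (k := k)
        (by simpa using hR'.mem hR0 (S := (lowerCentralSeries ℝ L L k).toSubmodule) h3 t)
      have a2 := dexp_sub_mem_lowerCentralSeries d ((Y + R) t) (h3 t)
      convert neg_mem (add_mem a1 a2) using 1
      simp only [Pi.add_apply, map_add]
      abel
    · intro T N hA hB hN t
      have hadT : ∀ {v w : L} (j : ℕ), v ∈ T → w ∈ T → ((LieAlgebra.ad ℝ L v) ^ j) w ∈ T := by
        intro v w j hv hw
        induction j with
        | zero => simpa using hw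
        | succ j ih => simpa [pow_succ'] using T.lie_mem hv ih
      have hr1 : ∀ t, B - dexp d (Y t) (f t) ∈ T := by
        intro t
        obtain ⟨b1, b2, -, -⟩ := h4 T N hA hB hN t
        have := dexp_sub_mem d (S := T.toSubmodule) fun j => hadT (j + 1) b1 b2
        convert sub_mem (sub_mem hB b2) this using 1
        abel
      have hr2 : ∀ t, B - dexp d (Y t) (f t) ∈ N := by
        intro t
        obtain ⟨b1, b2, -, b4⟩ := h4 T N hA hB hN t
        have := dexp_sub_mem d (Z := Y t) (W := f t) (S := N) fun j => by
          simpa [pow_succ'] using hN _ b1 _ (hadT j b1 b2)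
        convert neg_mem (add_mem b4 this) using 1
        abel
      obtain ⟨b1, b2, b3, b4⟩ := h4 T N hA hB hN t
      refine ⟨add_mem b1 (hR'.mem hR0 (S := T.toSubmodule) hr1 t), add_mem b2 (hr1 t), ?_, ?_⟩
      · convert add_mem b3 (hR'.mem hR0 hr2 t) using 1
        simp only [Pi.add_apply]
        abel
      · convert add_mem b4 (hr2 t) using 1
        simp only [Pi.add_apply]
        abel

/-- The sum of a Lie subalgebra and a subspace, when it is closed under the bracket. -/
def supSubalgebra (K : LieSubalgebra ℝ L) (I : Submodule ℝ L)
    (hKI : ∀ v ∈ K, ∀ w ∈ I, ⁅v, w⁆ ∈ K.toSubmodule ⊔ I)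
    (hI : ∀ v ∈ I, ∀ w ∈ I, ⁅v, w⁆ ∈ K.toSubmodule ⊔ I) : LieSubalgebra ℝ L where
  toSubmodule := K.toSubmodule ⊔ I
  lie_mem' := by
    intro a b ha hb
    obtain ⟨v, hv, w, hw, rfl⟩ := Submodule.mem_sup.1 ha
    obtain ⟨v', hv', w', hw', rfl⟩ := Submodule.mem_sup.1 hb
    have h1 := Submodule.mem_sup_left (T := I) (K.lie_mem hv hv')
    have h2 := hKI v hv w' hw'
    have h3 := hKI v' hv' w hw
    have h4 := hI w hw w' hw'
    have h5 : ⁅v + w, v' + w'⁆ = ⁅v, v'⁆ + ⁅v, w'⁆ - ⁅v', w⁆ + ⁅w, w'⁆ := by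
      rw [← lie_skew v' w]
      simp only [add_lie, lie_add]
      abel
    exact h5 ▸ add_mem (sub_mem (add_mem h1 h2) h3) h4

end LieAd

/-! ### Calculus in the chart at the identity -/

section Chart

open Topology

variable (E : Type*) [NormedAddCommGroup E] [NormedSpace ℝ E]
  (G : Type*) [TopologicalSpace G] [ChartedSpace E G] [Group G]

/-- The chart at the identity. -/
abbrev oneChart : OpenPartialHomeomorph G E := chartAt E (1 : G)

variable {E G}

theorem one_mem_oneChart_source : (1 : G) ∈ (oneChart E G).source := mem_chart_source E 1

theorem oneChart_one_mem_target : oneChart E G 1 ∈ (oneChart E G).target :=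
  (oneChart E G).map_source one_mem_oneChart_source

theorem oneChart_symm_one : (oneChart E G).symm (oneChart E G 1) = 1 :=
  (oneChart E G).left_inv one_mem_oneChart_source

variable (E G) in
/-- The multiplication of `G`, in the chart at the identity. -/
def chartMul (p : E × E) : E :=
  oneChart E G ((oneChart E G).symm p.1 * (oneChart E G).symm p.2)

variable (E G) in
/-- The derivative of the left translation by (the point with coordinates) `a`, at the identity. -/
def chartLeft (a : E) : E →L[ℝ] E :=
  fderiv ℝ (fun b => chartMul E G (a, b)) (oneChart E G 1)

variable (E) in
/-- `γ` has left logarithmic derivative `W` at `t`. -/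
structure HasLogDeriv (γ : ℝ → G) (W : E) (t : ℝ) : Prop where
  continuousAt : ContinuousAt γ t
  hasDerivAt : HasDerivAt (fun s => oneChart E G ((γ t)⁻¹ * γ s)) W t

variable [LieGroup 𝓘(ℝ, E) ∞ G]

theorem isTopologicalGroup (E : Type*) [NormedAddCommGroup E] [NormedSpace ℝ E] (G : Type*)
    [TopologicalSpace G] [ChartedSpace E G] [Group G] [LieGroup 𝓘(ℝ, E) ∞ G] :
    IsTopologicalGroup G :=
  topologicalGroup_of_lieGroup 𝓘(ℝ, E) (∞ : WithTop ℕ∞)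

theorem contDiffAt_oneChart_comp {V : Type*} [NormedAddCommGroup V] [NormedSpace ℝ V] {f : V → G}
    {v : V} (hf : ContMDiffAt 𝓘(ℝ, V) 𝓘(ℝ, E) ∞ f v) (hv : f v ∈ (oneChart E G).source) :
    ContDiffAt ℝ ∞ (fun w => oneChart E G (f w)) v := by
  have : IsManifold 𝓘(ℝ, E) ∞ G := inferInstance
  rw [← contMDiffAt_iff_contDiffAt]
  exact ContMDiffAt.comp v ((contMDiffOn_chart (I := 𝓘(ℝ, E)) (n := ∞) (x := (1 : G))).contMDiffAt
    ((oneChart E G).open_source.mem_nhds hv)) hf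

theorem contMDiffAt_oneChart_symm {a : E} (ha : a ∈ (oneChart E G).target) :
    ContMDiffAt 𝓘(ℝ, E) 𝓘(ℝ, E) ∞ (oneChart E G).symm a :=
  have : IsManifold 𝓘(ℝ, E) ∞ G := inferInstance
  (contMDiffOn_chart_symm (I := 𝓘(ℝ, E)) (n := ∞) (x := (1 : G))).contMDiffAt
    ((oneChart E G).open_target.mem_nhds ha)

theorem contDiffAt_chartMul {a b : E} (ha : a ∈ (oneChart E G).target)
    (hb : b ∈ (oneChart E G).target)
    (hab : (oneChart E G).symm a * (oneChart E G).symm b ∈ (oneChart E G).source) :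
    ContDiffAt ℝ ∞ (chartMul E G) (a, b) := by
  refine contDiffAt_oneChart_comp (f := fun p : E × E => (oneChart E G).symm p.1 *
    (oneChart E G).symm p.2) (ContMDiffAt.mul ?_ ?_) hab
  · exact ContMDiffAt.comp (a, b) (f := Prod.fst) (contMDiffAt_oneChart_symm ha)
      contDiff_fst.contMDiff.contMDiffAt
  · exact ContMDiffAt.comp (a, b) (f := Prod.snd) (contMDiffAt_oneChart_symm hb)
      contDiff_snd.contMDiff.contMDiffAt

theorem contDiffAt_chartMul_left {a : E} (ha : a ∈ (oneChart E G).target) :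
    ContDiffAt ℝ ∞ (chartMul E G) (a, oneChart E G 1) :=
  contDiffAt_chartMul ha oneChart_one_mem_target
    (by simpa [oneChart_symm_one] using (oneChart E G).map_target ha)

theorem contDiffAt_chartMul_right {a : E} (ha : a ∈ (oneChart E G).target) :
    ContDiffAt ℝ ∞ (chartMul E G) (oneChart E G 1, a) :=
  contDiffAt_chartMul oneChart_one_mem_target ha
    (by simpa [oneChart_symm_one] using (oneChart E G).map_target ha)

theorem chartMul_one {a : E} (ha : a ∈ (oneChart E G).target) :
    chartMul E G (a, oneChart E G 1) = a := by
  simp [chartMul, (oneChart E G).right_inv ha]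

theorem one_chartMul {a : E} (ha : a ∈ (oneChart E G).target) :
    chartMul E G (oneChart E G 1, a) = a := by
  simp [chartMul, (oneChart E G).right_inv ha]

theorem target_mem_nhds : (oneChart E G).target ∈ 𝓝 (oneChart E G 1) :=
  (oneChart E G).open_target.mem_nhds oneChart_one_mem_target

theorem source_mem_nhds : (oneChart E G).source ∈ 𝓝 (1 : G) :=
  (oneChart E G).open_source.mem_nhds one_mem_oneChart_source

theorem hasFDerivAt_chartLeft {a : E} (ha : a ∈ (oneChart E G).target) :
    HasFDerivAt (fun b => chartMul E G (a, b)) (chartLeft E G a) (oneChart E G 1) := by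
  apply DifferentiableAt.hasFDerivAt
  exact ((contDiffAt_chartMul_left ha).differentiableAt (by simp)).comp _
    ((differentiableAt_const a).prodMk differentiableAt_id)

theorem chartLeft_one : chartLeft E G (oneChart E G 1) = ContinuousLinearMap.id ℝ E := by
  refine (hasFDerivAt_chartLeft oneChart_one_mem_target).unique ?_
  refine (hasFDerivAt_id _).congr_of_eventuallyEq ?_
  filter_upwards [target_mem_nhds] with a ha
  simp [one_chartMul ha]

theorem hasFDerivAt_chartMul_one : HasFDerivAt (chartMul E G)
    (ContinuousLinearMap.fst ℝ E E + ContinuousLinearMap.snd ℝ E E)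
    (oneChart E G 1, oneChart E G 1) := by
  have h := ((contDiffAt_chartMul_left (E := E) (G := G) oneChart_one_mem_target).differentiableAt
    (by simp)).hasFDerivAt
  have h1 : HasFDerivAt (fun a => chartMul E G (a, oneChart E G 1)) (ContinuousLinearMap.id ℝ E)
      (oneChart E G 1) := by
    refine (hasFDerivAt_id _).congr_of_eventuallyEq ?_
    filter_upwards [target_mem_nhds] with a ha
    simp [chartMul_one ha]
  have h2 := hasFDerivAt_chartLeft (E := E) (G := G) oneChart_one_mem_target
  rw [chartLeft_one] at h2
  have h1' := h1.unique (h.comp (f := fun a => (a, oneChart E G 1)) (oneChart E G 1)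
    ((hasFDerivAt_id _).prodMk (hasFDerivAt_const _ _)))
  have h2' := h2.unique (h.comp (f := fun a => (oneChart E G 1, a)) (oneChart E G 1)
    ((hasFDerivAt_const _ _).prodMk (hasFDerivAt_id _)))
  have key : ContinuousLinearMap.fst ℝ E E + ContinuousLinearMap.snd ℝ E E =
      fderiv ℝ (chartMul E G) (oneChart E G 1, oneChart E G 1) := by
    ext v
    · simpa using congrArg (fun l => l v) h1'
    · simpa using congrArg (fun l => l v) h2'
  rw [key]
  exact h

/-- The partial derivative is a restriction of the full derivative of the smooth map `chartMul`. -/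
theorem continuousOn_chartLeft : ContinuousOn (chartLeft E G) (oneChart E G).target := by
  intro a ha
  have h : ∀ a ∈ (oneChart E G).target, chartLeft E G a =
      (fderiv ℝ (chartMul E G) (a, oneChart E G 1)).comp (ContinuousLinearMap.inr ℝ E E) := by
    intro a ha
    refine (hasFDerivAt_chartLeft ha).unique ?_
    have := ((contDiffAt_chartMul_left ha).differentiableAt (by simp)).hasFDerivAt.comp
      (oneChart E G 1) ((hasFDerivAt_const a (oneChart E G 1)).prodMk (hasFDerivAt_id _))
    exact this
  refine ContinuousWithinAt.congr ?_ h (h a ha)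
  have h1 : ContinuousAt (fderiv ℝ (chartMul E G)) (a, oneChart E G 1) :=
    ((contDiffAt_chartMul_left ha).fderiv_right (m := 0) (by simp)).continuousAt
  have h2 : ContinuousAt (fun a => fderiv ℝ (chartMul E G) (a, oneChart E G 1)) a :=
    ContinuousAt.comp (f := fun a : E => (a, oneChart E G 1)) h1 (by fun_prop)
  exact (h2.clm_comp continuousAt_const).continuousWithinAt

/-- Near `t` the curve is `γ t * (γ t)⁻¹ γ s`, a left translate of a curve through the identity.
This turns a logarithmic derivative into a differential equation in the chart. -/
theorem HasLogDeriv.hasDerivAt_chart {γ : ℝ → G} {W : E} {t : ℝ} (h : HasLogDeriv E γ W t)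
    (ht : γ t ∈ (oneChart E G).source) :
    HasDerivAt (fun s => oneChart E G (γ s)) (chartLeft E G (oneChart E G (γ t)) W) t := by
  have := isTopologicalGroup E G
  have h1 := hasFDerivAt_chartLeft ((oneChart E G).map_source ht)
  have h2 := h.hasDerivAt
  rw [show oneChart E G 1 = oneChart E G ((γ t)⁻¹ * γ t) by simp] at h1
  refine (h1.comp_hasDerivAt t h2).congr_of_eventuallyEq ?_
  have h3 : ContinuousAt (fun s => (γ t)⁻¹ * γ s) t := continuousAt_const.mul h.continuousAt
  filter_upwards [h3 (by simpa using source_mem_nhds (E := E) (G := G))] with s hs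
  simp only [Function.comp, chartMul]
  rw [(oneChart E G).left_inv ht, (oneChart E G).left_inv hs, mul_inv_cancel_left]

theorem HasLogDeriv.const_mul {γ : ℝ → G} {W : E} {t : ℝ} (h : HasLogDeriv E γ W t) (g : G) :
    HasLogDeriv E (fun s => g * γ s) W t := by
  have := isTopologicalGroup E G
  exact ⟨continuousAt_const.mul h.continuousAt, by simpa [mul_assoc] using h.hasDerivAt⟩

theorem hasFDerivAt_oneChart_comp {f : G → G} (h1 : f 1 = 1) {f' : E →L[ℝ] E}
    (hf : HasMFDerivAt 𝓘(ℝ, E) 𝓘(ℝ, E) f 1 f') :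
    HasFDerivAt (fun a => oneChart E G (f ((oneChart E G).symm a))) f' (oneChart E G 1) := by
  have h2 := hf.2
  have h3 : extChartAt 𝓘(ℝ, E) (f 1) = extChartAt 𝓘(ℝ, E) (1 : G) := by rw [h1]
  simp only [writtenInExtChartAt] at h2
  rw [h3] at h2
  simp only [mfld_simps] at h2
  exact (hasFDerivWithinAt_univ (𝕜 := ℝ) (E := E) (F := E)).1 h2

variable (E) in
/-- The adjoint action, in coordinates. -/
def AdE (g : G) : E →L[ℝ] E := (Ad g : LieAlg E G →L[ℝ] LieAlg E G)

theorem hasFDerivAt_conj (g : G) :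
    HasFDerivAt (fun a => oneChart E G (g * (oneChart E G).symm a * g⁻¹))
      (AdE E g) (oneChart E G 1) := by
  apply hasFDerivAt_oneChart_comp (f := fun h => g * h * g⁻¹) (by simp)
  apply MDifferentiableAt.hasMFDerivAt
  have : ContMDiff 𝓘(ℝ, E) 𝓘(ℝ, E) ∞ (fun h : G => g * h * g⁻¹) :=
    (contMDiff_mul_right (I := 𝓘(ℝ, E)) (n := ∞) (a := g⁻¹)).comp
      (contMDiff_mul_left (I := 𝓘(ℝ, E)) (n := ∞) (a := g))
  exact this.contMDiffAt.mdifferentiableAt (by simp)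

theorem HasLogDeriv.conj {γ : ℝ → G} {W : E} {t : ℝ} (h : HasLogDeriv E γ W t) (g : G) :
    HasLogDeriv E (fun s => g * γ s * g⁻¹) ((AdE E g) W) t := by
  have := isTopologicalGroup E G
  refine ⟨(continuousAt_const.mul h.continuousAt).mul continuousAt_const, ?_⟩
  have h1 := hasFDerivAt_conj (E := E) g
  rw [show oneChart E G 1 = oneChart E G ((γ t)⁻¹ * γ t) by simp] at h1
  refine (h1.comp_hasDerivAt t h.hasDerivAt).congr_of_eventuallyEq ?_
  have h3 : ContinuousAt (fun s => (γ t)⁻¹ * γ s) t := continuousAt_const.mul h.continuousAt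
  filter_upwards [h3 (by simpa using source_mem_nhds (E := E) (G := G))] with s hs
  simp only [Function.comp]
  rw [(oneChart E G).left_inv hs]
  congr 1
  group

/-- The quotient of the product curve by its value at `t` is `η(t)⁻¹ (γ(t)⁻¹γ(s)) η(t)` times
`η(t)⁻¹η(s)`: two curves through the identity, where the derivative of multiplication is addition.
-/
theorem HasLogDeriv.mul {γ η : ℝ → G} {W V : E} {t : ℝ} (h : HasLogDeriv E γ W t)
    (h' : HasLogDeriv E η V t) :
    HasLogDeriv E (fun s => γ s * η s) (AdE E (η t)⁻¹ W + V) t := by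
  have := isTopologicalGroup E G
  refine ⟨h.continuousAt.mul h'.continuousAt, ?_⟩
  have h0 := h.conj (η t)⁻¹
  have h1 := h0.hasDerivAt.prodMk h'.hasDerivAt
  have h2 := hasFDerivAt_chartMul_one (E := E) (G := G)
  have e1 : oneChart E G 1 = oneChart E G (((η t)⁻¹ * γ t * (η t)⁻¹⁻¹)⁻¹ *
    ((η t)⁻¹ * γ t * (η t)⁻¹⁻¹)) := by rw [inv_mul_cancel]
  have e2 : oneChart E G 1 = oneChart E G ((η t)⁻¹ * η t) := by simp
  rw [show (oneChart E G 1, oneChart E G 1) = (oneChart E G (((η t)⁻¹ * γ t * (η t)⁻¹⁻¹)⁻¹ *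
    ((η t)⁻¹ * γ t * (η t)⁻¹⁻¹)), oneChart E G ((η t)⁻¹ * η t)) from Prod.ext e1 e2] at h2
  refine (h2.comp_hasDerivAt t h1).congr_of_eventuallyEq ?_
  have h3 : ContinuousAt (fun s => (η t)⁻¹ * η s) t := continuousAt_const.mul h'.continuousAt
  have h4 : ContinuousAt (fun s => ((η t)⁻¹ * γ t * (η t)⁻¹⁻¹)⁻¹ *
    ((η t)⁻¹ * γ s * (η t)⁻¹⁻¹)) t := continuousAt_const.mul h0.continuousAt
  filter_upwards [h3 (by simpa using source_mem_nhds (E := E) (G := G)),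
    h4 (by simp only [inv_mul_cancel]; exact source_mem_nhds (E := E) (G := G))] with s hs hs'
  simp only [Function.comp, chartMul]
  rw [(oneChart E G).left_inv hs, (oneChart E G).left_inv hs']
  congr 1
  group

theorem AdE_mul (g h : G) : AdE E (g * h) = (AdE E g).comp (AdE E h) := by
  have := isTopologicalGroup E G
  have h1 := hasFDerivAt_conj (E := E) g
  rw [show oneChart E G 1 = oneChart E G (h * (oneChart E G).symm (oneChart E G 1) * h⁻¹) by simp] at h1
  refine (hasFDerivAt_conj (E := E) (g * h)).unique ?_
  refine (h1.comp (oneChart E G 1)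
    (f := fun a => oneChart E G (h * (oneChart E G).symm a * h⁻¹)) (hasFDerivAt_conj h)).congr_of_eventuallyEq ?_
  have h3 : ContinuousAt (fun a => h * (oneChart E G).symm a * h⁻¹) (oneChart E G 1) :=
    (continuousAt_const.mul ((oneChart E G).continuousAt_symm oneChart_one_mem_target)).mul
      continuousAt_const
  filter_upwards [h3 (by simpa [oneChart_symm_one] using source_mem_nhds (E := E) (G := G))]
    with s hs
  simp only [Function.comp]
  rw [(oneChart E G).left_inv hs]
  congr 1
  group

theorem AdE_one : AdE E (1 : G) = ContinuousLinearMap.id ℝ E := by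
  refine (hasFDerivAt_conj (E := E) (1 : G)).unique ?_
  refine (hasFDerivAt_id _).congr_of_eventuallyEq ?_
  filter_upwards [target_mem_nhds] with a ha
  simp [(oneChart E G).right_inv ha]

end Chart

section Bracket

open Topology

variable {E : Type*} [NormedAddCommGroup E] [NormedSpace ℝ E]
  {G : Type*} [TopologicalSpace G] [ChartedSpace E G] [Group G] [LieGroup 𝓘(ℝ, E) ∞ G]

/-! ### Left translations and left logarithmic derivatives -/

variable (E) in
/-- The derivative at `h` of the left translation by `g`, in the charts at `h` and `g * h`. -/
def leftDeriv (g h : G) : E →L[ℝ] E := mfderiv 𝓘(ℝ, E) 𝓘(ℝ, E) (fun b : G => g * b) h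

theorem hasMFDerivAt_mul_left (g h : G) :
    HasMFDerivAt 𝓘(ℝ, E) 𝓘(ℝ, E) (fun b : G => g * b) h (leftDeriv E g h) :=
  (((contMDiff_mul_left (I := 𝓘(ℝ, E)) (n := ∞) (a := g)).contMDiffAt).mdifferentiableAt
      (by simp)).hasMFDerivAt

theorem leftDeriv_mul (g g' h : G) :
    leftDeriv E (g * g') h = (leftDeriv E g (g' * h)).comp (leftDeriv E g' h) := by
  have h1 := (hasMFDerivAt_mul_left (E := E) g (g' * h)).comp h (hasMFDerivAt_mul_left g' h)
  have h2 : (fun b => g * b) ∘ (fun b => g' * b) = fun b => g * g' * b := by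
    ext b; simp [mul_assoc]
  rw [h2] at h1
  exact h1.mfderiv

theorem leftDeriv_one (h : G) : leftDeriv E 1 h = ContinuousLinearMap.id ℝ E := by
  have h1 : (fun b : G => 1 * b) = id := by ext; simp
  rw [leftDeriv, h1]
  exact mfderiv_id

variable (E) in
/-- The derivative at `g` of the chart at the identity. -/
def chartDeriv (g : G) : E →L[ℝ] E := mfderiv 𝓘(ℝ, E) 𝓘(ℝ, E) (oneChart E G) g

theorem hasMFDerivAt_oneChart {g : G} (hg : g ∈ (oneChart E G).source) :
    HasMFDerivAt 𝓘(ℝ, E) 𝓘(ℝ, E) (oneChart E G) g (chartDeriv E g) :=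
  have : IsManifold 𝓘(ℝ, E) ∞ G := inferInstance
  have : IsManifold 𝓘(ℝ, E) 1 G := inferInstance
  (mdifferentiableAt_atlas (chart_mem_atlas E 1) hg).hasMFDerivAt

theorem chartDeriv_one : chartDeriv E (1 : G) = ContinuousLinearMap.id ℝ E := by
  have : IsManifold 𝓘(ℝ, E) ∞ G := inferInstance
  have : IsManifold 𝓘(ℝ, E) 1 G := inferInstance
  have h := mfderiv_extChartAt_self (I := 𝓘(ℝ, E)) (x := (1 : G))
  have h2 : (extChartAt 𝓘(ℝ, E) (1 : G) : G → E) = oneChart E G := by ext; simp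
  rw [h2] at h
  exact h

theorem hasMFDerivAt_oneChart_symm :
    HasMFDerivAt 𝓘(ℝ, E) 𝓘(ℝ, E) (oneChart E G).symm (oneChart E G 1)
      (ContinuousLinearMap.id ℝ E) := by
  have : IsManifold 𝓘(ℝ, E) ∞ G := inferInstance
  have : IsManifold 𝓘(ℝ, E) 1 G := inferInstance
  have h := mfderivWithin_range_extChartAt_symm (I := 𝓘(ℝ, E)) (x := (1 : G))
  have h2 : ((extChartAt 𝓘(ℝ, E) (1 : G)).symm : E → G) = (oneChart E G).symm := by ext; simp
  have h3 := (mdifferentiableAt_atlas_symm (I := 𝓘(ℝ, E)) (chart_mem_atlas E (1 : G))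
    oneChart_one_mem_target).hasMFDerivAt
  rw [h2] at h
  simp only [mfld_simps, mfderivWithin_univ] at h
  rw [h] at h3
  exact h3

theorem hasLogDeriv_of_hasMFDerivAt {γ : ℝ → G} {W : E} {t : ℝ}
    (h : HasMFDerivAt 𝓘(ℝ, ℝ) 𝓘(ℝ, E) γ t
      ((1 : ℝ →L[ℝ] ℝ).smulRight (leftDeriv E (γ t) 1 W))) : HasLogDeriv E γ W t := by
  refine ⟨h.continuousAt, ?_⟩
  have h1 := (hasMFDerivAt_mul_left (E := E) (γ t)⁻¹ (γ t)).comp t h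
  have h2 : HasMFDerivAt 𝓘(ℝ, E) 𝓘(ℝ, E) (oneChart E G) ((γ t)⁻¹ * γ t)
      (ContinuousLinearMap.id ℝ E) := by
    have := hasMFDerivAt_oneChart (E := E) (G := G) one_mem_oneChart_source
    rw [chartDeriv_one] at this
    rw [inv_mul_cancel]
    exact this
  have h3 : HasFDerivAt (𝕜 := ℝ) (E := ℝ) (F := E) (fun s => oneChart E G ((γ t)⁻¹ * γ s))
      ((ContinuousLinearMap.id ℝ E).comp ((leftDeriv E (γ t)⁻¹ (γ t)).comp
        ((1 : ℝ →L[ℝ] ℝ).smulRight (leftDeriv E (γ t) 1 W)))) t :=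
    hasMFDerivAt_iff_hasFDerivAt.1 (h2.comp t h1)
  refine h3.hasDerivAt.congr_deriv ?_
  have h4 := leftDeriv_mul (E := E) (γ t)⁻¹ (γ t) 1
  rw [inv_mul_cancel, mul_one, leftDeriv_one] at h4
  have h5 := congrArg (fun l => l W) h4
  simpa using h5.symm

theorem HasLogDeriv.hasMFDerivAt {γ : ℝ → G} {W : E} {t : ℝ} (h : HasLogDeriv E γ W t) :
    HasMFDerivAt 𝓘(ℝ, ℝ) 𝓘(ℝ, E) γ t
      ((1 : ℝ →L[ℝ] ℝ).smulRight (leftDeriv E (γ t) 1 W)) := by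
  have := isTopologicalGroup E G
  have h1 := hasMFDerivAt_iff_hasFDerivAt.2 h.hasDerivAt.hasFDerivAt
  have h2 : HasMFDerivAt 𝓘(ℝ, E) 𝓘(ℝ, E) (fun a => γ t * (oneChart E G).symm a) (oneChart E G 1)
      (leftDeriv E (γ t) 1) := by
    have h3 := hasMFDerivAt_mul_left (E := E) (γ t) 1
    rw [← oneChart_symm_one (E := E)] at h3
    have h4 := h3.comp _ hasMFDerivAt_oneChart_symm
    rw [oneChart_symm_one] at h4
    exact h4
  rw [← inv_mul_cancel (γ t)] at h2
  have h3 := h2.comp t h1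
  rw [inv_mul_cancel] at h3
  refine HasMFDerivAt.congr_of_eventuallyEq
    (f' := (1 : ℝ →L[ℝ] ℝ).smulRight (leftDeriv E (γ t) 1 W))
    (f := (fun a => γ t * (oneChart E G).symm a) ∘ fun s => oneChart E G ((γ t)⁻¹ * γ s)) ?_ ?_
  · refine h3.congr_mfderiv ?_
    refine ContinuousLinearMap.ext fun r => ?_
    exact map_smul (leftDeriv E (γ t) 1) (show ℝ from r) W
  · have h3 : ContinuousAt (fun s => (γ t)⁻¹ * γ s) t := continuousAt_const.mul h.continuousAt
    filter_upwards [h3 (by simpa using source_mem_nhds (E := E) (G := G))] with s hs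
    simp only [Function.comp]
    rw [(oneChart E G).left_inv hs, mul_inv_cancel_left]

/-! ### The bracket and the derivative of the adjoint action -/

/-- The second derivative of the multiplication, in the chart at the identity. -/
def chartMulSnd (E : Type*) [NormedAddCommGroup E] [NormedSpace ℝ E] (G : Type*)
    [TopologicalSpace G] [ChartedSpace E G] [Group G] : E × E →L[ℝ] E × E →L[ℝ] E :=
  fderiv ℝ (fderiv ℝ (chartMul E G)) (oneChart E G 1, oneChart E G 1)

theorem chartLeft_eq {a : E} (ha : a ∈ (oneChart E G).target) (W : E) :
    chartLeft E G a W = fderiv ℝ (chartMul E G) (a, oneChart E G 1) (0, W) := by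
  have h := ((contDiffAt_chartMul_left ha).differentiableAt (by simp)).hasFDerivAt.comp
      (oneChart E G 1) ((hasFDerivAt_const a (oneChart E G 1)).prodMk (hasFDerivAt_id _))
  rw [(hasFDerivAt_chartLeft ha).unique h]
  simp

theorem hasFDerivAt_fderiv_chartMul : HasFDerivAt (fderiv ℝ (chartMul E G)) (chartMulSnd E G)
    (oneChart E G 1, oneChart E G 1) :=
  (((contDiffAt_chartMul_left oneChart_one_mem_target).fderiv_right (m := 1)
    (by rw [one_add_one_eq_two]; exact ENat.LEInfty.out)).differentiableAt (by simp)).hasFDerivAt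

theorem chartMulSnd_symm (v w : E × E) : chartMulSnd E G v w = chartMulSnd E G w v :=
  ((contDiffAt_chartMul_left (E := E) (G := G) oneChart_one_mem_target).isSymmSndFDerivAt
    (by simpa using ENat.LEInfty.out)) v w

theorem hasFDerivAt_chartLeft_apply (W : E) : HasFDerivAt (fun a => chartLeft E G a W)
    (((chartMulSnd E G).comp (ContinuousLinearMap.inl ℝ E E)).flip (0, W)) (oneChart E G 1) := by
  have h1 := (hasFDerivAt_fderiv_chartMul (E := E) (G := G)).comp
    (f := fun a => (a, oneChart E G 1)) (oneChart E G 1)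
    ((hasFDerivAt_id _).prodMk (hasFDerivAt_const _ _))
  have h2 := h1.clm_apply (hasFDerivAt_const ((0, W) : E × E) (oneChart E G 1))
  refine (h2.congr_of_eventuallyEq ?_).congr_fderiv ?_
  · filter_upwards [target_mem_nhds] with a ha
    simp [chartLeft_eq ha]
  · ext v
    simp

/-- Read in the chart, the left invariant field with value `W` at the identity is `a ↦ chartLeft a
W`. The Lie bracket thereby becomes a bracket of vector fields on `E`. -/
theorem mpullback_oneChart_symm {a : E} (ha : a ∈ (oneChart E G).target) (W : E) :
    (show E →L[ℝ] E from mfderiv 𝓘(ℝ, E) 𝓘(ℝ, E) (oneChart E G).symm a).inverse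
      (leftDeriv E ((oneChart E G).symm a) 1 W) = chartLeft E G a W := by
  have : IsManifold 𝓘(ℝ, E) ∞ G := inferInstance
  have : IsManifold 𝓘(ℝ, E) 1 G := inferInstance
  have hs := (oneChart E G).map_target ha
  have hd := mdifferentiable_chart (I := 𝓘(ℝ, E)) (1 : G)
  have h1 : (show E →L[ℝ] E from mfderiv 𝓘(ℝ, E) 𝓘(ℝ, E) (oneChart E G).symm a).comp
      (chartDeriv E ((oneChart E G).symm a)) = ContinuousLinearMap.id ℝ E := by
    have := hd.symm_comp_deriv hs
    rw [(oneChart E G).right_inv ha] at this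
    exact this
  have h2 : (chartDeriv E ((oneChart E G).symm a)).comp
      (show E →L[ℝ] E from mfderiv 𝓘(ℝ, E) 𝓘(ℝ, E) (oneChart E G).symm a) =
        ContinuousLinearMap.id ℝ E :=
    hd.comp_symm_deriv ha
  rw [ContinuousLinearMap.inverse_eq h1 h2]
  have h3 := hasMFDerivAt_mul_left (E := E) ((oneChart E G).symm a) 1
  rw [← oneChart_symm_one (E := E)] at h3
  have h4 := h3.comp _ hasMFDerivAt_oneChart_symm
  rw [oneChart_symm_one] at h4
  have h5 : HasMFDerivAt 𝓘(ℝ, E) 𝓘(ℝ, E) (oneChart E G)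
      (((fun b => (oneChart E G).symm a * b) ∘ (oneChart E G).symm) (oneChart E G 1))
      (chartDeriv E ((oneChart E G).symm a)) := by
    rw [Function.comp, oneChart_symm_one, mul_one]
    exact hasMFDerivAt_oneChart hs
  have h6 : HasFDerivAt (𝕜 := ℝ) (E := E) (F := E) (fun b => chartMul E G (a, b))
      ((chartDeriv E ((oneChart E G).symm a)).comp ((leftDeriv E ((oneChart E G).symm a) 1).comp
        (ContinuousLinearMap.id ℝ E))) (oneChart E G 1) :=
    hasMFDerivAt_iff_hasFDerivAt.1 (h5.comp _ h4)
  rw [(hasFDerivAt_chartLeft ha).unique h6]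
  rfl

/-- `chartLeft` is the identity at the base point, so the bracket of two such fields is the
difference of their derivatives: the antisymmetric part of the mixed second derivative of
multiplication. -/
theorem lie_eq (Z W : LieAlg E G) : (⁅Z, W⁆ : LieAlg E G) =
    (chartMulSnd E G (Z, 0) (0, W) - chartMulSnd E G (W, 0) (0, Z) : E) := by
  have : IsManifold 𝓘(ℝ, E) ∞ G := inferInstance
  have : IsManifold 𝓘(ℝ, E) 1 G := inferInstance
  have hV : ∀ V : E, (VectorField.mpullbackWithin 𝓘(ℝ, E) 𝓘(ℝ, E)
      (extChartAt 𝓘(ℝ, E) (1 : G)).symm (mulInvariantVectorField (V : LieAlg E G))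
      (Set.range 𝓘(ℝ, E)) : E → E) =ᶠ[𝓝 (oneChart E G 1)] fun a => chartLeft E G a V := by
    intro V
    filter_upwards [target_mem_nhds] with a ha
    rw [← mpullback_oneChart_symm ha]
    simp only [VectorField.mpullbackWithin, mfld_simps, mfderivWithin_univ]
    rfl
  rw [GroupLieAlgebra.bracket_def, ← VectorField.mlieBracketWithin_univ,
    VectorField.mlieBracketWithin_apply, mfderiv_extChartAt_self]
  have h1 : (ContinuousLinearMap.id ℝ E).inverse = ContinuousLinearMap.id ℝ E :=
    ContinuousLinearMap.inverse_id
  have h2 := (hV Z).lieBracketWithin_vectorField_eq_nhds (𝕜 := ℝ) (s := Set.univ) (hV W)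
  have h3 : VectorField.lieBracketWithin ℝ (fun a => chartLeft E G a Z)
      (fun a => chartLeft E G a W) Set.univ (oneChart E G 1) = (chartMulSnd E G (Z, 0) (0, W) - chartMulSnd E G (W, 0) (0, Z) : E) := by
    rw [VectorField.lieBracketWithin_univ, VectorField.lieBracket_eq]
    beta_reduce
    rw [(hasFDerivAt_chartLeft_apply (E := E) (G := G) Z).fderiv,
      (hasFDerivAt_chartLeft_apply (E := E) (G := G) W).fderiv, chartLeft_one]
    simp
    rfl
  have h4 : (extChartAt 𝓘(ℝ, E) (1 : G)).symm ⁻¹' Set.univ ∩ Set.range 𝓘(ℝ, E) =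
      (Set.univ : Set E) := by simp
  rw [h4]
  exact (congrArg (fun l : E →L[ℝ] E => l _) h1).trans (h2.trans h3)

end Bracket

/-! ### Conjugation in the chart, and the derivative of `Ad` along curves -/

section AdDeriv

open Topology

variable {E : Type*} [NormedAddCommGroup E] [NormedSpace ℝ E]
  {G : Type*} [TopologicalSpace G] [ChartedSpace E G] [Group G] [LieGroup 𝓘(ℝ, E) ∞ G]

variable (E G) in
/-- The conjugation `(g, h) ↦ g h g⁻¹`, in the chart at the identity. -/
def chartConj (p : E × E) : E :=
  oneChart E G ((oneChart E G).symm p.1 * (oneChart E G).symm p.2 * ((oneChart E G).symm p.1)⁻¹)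

theorem contDiffAt_chartConj {a : E} (ha : a ∈ (oneChart E G).target) :
    ContDiffAt ℝ ∞ (chartConj E G) (a, oneChart E G 1) := by
  have h1 : ContMDiffAt 𝓘(ℝ, E × E) 𝓘(ℝ, E) ∞ (fun p : E × E => (oneChart E G).symm p.1)
      (a, oneChart E G 1) :=
    ContMDiffAt.comp (a, oneChart E G 1) (f := Prod.fst) (contMDiffAt_oneChart_symm ha)
      contDiff_fst.contMDiff.contMDiffAt
  have h2 : ContMDiffAt 𝓘(ℝ, E × E) 𝓘(ℝ, E) ∞ (fun p : E × E => (oneChart E G).symm p.2)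
      (a, oneChart E G 1) :=
    ContMDiffAt.comp (a, oneChart E G 1) (f := Prod.snd)
      (contMDiffAt_oneChart_symm oneChart_one_mem_target) contDiff_snd.contMDiff.contMDiffAt
  exact contDiffAt_oneChart_comp ((h1.mul h2).mul h1.inv)
    (by simp)

theorem AdE_oneChart_symm {a : E} (ha : a ∈ (oneChart E G).target) (W : E) :
    AdE E ((oneChart E G).symm a) W = fderiv ℝ (chartConj E G) (a, oneChart E G 1) (0, W) := by
  have h := ((contDiffAt_chartConj ha).differentiableAt (by simp)).hasFDerivAt.comp
      (oneChart E G 1) ((hasFDerivAt_const a (oneChart E G 1)).prodMk (hasFDerivAt_id _))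
  have h' : HasFDerivAt (chartConj E G ∘ fun b => (a, id b)) _ _ :=
    hasFDerivAt_conj ((oneChart E G).symm a)
  rw [h'.unique h]
  simp

/-- Differentiate `ab = (aba⁻¹)a` in `b` at the identity. -/
theorem fderiv_chartMul_AdE {a : E} (ha : a ∈ (oneChart E G).target) (W : E) :
    fderiv ℝ (chartMul E G) (oneChart E G 1, a) (AdE E ((oneChart E G).symm a) W, 0) =
      chartLeft E G a W := by
  have := isTopologicalGroup E G
  have h1 := ((contDiffAt_chartMul_right ha).differentiableAt (by simp)).hasFDerivAt
  have h2 := (hasFDerivAt_conj (E := E) ((oneChart E G).symm a)).prodMk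
    (hasFDerivAt_const a (oneChart E G 1))
  have e1 : oneChart E G 1 = oneChart E G ((oneChart E G).symm a *
    (oneChart E G).symm (oneChart E G 1) * ((oneChart E G).symm a)⁻¹) := by simp
  have h3 : HasFDerivAt (chartMul E G) (fderiv ℝ (chartMul E G) (oneChart E G 1, a))
      (oneChart E G ((oneChart E G).symm a * (oneChart E G).symm (oneChart E G 1) *
        ((oneChart E G).symm a)⁻¹), a) := by
    rw [← e1]
    exact h1
  have h4 := h3.comp (oneChart E G 1) (f := fun b => (oneChart E G ((oneChart E G).symm a *
        (oneChart E G).symm b * ((oneChart E G).symm a)⁻¹), a)) h2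
  have h5 : ContinuousAt (fun b => (oneChart E G).symm a * (oneChart E G).symm b *
      ((oneChart E G).symm a)⁻¹) (oneChart E G 1) :=
    (continuousAt_const.mul ((oneChart E G).continuousAt_symm oneChart_one_mem_target)).mul
      continuousAt_const
  have h6 := (hasFDerivAt_chartLeft ha).unique (h4.congr_of_eventuallyEq ?_)
  · rw [h6]
    simp
  · filter_upwards [h5 (by simpa [oneChart_symm_one] using source_mem_nhds (E := E) (G := G))]
      with b hb
    simp only [Function.comp, chartMul]
    rw [(oneChart E G).left_inv hb]
    congr 1
    group

/-- Smoothness of conjugation gives some derivative `D`. Its value is found by differentiating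
`fderiv_chartMul_AdE` in `a`: the product rule yields a second derivative of multiplication plus `D
Z` on the left, and another second derivative on the right. -/
theorem hasFDerivAt_AdE (W : E) : ∃ D : E →L[ℝ] E,
    (∀ Z, D Z = chartMulSnd E G (Z, 0) (0, W) - chartMulSnd E G (W, 0) (0, Z)) ∧
    HasFDerivAt (fun a => AdE E ((oneChart E G).symm a) W) D (oneChart E G 1) := by
  have h0 : HasFDerivAt (fderiv ℝ (chartConj E G))
      (fderiv ℝ (fderiv ℝ (chartConj E G)) (oneChart E G 1, oneChart E G 1))
      (oneChart E G 1, oneChart E G 1) :=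
    (((contDiffAt_chartConj oneChart_one_mem_target).fderiv_right (m := 1)
    (by rw [one_add_one_eq_two]; exact ENat.LEInfty.out)).differentiableAt (by simp)).hasFDerivAt
  have h1 := (h0.comp (f := fun a => (a, oneChart E G 1)) (oneChart E G 1)
    ((hasFDerivAt_id _).prodMk (hasFDerivAt_const _ _))).clm_apply
    (hasFDerivAt_const ((0, (W : E)) : E × E) (oneChart E G 1))
  have hev : (fun a => AdE E ((oneChart E G).symm a) W) =ᶠ[𝓝 (oneChart E G 1)]
      fun a => fderiv ℝ (chartConj E G) (a, oneChart E G 1) (0, (W : E)) := by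
    filter_upwards [target_mem_nhds] with a ha
    exact AdE_oneChart_symm ha W
  have h2 := HasFDerivAt.congr_of_eventuallyEq h1 hev
  refine ⟨_, fun Z => ?_, h2⟩
  set D := fderiv ℝ (fun a => AdE E ((oneChart E G).symm a) W) (oneChart E G 1) with hD
  rw [← h2.fderiv, ← hD]
  rw [← h2.fderiv, ← hD] at h2
  have h3 := ((hasFDerivAt_fderiv_chartMul (E := E) (G := G)).comp
    (f := fun a => (oneChart E G 1, a)) (oneChart E G 1)
    ((hasFDerivAt_const _ _).prodMk (hasFDerivAt_id _))).clm_apply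
    (h2.prodMk (hasFDerivAt_const (0 : E) (oneChart E G 1)))
  have h4 := h3.unique ((hasFDerivAt_chartLeft_apply (E := E) (G := G) W).congr_of_eventuallyEq ?_)
  · have h5 := congrArg (fun l => l Z) h4
    simp [hasFDerivAt_chartMul_one.fderiv, AdE_one] at h5
    rw [chartMulSnd_symm (W, 0), ← h5]
    simp
  · filter_upwards [target_mem_nhds] with a ha
    rw [← fderiv_chartMul_AdE ha]
    rfl

/-- Since `Ad(γ s) = Ad(γ t) Ad(γ(t)⁻¹γ(s))`, only the derivative of `Ad` at the identity is needed,
and that is the bracket. -/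
theorem HasLogDeriv.hasDerivAt_AdE {γ : ℝ → G} {Z : LieAlg E G} {t : ℝ}
    (h : HasLogDeriv E γ Z t) (W : LieAlg E G) :
    HasDerivAt (fun s => AdE E (γ s) W) (AdE E (γ t) (⁅Z, W⁆ : LieAlg E G)) t := by
  have := isTopologicalGroup E G
  obtain ⟨D, hD, h1⟩ := hasFDerivAt_AdE (E := E) (G := G) W
  rw [show oneChart E G 1 = oneChart E G ((γ t)⁻¹ * γ t) by simp] at h1
  have h2 := (AdE E (γ t)).hasFDerivAt.comp_hasDerivAt t (h1.comp_hasDerivAt t h.hasDerivAt)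
  refine (h2.congr_of_eventuallyEq ?_).congr_deriv
    (congrArg (AdE E (γ t)) ((hD Z).trans (lie_eq Z W).symm))
  have h3 : ContinuousAt (fun s => (γ t)⁻¹ * γ s) t := continuousAt_const.mul h.continuousAt
  filter_upwards [h3 (by simpa using source_mem_nhds (E := E) (G := G))] with s hs
  simp only [Function.comp]
  rw [(oneChart E G).left_inv hs]
  have h4 := AdE_mul (E := E) (γ t) ((γ t)⁻¹ * γ s)
  rw [mul_inv_cancel_left] at h4
  exact congrArg (fun l : E →L[ℝ] E => l W) h4

end AdDeriv

section ExpBasic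

open Topology

variable {E : Type*} [NormedAddCommGroup E] [NormedSpace ℝ E] [CompleteSpace E]
  {G : Type*} [TopologicalSpace G] [ChartedSpace E G] [Group G] [LieGroup 𝓘(ℝ, E) ∞ G] [T2Space G]

/-! ### One-parameter subgroups -/

theorem isMIntegralCurve_of_hasLogDeriv {γ : ℝ → G} {Z : LieAlg E G}
    (h : ∀ t, HasLogDeriv E γ Z t) : IsMIntegralCurve γ (mulInvariantVectorField Z) :=
  fun t => (h t).hasMFDerivAt

theorem lieExp_smul {Z : LieAlg E G} {γ : ℝ → G} (h0 : γ 0 = 1)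
    (h : IsMIntegralCurve γ (mulInvariantVectorField Z)) (s : ℝ) : lieExp (s • Z) = γ s := by
  have h1 := h.comp_mul s
  rw [lieExp_eq (s • Z) (γ ∘ (· * s)) (by simpa using h0)
    (by rw [mulInvariantVectorField_smul]; exact h1)]
  simp

theorem hasLogDeriv_lieExp (Z : LieAlg E G) (t : ℝ) :
    HasLogDeriv E (fun s : ℝ => lieExp (s • Z)) Z t := by
  obtain ⟨γ, h0, h⟩ := exists_isMIntegralCurve Z
  have h1 : (fun s : ℝ => lieExp (s • Z)) = γ := funext fun s => lieExp_smul h0 h s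
  rw [h1]
  exact hasLogDeriv_of_hasMFDerivAt (h t)

theorem eq_mul_lieExp {γ : ℝ → G} {Z : LieAlg E G} (h : ∀ t, HasLogDeriv E γ Z t) (t : ℝ) :
    γ t = γ 0 * lieExp (t • Z) := by
  rw [lieExp_smul (γ := fun s => (γ 0)⁻¹ * γ s) (by simp)
    (isMIntegralCurve_of_hasLogDeriv fun t => (h t).const_mul _), mul_inv_cancel_left]

theorem lieExp_zero : lieExp (0 : LieAlg E G) = 1 := by
  simpa using (eq_mul_lieExp (hasLogDeriv_lieExp (0 : LieAlg E G)) 0).symm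

theorem lieExp_add_smul (Z : LieAlg E G) (s t : ℝ) :
    lieExp ((s + t) • Z) = lieExp (s • Z) * lieExp (t • Z) := by
  have h : ∀ r, HasLogDeriv E (fun r => lieExp ((s + r) • Z)) Z r := by
    intro r
    have h1 := hasLogDeriv_lieExp Z (s + r)
    exact ⟨h1.continuousAt.comp (f := fun r => s + r) (by fun_prop),
      h1.hasDerivAt.comp_const_add s r⟩
  simpa using eq_mul_lieExp h t

theorem lieExp_neg (Z : LieAlg E G) : lieExp (-Z) = (lieExp Z)⁻¹ := by
  have h := lieExp_add_smul Z 1 (-1)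
  rw [add_neg_cancel, zero_smul, lieExp_zero, one_smul, neg_one_smul] at h
  exact (inv_eq_of_mul_eq_one_right h.symm).symm

theorem lieExp_nat_smul (Z : LieAlg E G) (n : ℕ) : lieExp ((n : ℝ) • Z) = lieExp Z ^ n := by
  induction n with
  | zero => simp [lieExp_zero]
  | succ n ih => rw [Nat.cast_succ, lieExp_add_smul, ih, one_smul, pow_succ]

theorem conj_lieExp (g : G) (Z : LieAlg E G) : g * lieExp Z * g⁻¹ = lieExp (Ad g Z) := by
  have h := eq_mul_lieExp (Z := Ad g Z) (fun t => (hasLogDeriv_lieExp Z t).conj g) 1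
  simpa [lieExp_zero] using h

theorem Ad_mul_apply (g h : G) (Z : LieAlg E G) : Ad (g * h) Z = Ad g (Ad h Z) :=
  congrArg (fun l : E →L[ℝ] E => l Z) (AdE_mul (E := E) g h)

theorem Ad_one_apply (Z : LieAlg E G) : Ad (1 : G) Z = Z :=
  congrArg (fun l : E →L[ℝ] E => l Z) (AdE_one (E := E) (G := G))

variable {d : ℕ}

variable (E G) in
/-- The Lie algebra of `G` is nilpotent of class at most `d`. -/
def IsNilpotentOfClass (d : ℕ) : Prop :=
  LieModule.lowerCentralSeries ℝ (LieAlg E G) (LieAlg E G) d = ⊥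

theorem hasDerivAt_sum_pow_div_factorial {v : ℕ → E} (hv : v (d + 1) = 0) (t : ℝ) :
    HasDerivAt (fun s : ℝ => ∑ j ∈ Finset.range (d + 1), (s ^ j / j.factorial : ℝ) • v j)
      (∑ j ∈ Finset.range (d + 1), (t ^ j / j.factorial : ℝ) • v (j + 1)) t := by
  refine (HasDerivAt.fun_sum fun j _ =>
    ((hasDerivAt_pow j t).div_const _).smul_const (v j)).congr_deriv ?_
  rw [Finset.sum_range_succ', Finset.sum_range_succ _ d, hv]
  simp only [Nat.cast_zero, zero_mul, zero_div, zero_smul, add_zero, smul_zero]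
  refine Finset.sum_congr rfl fun j _ => ?_
  congr 1
  rw [Nat.factorial_succ]
  have : (j.factorial : ℝ) ≠ 0 := by positivity
  push_cast
  field_simp

/-- For `v j = (ad Z)ʲ W` this is the termwise primitive of `e^{-t ad Z} W`; its value at `t = 1` is
`dexp Z W`. -/
theorem hasDerivAt_sum_pow_div_factorial_succ (v : ℕ → E) (t : ℝ) :
    HasDerivAt (fun s : ℝ => ∑ j ∈ Finset.range (d + 1),
        ((-1) ^ j * s ^ (j + 1) / (j + 1).factorial : ℝ) • v j)
      (∑ j ∈ Finset.range (d + 1), ((-t) ^ j / j.factorial : ℝ) • v j) t := by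
  refine (HasDerivAt.fun_sum fun j _ =>
    (((hasDerivAt_pow (j + 1) t).const_mul ((-1) ^ j)).div_const _).smul_const (v j)).congr_deriv ?_
  refine Finset.sum_congr rfl fun j _ => ?_
  congr 1
  rw [Nat.factorial_succ, neg_pow t]
  have : (j.factorial : ℝ) ≠ 0 := by positivity
  push_cast
  field_simp

theorem hasDerivAt_expAd (hd : IsNilpotentOfClass E G d) (Z W : LieAlg E G) (t : ℝ) :
    HasDerivAt (F := E) (fun s => expAd d s Z W) (expAd d t Z ⁅Z, W⁆) t := by
  have hsucc : ∀ j, ((LieAlgebra.ad ℝ _ Z) ^ j) ⁅Z, W⁆ = ((LieAlgebra.ad ℝ _ Z) ^ (j + 1)) W :=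
    fun j => by rw [pow_succ, Module.End.mul_apply, LieAlgebra.ad_apply]
  have h := hasDerivAt_sum_pow_div_factorial (E := E) (d := d)
    (v := fun j => ((LieAlgebra.ad ℝ (LieAlg E G) Z) ^ j) W)
    (ad_pow_eq_zero hd Z W (Nat.le_succ d)) t
  simp only [expAd_apply, hsucc]
  exact h

theorem expAd_zero (Z W : LieAlg E G) : expAd d 0 Z W = W := by
  rw [expAd_apply, Finset.sum_range_succ']
  simp

/-- `Ad (exp Z) = e^{ad Z}`. -/
theorem Ad_lieExp_smul (hd : IsNilpotentOfClass E G d) (Z W : LieAlg E G) (t : ℝ) :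
    Ad (lieExp (t • Z)) W = expAd d t Z W := by
  -- Induction on the power of `ad Z` that kills `W`. The derivative of the difference of the two
  -- sides is the same difference for `[Z, W]`, which one power fewer kills.
  suffices H : ∀ (k : ℕ) (W : LieAlg E G), ((LieAlgebra.ad ℝ _ Z) ^ k) W = 0 → ∀ t : ℝ,
      Ad (lieExp (t • Z)) W = expAd d t Z W from H d W (ad_pow_eq_zero hd Z W le_rfl) t
  intro k
  induction k with
  | zero =>
    intro W hW t
    have : W = 0 := by simpa using hW
    rw [this, map_zero, map_zero]
  | succ k ih =>
    intro W hW t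
    have h1 := ih ⁅Z, W⁆ (by rwa [pow_succ, Module.End.mul_apply, LieAlgebra.ad_apply] at hW)
    have h2 : ∀ t, HasDerivAt (F := E) (fun s => Ad (lieExp (s • Z)) W - expAd d s Z W) 0 t := by
      intro t
      refine (((hasLogDeriv_lieExp Z t).hasDerivAt_AdE W).sub
        (hasDerivAt_expAd hd Z W t)).congr_deriv ?_
      exact sub_eq_zero.2 (h1 t)
    have h3 := is_const_of_deriv_eq_zero (fun t => (h2 t).differentiableAt)
      (fun t => (h2 t).deriv) t 0
    rw [zero_smul, lieExp_zero, Ad_one_apply, expAd_zero, sub_self] at h3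
    exact sub_eq_zero.1 h3

theorem Ad_lieExp (hd : IsNilpotentOfClass E G d) (Z W : LieAlg E G) :
    Ad (lieExp Z) W = expAd d 1 Z W := by
  rw [← Ad_lieExp_smul hd, one_smul]

theorem expAd_eq_self {Z W : LieAlg E G} (h : ⁅Z, W⁆ = 0) (t : ℝ) : expAd d t Z W = W := by
  rw [expAd_apply, Finset.sum_range_succ', Finset.sum_eq_zero fun j _ => ?_]
  · simp
  · rw [pow_succ (LieAlgebra.ad ℝ _ Z), Module.End.mul_apply, LieAlgebra.ad_apply, h, map_zero, smul_zero]

/-- `Ad(exp tB)` fixes `A`, so `exp(tA) exp(tB)` has constant logarithmic derivative `A + B`. -/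
theorem lieExp_add_of_lie_eq_zero (hd : IsNilpotentOfClass E G d) {A B : LieAlg E G}
    (h : ⁅A, B⁆ = 0) : lieExp (A + B) = lieExp A * lieExp B := by
  have h0 : ⁅B, A⁆ = 0 := by rw [← lie_skew, h, neg_zero]
  have h1 : ∀ t, HasLogDeriv E (fun s : ℝ => lieExp (s • A) * lieExp (s • B))
      (A + B : LieAlg E G) t := by
    intro t
    have h2 := (hasLogDeriv_lieExp A t).mul (hasLogDeriv_lieExp B t)
    have h3 : AdE E (lieExp (t • B))⁻¹ A = A := by
      rw [← lieExp_neg, ← neg_smul]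
      exact (Ad_lieExp_smul hd B A (-t)).trans (expAd_eq_self h0 _)
    rw [h3] at h2
    exact h2
  simpa [lieExp_zero] using (eq_mul_lieExp h1 1).symm

end ExpBasic

section ExpDeriv

open Topology

variable {E : Type*} [NormedAddCommGroup E] [NormedSpace ℝ E] [FiniteDimensional ℝ E]
  {G : Type*} [TopologicalSpace G] [ChartedSpace E G] [Group G] [LieGroup 𝓘(ℝ, E) ∞ G] [T2Space G]

/-! ### The derivative of the exponential map -/

/-- A curve whose logarithmic derivative is small does not leave the chart at the identity. -/
theorem chart_bound {q : ℝ → G} {W : ℝ → E} {r M : ℝ}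
    (hr : Metric.closedBall (oneChart E G 1) r ⊆ (oneChart E G).target)
    (hη : ∀ a ∈ Metric.closedBall (oneChart E G 1) r,
      ‖chartLeft E G a - ContinuousLinearMap.id ℝ E‖ ≤ 1 / 2)
    (hq : ∀ s, HasLogDeriv E q (W s) s) (hq0 : q 0 = 1)
    (hW : ∀ s ∈ Set.Icc (0 : ℝ) 1, ‖W s‖ ≤ M) (hM : 0 < M) (hMr : 2 * M ≤ r) :
    ∀ s ∈ Set.Icc (0 : ℝ) 1, q s ∈ (oneChart E G).source ∧
      ‖oneChart E G (q s) - oneChart E G 1‖ ≤ 2 * M * s := by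
  have hqc : Continuous q := continuous_iff_continuousAt.2 fun s => (hq s).continuousAt
  have hφ : ∀ s, q s ∈ (oneChart E G).source → ContinuousAt (fun s => oneChart E G (q s)) s :=
    fun s hs => ((oneChart E G).continuousAt hs).comp hqc.continuousAt
  have hr' : ∀ s ∈ Set.Icc (0 : ℝ) 1, ‖oneChart E G (q s) - oneChart E G 1‖ ≤ 2 * M * s →
      oneChart E G (q s) ∈ Metric.closedBall (oneChart E G 1) r := fun s hs h => by
    rw [Metric.mem_closedBall, dist_eq_norm]
    nlinarith [hs.2]
  -- Compactness of the ball keeps limits of points of the curve inside the domain of the chart.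
  -- This is the closedness needed for the continuous induction on `[0, 1]`.
  have hK : IsClosed ((oneChart E G).symm '' Metric.closedBall (oneChart E G 1) r) :=
    have : ProperSpace E := FiniteDimensional.proper_real E
    ((isCompact_closedBall _ _).image_of_continuousOn
      ((oneChart E G).continuousOn_symm.mono hr)).isClosed
  refine IsClosed.Icc_subset_of_forall_exists_gt (s := {s | q s ∈ (oneChart E G).source ∧
      ‖oneChart E G (q s) - oneChart E G 1‖ ≤ 2 * M * s}) ?_ ?_ ?_
  · apply IsSeqClosed.isClosed
    intro u s hu hus
    have hs : s ∈ Set.Icc (0 : ℝ) 1 := isClosed_Icc.mem_of_tendsto hus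
      (Filter.Eventually.of_forall fun n => (hu n).2)
    have h1 : q s ∈ (oneChart E G).symm '' Metric.closedBall (oneChart E G 1) r := by
      refine hK.mem_of_tendsto ((hqc.tendsto s).comp hus) (Filter.Eventually.of_forall fun n => ?_)
      exact ⟨_, hr' _ (hu n).2 (hu n).1.2, (oneChart E G).left_inv (hu n).1.1⟩
    have h2 : q s ∈ (oneChart E G).source := by
      obtain ⟨a, ha, h⟩ := h1
      exact h ▸ (oneChart E G).map_target (hr ha)
    refine ⟨⟨h2, ?_⟩, hs⟩
    exact le_of_tendsto_of_tendsto' ((((hφ s h2).tendsto.comp hus).sub_const _).norm)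
      (hus.const_mul (2 * M)) fun n => (hu n).1.2
  · simp [hq0]
  · rintro x ⟨⟨hx1, hx2⟩, hx⟩ y hy
    have hx' : x ∈ Set.Icc (0 : ℝ) 1 := ⟨hx.1, hx.2.le⟩
    have hder := (hq x).hasDerivAt_chart hx1
    -- The speed in the chart is at most `(1 + 1/2) M`. The remaining `M/2` below the claimed rate
    -- `2M` absorbs the error of the first order expansion.
    have hn : ‖chartLeft E G (oneChart E G (q x)) (W x)‖ ≤ 3 / 2 * M := by
      have h1 := (chartLeft E G (oneChart E G (q x)) - ContinuousLinearMap.id ℝ E).le_of_opNorm_le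
        (hη _ (hr' x hx' hx2)) (W x)
      have h2 := norm_add_le
        ((chartLeft E G (oneChart E G (q x)) - ContinuousLinearMap.id ℝ E) (W x)) (W x)
      simp only [sub_apply, ContinuousLinearMap.id_apply,
        sub_add_cancel] at h1 h2
      linarith [hW x hx']
    have h1 := (hasDerivAt_iff_isLittleO.1 hder).def (show 0 < M / 2 by positivity)
    have h2 := hqc.continuousAt.eventually ((oneChart E G).open_source.mem_nhds hx1)
    have h3 : ∀ᶠ s in 𝓝[>] x, s ∈ Set.Ioc x y := Ioc_mem_nhdsGT hy
    obtain ⟨s, ⟨h1s, h2s⟩, h3s⟩ :=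
      (((h1.and h2).filter_mono nhdsWithin_le_nhds).and h3).exists
    refine ⟨s, ⟨h2s, ?_⟩, h3s⟩
    have hsx : 0 < s - x := sub_pos.2 h3s.1
    rw [Real.norm_of_nonneg hsx.le] at h1s
    have h4 : ‖(s - x) • chartLeft E G (oneChart E G (q x)) (W x)‖ ≤ (s - x) * (3 / 2 * M) := by
      rw [norm_smul, Real.norm_of_nonneg hsx.le]
      gcongr
    have h5 : oneChart E G (q s) - oneChart E G 1 = (oneChart E G (q s) - oneChart E G (q x) -
      (s - x) • chartLeft E G (oneChart E G (q x)) (W x)) +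
      (s - x) • chartLeft E G (oneChart E G (q x)) (W x) +
      (oneChart E G (q x) - oneChart E G 1) := by abel
    rw [h5]
    refine (norm_add₃_le).trans ?_
    nlinarith

/-- A curve with small logarithmic derivative `W` is well approximated by the primitive of `W`. -/
theorem chart_estimate {q : ℝ → G} {W V : ℝ → E} {r M η : ℝ}
    (hr : Metric.closedBall (oneChart E G 1) r ⊆ (oneChart E G).target) (hη1 : η ≤ 1 / 2)
    (hη : ∀ a ∈ Metric.closedBall (oneChart E G 1) r,
      ‖chartLeft E G a - ContinuousLinearMap.id ℝ E‖ ≤ η)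
    (hq : ∀ s, HasLogDeriv E q (W s) s) (hq0 : q 0 = 1)
    (hV : ∀ s, HasDerivAt V (W s) s)
    (hW : ∀ s ∈ Set.Icc (0 : ℝ) 1, ‖W s‖ ≤ M) (hM : 0 < M) (hMr : 2 * M ≤ r) :
    q 1 ∈ (oneChart E G).source ∧
      ‖oneChart E G (q 1) - oneChart E G 1 - (V 1 - V 0)‖ ≤ η * M := by
  have hb := chart_bound hr (fun a ha => (hη a ha).trans hη1) hq hq0 hW hM hMr
  refine ⟨(hb 1 (by simp)).1, ?_⟩
  have hd : ∀ s ∈ Set.Icc (0 : ℝ) 1, HasDerivWithinAt (fun s => oneChart E G (q s) - V s)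
      (chartLeft E G (oneChart E G (q s)) (W s) - W s) (Set.Icc 0 1) s := fun s hs =>
    (((hq s).hasDerivAt_chart (hb s hs).1).sub (hV s)).hasDerivWithinAt
  have h := norm_image_sub_le_of_norm_deriv_le_segment_01' (C := η * M) hd fun s hs => ?_
  · rw [hq0] at h
    convert h using 2
    abel
  · have hs' : s ∈ Set.Icc (0 : ℝ) 1 := ⟨hs.1, hs.2.le⟩
    have h1 : oneChart E G (q s) ∈ Metric.closedBall (oneChart E G 1) r := by
      rw [Metric.mem_closedBall, dist_eq_norm]
      nlinarith [(hb s hs').2, hs.2]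
    refine ((chartLeft E G (oneChart E G (q s)) - ContinuousLinearMap.id ℝ E).le_of_opNorm_le
      (hη _ h1) (W s)).trans ?_
    exact mul_le_mul_of_nonneg_left (hW s hs') ((norm_nonneg _).trans (hη _ h1))

variable [CompleteSpace E] {d : ℕ}

variable (E G) in
/-- The bracket of the Lie algebra as a continuous bilinear map, in coordinates. -/
def adE : E →L[ℝ] E →L[ℝ] E :=
  LinearMap.toContinuousLinearMap ((LinearMap.toContinuousLinearMap :
    (E →ₗ[ℝ] E) ≃ₗ[ℝ] E →L[ℝ] E).toLinearMap.comp
      (LinearMap.mk₂ ℝ (show E → E → E from fun Z W : LieAlg E G => (⁅Z, W⁆ : LieAlg E G))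
        (add_lie (L := LieAlg E G) (M := LieAlg E G))
        (smul_lie (R := ℝ) (L := LieAlg E G) (M := LieAlg E G))
        (lie_add (L := LieAlg E G) (M := LieAlg E G))
        (fun t Z W => lie_smul (R := ℝ) (L := LieAlg E G) (M := LieAlg E G) t Z W)))

theorem adE_pow_apply (Z W : LieAlg E G) (j : ℕ) :
    (adE E G Z ^ j) W = ((LieAlgebra.ad ℝ (LieAlg E G) Z) ^ j) W := by
  induction j with
  | zero => rfl
  | succ j ih =>
    rw [pow_succ' (LieAlgebra.ad ℝ (LieAlg E G) Z), Module.End.mul_apply, ← ih, pow_succ']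
    rfl

variable (E G) in
/-- `e^{t ad Z}`, in coordinates. -/
def expAdE (d : ℕ) (p : ℝ × E) : E →L[ℝ] E :=
  ∑ j ∈ Finset.range (d + 1), (p.1 ^ j / j.factorial : ℝ) • adE E G p.2 ^ j

variable (E G) in
/-- The left logarithmic derivative of the exponential map, in coordinates. -/
def dexpE (d : ℕ) (Z : E) : E →L[ℝ] E :=
  ∑ j ∈ Finset.range (d + 1), ((-1) ^ j / (j + 1).factorial : ℝ) • adE E G Z ^ j

theorem expAdE_apply (t : ℝ) (Z W : LieAlg E G) : expAdE E G d (t, Z) W = expAd d t Z W := by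
  have h : ∀ Z W : E, expAdE E G d (t, Z) W =
      ∑ j ∈ Finset.range (d + 1), (t ^ j / j.factorial : ℝ) • (adE E G Z ^ j) W := by
    intro Z W
    simp [expAdE, sum_apply]
  rw [expAd_apply]
  exact (h Z W).trans (Finset.sum_congr rfl fun j _ => congrArg ((t ^ j / j.factorial : ℝ) • ·)
    (adE_pow_apply Z W j))

theorem dexpE_apply (Z W : LieAlg E G) : dexpE E G d Z W = dexp d Z W := by
  have h : ∀ Z W : E, dexpE E G d Z W =
      ∑ j ∈ Finset.range (d + 1), ((-1) ^ j / (j + 1).factorial : ℝ) • (adE E G Z ^ j) W := by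
    intro Z W
    simp [dexpE, sum_apply]
  rw [dexp_apply]
  exact (h Z W).trans (Finset.sum_congr rfl fun j _ =>
    congrArg (((-1) ^ j / (j + 1).factorial : ℝ) • ·) (adE_pow_apply Z W j))

theorem continuous_expAdE : Continuous (expAdE E G d) := by
  unfold expAdE
  fun_prop

theorem continuous_dexpE : Continuous (dexpE E G d) := by
  unfold dexpE
  fun_prop

variable (E G) in
/-- The exponential map, in coordinates on the Lie algebra. -/
def expE (Z : E) : G := lieExp (Z : LieAlg E G)

/-- This curve joins `1` to `(exp Y)⁻¹ exp Y'` as `s` runs from `0` to `1`. Its logarithmic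
derivative is of the order of `Y' - Y`, and the primitive of that is `dexp Y' (Y' - Y)` at `s = 1`;
so it computes the derivative of `exp`. -/
theorem hasLogDeriv_quotient (hd : IsNilpotentOfClass E G d) (Y Y' : LieAlg E G) (s : ℝ) :
    HasLogDeriv E (fun s : ℝ => (lieExp (s • Y))⁻¹ * lieExp (s • Y'))
      (expAd d (-s) Y' (Y' - Y)) s := by
  have h1 := (hasLogDeriv_lieExp (-Y) s).mul (hasLogDeriv_lieExp Y' s)
  have h2 : AdE E (lieExp (s • Y'))⁻¹ (-Y : LieAlg E G) + (show E from Y') =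
      (expAd d (-s) Y' (Y' - Y) : LieAlg E G) := by
    have h3 : ∀ W : LieAlg E G, AdE E (lieExp (s • Y'))⁻¹ W = expAd d (-s) Y' W := fun W => by
      rw [← lieExp_neg, ← neg_smul]
      exact Ad_lieExp_smul hd Y' W (-s)
    rw [h3, map_sub, expAd_eq_self (lie_self Y'), map_neg]
    exact neg_add_eq_sub _ _
  rw [h2] at h1
  simpa only [smul_neg, lieExp_neg] using h1

theorem eventually_expE_estimate (hd : IsNilpotentOfClass E G d) (Y : E) {ε : ℝ} (hε : 0 < ε) :
    ∀ᶠ Y' in 𝓝 Y, (expE E G Y)⁻¹ * expE E G Y' ∈ (oneChart E G).source ∧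
      ‖oneChart E G ((expE E G Y)⁻¹ * expE E G Y') - oneChart E G 1 - dexpE E G d Y (Y' - Y)‖ ≤
        ε * ‖Y' - Y‖ := by
  have : ProperSpace E := FiniteDimensional.proper_real E
  obtain ⟨C, hC⟩ := ((isCompact_Icc (a := (-1 : ℝ)) (b := 0)).prod
    (isCompact_closedBall Y 1)).exists_bound_of_continuousOn
      (continuous_expAdE (E := E) (G := G) (d := d)).continuousOn
  set C' := max C 1 with hC'
  have hC'0 : 0 < C' := lt_max_of_lt_right one_pos
  -- `C'` bounds `e^{-s ad Y'}`, so this `η` makes the error in the chart at most `ε/2 ‖Y' - Y‖`.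
  -- The other half of `ε` pays for replacing `dexp Y'` by `dexp Y`.
  set η := min (1 / 2) (ε / (2 * C')) with hη
  have hη0 : 0 < η := lt_min (by norm_num) (by positivity)
  have h1 : ContinuousAt (fun a => ‖chartLeft E G a - ContinuousLinearMap.id ℝ E‖)
      (oneChart E G 1) :=
    ((continuousOn_chartLeft.continuousAt target_mem_nhds).sub continuousAt_const).norm
  have h2 := h1.eventually_lt continuousAt_const
    (show _ < η by simpa [chartLeft_one] using hη0)
  obtain ⟨r, hr, hr'⟩ := Metric.nhds_basis_closedBall.mem_iff.1
    (Filter.inter_mem h2 (target_mem_nhds (E := E) (G := G)))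
  have h3 : ContinuousAt (fun Z => ‖dexpE E G d Z - dexpE E G d Y‖) Y :=
    ((continuous_dexpE.continuousAt).sub continuousAt_const).norm
  have h4 := h3.eventually_lt continuousAt_const (show _ < ε / 2 by simpa using hε)
  filter_upwards [h4, Metric.closedBall_mem_nhds Y one_pos,
    Metric.closedBall_mem_nhds Y (show 0 < r / (2 * C') by positivity)] with Y' h4 h5 h6
  by_cases hYY : Y' = Y
  · rw [hYY]
    simp
  have hY0 : 0 < ‖Y' - Y‖ := norm_pos_iff.2 (sub_ne_zero.2 hYY)
  rw [Metric.mem_closedBall, dist_eq_norm, le_div_iff₀ (by positivity)] at h6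
  have hq : ∀ s, HasLogDeriv E (fun s : ℝ => (expE E G (s • Y))⁻¹ * expE E G (s • Y'))
      (expAdE E G d (-s, Y') (Y' - Y)) s := fun s => by
    have h := hasLogDeriv_quotient hd (G := G) Y Y' s
    exact ⟨h.1, h.2.congr_deriv (expAdE_apply (G := G) (d := d) (-s) Y' (Y' - Y : E)).symm⟩
  have hV : ∀ s, HasDerivAt (fun s : ℝ => ∑ j ∈ Finset.range (d + 1),
        ((-1) ^ j * s ^ (j + 1) / (j + 1).factorial : ℝ) • (adE E G Y' ^ j) (Y' - Y))
        (expAdE E G d (-s, Y') (Y' - Y)) s := fun s => by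
    refine (hasDerivAt_sum_pow_div_factorial_succ (d := d)
      (fun j => (adE E G Y' ^ j) (Y' - Y)) s).congr_deriv ?_
    simp [expAdE, sum_apply]
  have h0 : (expE E G ((0 : ℝ) • Y))⁻¹ * expE E G ((0 : ℝ) • Y') = 1 := by
    have : expE E G 0 = 1 := lieExp_zero
    rw [zero_smul, zero_smul, this, inv_one, one_mul]
  have key := chart_estimate (M := C' * ‖Y' - Y‖) (fun a ha => (hr' ha).2) (min_le_left _ _)
    (fun a ha => (hr' ha).1.le) hq h0 hV (fun s hs => (expAdE E G d (-s, Y')).le_of_opNorm_le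
      ((hC (-s, Y') ⟨⟨by linarith [hs.2], by linarith [hs.1]⟩, h5⟩).trans (le_max_left C 1)) _)
    (by positivity) (by linarith)
  have hV1 : ∑ j ∈ Finset.range (d + 1), ((-1) ^ j * (1 : ℝ) ^ (j + 1) / (j + 1).factorial : ℝ) •
      (adE E G Y' ^ j) (Y' - Y) = dexpE E G d Y' (Y' - Y) := by
    simp [dexpE, sum_apply]
  have hV0 : ∑ j ∈ Finset.range (d + 1), ((-1) ^ j * (0 : ℝ) ^ (j + 1) / (j + 1).factorial : ℝ) •
      (adE E G Y' ^ j) (Y' - Y) = 0 := by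
    simp
  rw [one_smul, one_smul, hV1, hV0, sub_zero] at key
  refine ⟨key.1, ?_⟩
  have k1 : η * (C' * ‖Y' - Y‖) ≤ ε / 2 * ‖Y' - Y‖ := by
    rw [← mul_assoc]
    gcongr
    calc η * C' ≤ ε / (2 * C') * C' := by gcongr; exact min_le_right _ _
      _ = ε / 2 := by field_simp
  have k2 := (dexpE E G d Y' - dexpE E G d Y).le_of_opNorm_le h4.le (Y' - Y)
  rw [sub_apply] at k2
  have k3 : oneChart E G ((expE E G Y)⁻¹ * expE E G Y') - oneChart E G 1 -
      dexpE E G d Y (Y' - Y) = (oneChart E G ((expE E G Y)⁻¹ * expE E G Y') - oneChart E G 1 -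
      dexpE E G d Y' (Y' - Y)) + (dexpE E G d Y' (Y' - Y) - dexpE E G d Y (Y' - Y)) := by abel
  rw [k3]
  refine (norm_add_le _ _).trans ?_
  linarith [key.2]

theorem hasFDerivAt_expE (hd : IsNilpotentOfClass E G d) (Y : E) :
    HasFDerivAt (fun Y' => oneChart E G ((expE E G Y)⁻¹ * expE E G Y')) (dexpE E G d Y) Y := by
  rw [hasFDerivAt_iff_isLittleO, Asymptotics.isLittleO_iff]
  intro ε hε
  filter_upwards [eventually_expE_estimate hd Y hε] with Y' h
  simpa using h.2

theorem continuous_expE (hd : IsNilpotentOfClass E G d) : Continuous (expE E G) := by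
  have := isTopologicalGroup E G
  rw [continuous_iff_continuousAt]
  intro Y
  have h1 := (hasFDerivAt_expE hd Y).continuousAt
  have h2 : ContinuousAt (oneChart E G).symm
      (oneChart E G ((expE E G Y)⁻¹ * expE E G Y)) := by
    rw [inv_mul_cancel]
    exact (oneChart E G).continuousAt_symm oneChart_one_mem_target
  have h3 : ContinuousAt (fun Y' => expE E G Y * (oneChart E G).symm
      (oneChart E G ((expE E G Y)⁻¹ * expE E G Y'))) Y :=
    continuousAt_const.mul
      (ContinuousAt.comp (f := fun Y' => oneChart E G ((expE E G Y)⁻¹ * expE E G Y')) h2 h1)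
  refine h3.congr ?_
  filter_upwards [eventually_expE_estimate hd Y one_pos] with Y' h
  rw [(oneChart E G).left_inv h.1, mul_inv_cancel_left]

/-- The derivative exists at all nearby points and is continuous at `Y`. Strictness is what the
inverse function theorem requires. -/
theorem hasStrictFDerivAt_expE (hd : IsNilpotentOfClass E G d) (Y : E) :
    HasStrictFDerivAt (fun Y' => oneChart E G ((expE E G Y)⁻¹ * expE E G Y'))
      (dexpE E G d Y) Y := by
  have := isTopologicalGroup E G
  have hc : ContinuousAt (fun Y' => (expE E G Y)⁻¹ * expE E G Y') Y :=
    (continuous_const.mul (continuous_expE hd)).continuousAt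
  have hs : ∀ᶠ Y' in 𝓝 Y, (expE E G Y)⁻¹ * expE E G Y' ∈ (oneChart E G).source :=
    hc.eventually (by simp only [inv_mul_cancel]; exact source_mem_nhds)
  have hd' : ∀ᶠ Y' in 𝓝 Y, HasFDerivAt (fun Y' => oneChart E G ((expE E G Y)⁻¹ * expE E G Y'))
      ((chartLeft E G (oneChart E G ((expE E G Y)⁻¹ * expE E G Y'))).comp (dexpE E G d Y')) Y' := by
    filter_upwards [hs] with Z hZ
    have h1 := hasFDerivAt_chartLeft ((oneChart E G).map_source hZ)
    have h2 := hasFDerivAt_expE hd (G := G) Z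
    rw [show oneChart E G 1 = oneChart E G ((expE E G Z)⁻¹ * expE E G Z) by simp] at h1
    refine (h1.comp Z (f := fun Y' => oneChart E G ((expE E G Z)⁻¹ * expE E G Y')) h2
      ).congr_of_eventuallyEq ?_
    filter_upwards [eventually_expE_estimate hd Z one_pos] with Y' h
    simp only [Function.comp, chartMul]
    rw [(oneChart E G).left_inv hZ, (oneChart E G).left_inv h.1]
    congr 1
    group
  have h3 := hasStrictFDerivAt_of_hasFDerivAt_of_continuousAt hd' ?_
  · simpa [chartLeft_one] using! h3
  · have h4 : ContinuousAt (chartLeft E G) (oneChart E G ((expE E G Y)⁻¹ * expE E G Y)) := by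
      rw [inv_mul_cancel]
      exact continuousOn_chartLeft.continuousAt target_mem_nhds
    exact (ContinuousAt.comp (f := fun Y' => oneChart E G ((expE E G Y)⁻¹ * expE E G Y')) h4
      (hasFDerivAt_expE hd Y).continuousAt).clm_comp continuous_dexpE.continuousAt

theorem dexpE_bijective (hd : IsNilpotentOfClass E G d) (Y : E) :
    Function.Bijective (dexpE E G d Y) := by
  have h1 : Function.Injective (dexpE E G d Y) := fun a b hab =>
    dexp_injective hd (Y : LieAlg E G)
      (((dexpE_apply Y a).symm.trans hab).trans (dexpE_apply Y b))
  exact ⟨h1, LinearMap.injective_iff_surjective (f := (dexpE E G d Y).toLinearMap).1 h1⟩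

variable (E G) in
/-- The derivative of the exponential map, as a continuous linear equivalence. -/
def dexpEquiv (hd : IsNilpotentOfClass E G d) (Y : E) : E ≃L[ℝ] E :=
  (LinearEquiv.ofBijective (dexpE E G d Y).toLinearMap (dexpE_bijective hd Y)).toContinuousLinearEquiv

theorem hasStrictFDerivAt_expE_equiv (hd : IsNilpotentOfClass E G d) (Y : E) :
    HasStrictFDerivAt (fun Y' => oneChart E G ((expE E G Y)⁻¹ * expE E G Y'))
      (dexpEquiv E G hd Y : E →L[ℝ] E) Y :=
  hasStrictFDerivAt_expE hd Y

/-- The exponential map is open. -/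
theorem map_nhds_expE (hd : IsNilpotentOfClass E G d) (Y : E) :
    Filter.map (expE E G) (𝓝 Y) = 𝓝 (expE E G Y) := by
  have := isTopologicalGroup E G
  have h1 := (hasStrictFDerivAt_expE_equiv hd (G := G) Y).map_nhds_eq_of_equiv
  rw [inv_mul_cancel] at h1
  have h2 : Filter.map (oneChart E G).symm (𝓝 (oneChart E G 1)) = 𝓝 1 := by
    have := (oneChart E G).symm.map_nhds_eq (x := oneChart E G 1) oneChart_one_mem_target
    rwa [oneChart_symm_one] at this
  have h3 : Filter.map (fun g => expE E G Y * g) (𝓝 1) = 𝓝 (expE E G Y) := by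
    simp
  rw [← h3, ← h2, ← h1, Filter.map_map, Filter.map_map]
  refine Filter.map_congr ?_
  filter_upwards [eventually_expE_estimate hd Y one_pos] with Y' h
  simp only [Function.comp]
  rw [(oneChart E G).left_inv h.1, mul_inv_cancel_left]

/-- Along the polynomial curves of `exists_polyCurve_dexp`, the exponential map is
`t ↦ exp A exp (t B)`. -/
theorem hasLogDeriv_lieExp_comp (hd : IsNilpotentOfClass E G d) {Y f : ℝ → LieAlg E G}
    {B : LieAlg E G} {t : ℝ} (hY : HasDerivAt (F := E) Y (f t) t) (h : dexp d (Y t) (f t) = B) :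
    HasLogDeriv E (fun s => lieExp (Y s)) B t := by
  refine ⟨(continuous_expE hd).continuousAt.comp (f := (Y : ℝ → E)) hY.continuousAt, ?_⟩
  refine ((hasFDerivAt_expE hd (G := G) (Y t)).comp_hasDerivAt t hY).congr_deriv ?_
  exact (dexpE_apply (Y t) (f t)).trans h

end ExpDeriv

section ExpBijective

open Topology

variable {E : Type*} [NormedAddCommGroup E] [NormedSpace ℝ E] [FiniteDimensional ℝ E]
  [CompleteSpace E] {G : Type*} [TopologicalSpace G] [ChartedSpace E G] [Group G]
  [LieGroup 𝓘(ℝ, E) ∞ G] [T2Space G] {d : ℕ}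

/-! ### The exponential map of a simply connected nilpotent Lie group -/

instance instFiniteDimensionalLieAlg : FiniteDimensional ℝ (LieAlg E G) :=
  inferInstanceAs (FiniteDimensional ℝ E)

/-- Engel's theorem. -/
theorem exists_isNilpotentOfClass
    (hnil : ∀ Z : LieAlg E G, IsNilpotent (LieAlgebra.ad ℝ (LieAlg E G) Z)) :
    ∃ d, IsNilpotentOfClass E G d := by
  have h := (LieAlgebra.isNilpotent_iff_forall (R := ℝ) (L := LieAlg E G)).2 hnil
  exact (LieModule.isNilpotent_iff ℝ (LieAlg E G) (LieAlg E G)).1 h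

theorem HasWeakDeriv.hasDerivAt {Y f : ℝ → LieAlg E G} (h : HasWeakDeriv Y f) (t : ℝ) :
    HasDerivAt (F := E) Y (f t) t := by
  let e : E ≃L[ℝ] (Fin (Module.finrank ℝ E) → ℝ) :=
    (Module.finBasis ℝ E).equivFun.toContinuousLinearEquiv
  have h1 : HasDerivAt (fun s => e (Y s)) (e (f t)) t := by
    rw [hasDerivAt_pi]
    intro i
    exact h ((Module.finBasis ℝ E).coord i) t
  have h2 := e.symm.hasFDerivAt.comp_hasDerivAt t h1
  have h3 : (e.symm ∘ fun s => e (Y s)) = Y := funext fun s => e.symm_apply_apply (Y s)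
  rw [h3] at h2
  exact h2.congr_deriv (e.symm_apply_apply (f t))

/-- The Baker-Campbell-Hausdorff theorem: `exp A * exp (t B)` is the exponential of a polynomial
curve. -/
theorem exists_polyCurve_mul_lieExp (hd : IsNilpotentOfClass E G d) (A B : LieAlg E G) :
    ∃ Y ∈ polyCurve (LieAlg E G), Y 0 = A ∧ (∀ t, lieExp (Y t) = lieExp A * lieExp (t • B)) ∧
      ∀ (T : LieSubalgebra ℝ (LieAlg E G)) (N : Submodule ℝ (LieAlg E G)), A ∈ T → B ∈ T →
        (∀ v ∈ T, ∀ w ∈ T, ⁅v, w⁆ ∈ N) → ∀ t, Y t ∈ T ∧ Y t - (A + t • B) ∈ N := by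
  obtain ⟨Y, hY, f, hf, h0, hB, hT⟩ := exists_polyCurve_dexp hd A B
  refine ⟨Y, hY, h0, fun t => ?_, hT⟩
  have h := eq_mul_lieExp (γ := fun t => lieExp (Y t)) (Z := B)
    (fun t => hasLogDeriv_lieExp_comp hd (hf.hasDerivAt t) (hB t)) t
  simpa [h0] using h

theorem exists_lieExp_eq_mul (hd : IsNilpotentOfClass E G d) (A B : LieAlg E G) :
    ∃ C : LieAlg E G, lieExp C = lieExp A * lieExp B ∧
      ∀ (T : LieSubalgebra ℝ (LieAlg E G)) (N : Submodule ℝ (LieAlg E G)), A ∈ T → B ∈ T →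
        (∀ v ∈ T, ∀ w ∈ T, ⁅v, w⁆ ∈ N) → C ∈ T ∧ C - (A + B) ∈ N := by
  obtain ⟨Y, -, -, h1, h2⟩ := exists_polyCurve_mul_lieExp hd A B
  refine ⟨Y 1, by simpa using h1 1, fun T N hA hB hN => by simpa using h2 T N hA hB hN 1⟩

theorem isOpenMap_expE (hd : IsNilpotentOfClass E G d) : IsOpenMap (expE E G) :=
  isOpenMap_iff_nhds_le.2 fun Y => (map_nhds_expE hd Y).ge

/-- The image of `exp` is a subgroup by Baker-Campbell-Hausdorff and open because `exp` is an open
map; an open subgroup is closed, and `G` is connected. -/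
theorem expE_surjective [ConnectedSpace G] (hd : IsNilpotentOfClass E G d) :
    Function.Surjective (expE E G) := by
  have := isTopologicalGroup E G
  let S : Subgroup G :=
    { carrier := Set.range (expE E G)
      mul_mem' := by
        rintro _ _ ⟨A, rfl⟩ ⟨B, rfl⟩
        obtain ⟨C, hC, -⟩ := exists_lieExp_eq_mul hd (A : LieAlg E G) B
        exact ⟨C, hC⟩
      one_mem' := ⟨0, lieExp_zero⟩
      inv_mem' := by
        rintro _ ⟨A, rfl⟩
        exact ⟨-A, lieExp_neg (A : LieAlg E G)⟩ }
  have hS : IsOpen (S : Set G) := (isOpenMap_expE hd).isOpen_range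
  have h : (S : Set G) = Set.univ :=
    IsClopen.eq_univ ⟨S.isClosed_of_isOpen hS, hS⟩ ⟨1, S.one_mem⟩
  exact Set.range_eq_univ.1 h

/-- `e^{ad A} B = Ad(exp A) B = Ad(exp B) B = B`. -/
theorem lie_eq_zero_of_lieExp_eq (hd : IsNilpotentOfClass E G d) {A B : LieAlg E G}
    (h : lieExp A = lieExp B) : ⁅A, B⁆ = 0 := by
  refine lie_eq_zero_of_expAd hd ?_
  rw [← Ad_lieExp hd, h, Ad_lieExp hd]
  exact expAd_eq_self (lie_self B) 1

theorem lie_eq_zero_of_lieExp_eq_one (hd : IsNilpotentOfClass E G d) {Z : LieAlg E G}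
    (h : lieExp Z = 1) (W : LieAlg E G) : ⁅Z, W⁆ = 0 := by
  refine lie_eq_zero_of_expAd hd ?_
  rw [← Ad_lieExp hd, h, Ad_one_apply]

/-- The kernel of the exponential map. -/
def expKer (hd : IsNilpotentOfClass E G d) : AddSubgroup (LieAlg E G) where
  carrier := {Z | lieExp Z = 1}
  zero_mem' := lieExp_zero
  add_mem' {A B} hA hB := by
    rw [Set.mem_ofPred_eq] at *
    rw [lieExp_add_of_lie_eq_zero hd (lie_eq_zero_of_lieExp_eq_one hd hA B), hA, hB, one_mul]
  neg_mem' {A} hA := (lieExp_neg A).trans (inv_eq_one.2 hA)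

/-- Although `exp` is not a homomorphism, its fibres are cosets of its kernel, because elements with
equal exponentials commute. -/
theorem lieExp_eq_iff (hd : IsNilpotentOfClass E G d) {A B : LieAlg E G} :
    lieExp A = lieExp B ↔ B + -A ∈ expKer hd := by
  change _ ↔ lieExp (B + -A) = 1
  constructor
  · intro h
    rw [lieExp_add_of_lie_eq_zero hd (by rw [lie_neg, lie_skew, lie_eq_zero_of_lieExp_eq hd h]),
      lieExp_neg, h, mul_inv_cancel]
  · intro h
    have h1 := lieExp_add_of_lie_eq_zero hd (lie_eq_zero_of_lieExp_eq_one hd h A)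
    rw [h, one_mul, neg_add_cancel_right] at h1
    exact h1.symm

/-- The kernel of the exponential map, in coordinates. -/
def expKerE (hd : IsNilpotentOfClass E G d) : AddSubgroup E := expKer hd

theorem isDiscrete_expKerE (hd : IsNilpotentOfClass E G d) :
    IsDiscrete (expKerE (G := G) hd : Set E) := by
  refine IsDiscrete.of_nhdsWithin fun x hx => ?_
  have h := hasStrictFDerivAt_expE_equiv hd (G := G) x
  have hU := (h.toOpenPartialHomeomorph _).open_source.mem_nhds
    h.mem_toOpenPartialHomeomorph_source
  have hval : ∀ {y}, y ∈ expKerE (G := G) hd → expE E G y = 1 := fun {y} hy => hy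
  rw [Filter.le_pure_iff, mem_nhdsWithin_iff_eventually]
  filter_upwards [hU] with y hy hyK
  refine (h.toOpenPartialHomeomorph _).injOn hy h.mem_toOpenPartialHomeomorph_source
    (?_ : oneChart E G ((expE E G x)⁻¹ * expE E G y) = oneChart E G ((expE E G x)⁻¹ * expE E G x))
  rw [hval hx, hval hyK]

theorem isCoveringMap_expE [ConnectedSpace G] (hd : IsNilpotentOfClass E G d) :
    IsCoveringMap (expE E G) :=
  (((isOpenMap_expE hd).isQuotientMap (continuous_expE hd)
    (expE_surjective hd)).isAddQuotientCoveringMap_of_addSubgroup (expKerE (G := G) hd)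
      (isDiscrete_expKerE hd) (lieExp_eq_iff hd)).isCoveringMap

/-- The inverse is the lift of the identity of `G` through the covering `exp`. Uniqueness of lifts
makes it a left inverse too. -/
theorem exists_continuous_inverse_expE [SimplyConnectedSpace G] (hd : IsNilpotentOfClass E G d) :
    ∃ F : G → E, Continuous F ∧ (∀ g, expE E G (F g) = g) ∧ ∀ Z, F (expE E G Z) = Z := by
  have : LocallyPathConnectedSpace G := ChartedSpace.locallyPathConnectedSpace E G
  have cov := isCoveringMap_expE (G := G) hd
  have h0 : expE E G 0 = 1 := lieExp_zero
  obtain ⟨F, ⟨hF1, hF2⟩, -⟩ := cov.existsUnique_continuousMap_lifts (ContinuousMap.id G) 1 0 h0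
  have h1 : ∀ g, expE E G (F g) = g := fun g => congrFun hF2 g
  refine ⟨F, F.continuous, h1, fun Z => ?_⟩
  have h2 := cov.eq_of_comp_eq (g₁ := fun Z => F (expE E G Z)) (g₂ := id)
    (F.continuous.comp (continuous_expE hd)) continuous_id (by ext Z; simp [h1]) 0
    (by simp [h0, hF1])
  exact congrFun h2 Z

theorem lieExp_bijective [SimplyConnectedSpace G] (hd : IsNilpotentOfClass E G d) :
    Function.Bijective (lieExp : LieAlg E G → G) := by
  obtain ⟨F, -, h1, h2⟩ := exists_continuous_inverse_expE (G := G) hd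
  exact ⟨Function.LeftInverse.injective (g := F) h2, Function.RightInverse.surjective (g := F) h1⟩

variable (E) in
/-- The logarithm: the inverse of the exponential map, when that is bijective. -/
def lieLog (g : G) : LieAlg E G := Function.invFun (lieExp : LieAlg E G → G) g

theorem lieExp_lieLog [SimplyConnectedSpace G] (hd : IsNilpotentOfClass E G d) (g : G) :
    lieExp (lieLog E g) = g :=
  Function.invFun_eq ((lieExp_bijective hd).2 g)

theorem lieLog_lieExp [SimplyConnectedSpace G] (hd : IsNilpotentOfClass E G d) (Z : LieAlg E G) :
    lieLog E (lieExp Z) = Z :=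
  Function.leftInverse_invFun (lieExp_bijective hd).1 Z

theorem continuous_lieLog [SimplyConnectedSpace G] (hd : IsNilpotentOfClass E G d) :
    Continuous (lieLog E : G → E) := by
  obtain ⟨F, hF, h1, h2⟩ := exists_continuous_inverse_expE (G := G) hd
  exact (funext fun g => (lieExp_bijective hd).1 ((lieExp_lieLog hd g).trans (h1 g).symm) :
    (lieLog E : G → E) = F) ▸ hF

theorem lieLog_one [SimplyConnectedSpace G] (hd : IsNilpotentOfClass E G d) :
    lieLog E (1 : G) = 0 :=
  (congrArg (lieLog E) lieExp_zero.symm).trans (lieLog_lieExp hd 0)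

/-- Near the identity the logarithm is the local inverse of `exp` at `0`, where `dexp` is the
identity. -/
theorem hasDerivAt_lieLog [SimplyConnectedSpace G] (hd : IsNilpotentOfClass E G d) {γ : ℝ → G}
    {W : LieAlg E G} {t : ℝ} (h : HasLogDeriv E γ W t) (ht : γ t = 1) :
    HasDerivAt (F := E) (fun s => lieLog E (γ s)) W t := by
  have hs := hasStrictFDerivAt_expE_equiv hd (G := G) 0
  have h0 : expE E G 0 = 1 := lieExp_zero
  have hlog : Filter.Tendsto (fun s => (lieLog E : G → E) (γ s)) (𝓝 t) (𝓝 0) := by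
    have h1 := (continuous_lieLog hd).continuousAt.comp h.continuousAt
    rw [ContinuousAt, Function.comp_apply, ht] at h1
    exact (lieLog_one hd (G := G)) ▸ h1
  have h1 := h.hasDerivAt
  simp only [ht, inv_one, one_mul] at h1
  have h2 := hs.to_localInverse.hasFDerivAt
  have h3 : oneChart E G ((expE E G 0)⁻¹ * expE E G 0) = oneChart E G (γ t) := by
    rw [ht, inv_mul_cancel]
  rw [h3] at h2
  have h4 := h2.comp_hasDerivAt t h1
  have h5 : (dexpEquiv E G hd 0).symm W = W := by
    refine ((dexpEquiv E G hd 0).symm_apply_eq).2 ?_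
    refine ((dexpE_apply (0 : LieAlg E G) W).trans ?_).symm
    rw [dexp_apply, Finset.sum_range_succ', Finset.sum_eq_zero fun j _ => ?_]
    · simp
      rfl
    · simp [pow_succ]
  refine (h4.congr_of_eventuallyEq ?_).congr_deriv h5
  filter_upwards [hlog.eventually hs.eventually_left_inverse] with s h6
  have h7 : (expE E G 0)⁻¹ * expE E G (lieLog E (γ s)) = γ s := by
    rw [h0, inv_one, one_mul]
    exact lieExp_lieLog hd (γ s)
  exact h6.symm.trans (congrArg _ (congrArg (oneChart E G) h7))

end ExpBijective

/-- A continuous phase with trivial exponential, on a preconnected set, is constant. -/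
theorem eq_zero_of_isPreconnected {α : Type*} [TopologicalSpace α] {S : Set α}
    (hS : IsPreconnected S) {f : α → ℝ} (hf : ContinuousOn f S)
    (h : ∀ a ∈ S, Complex.exp (Complex.I * (f a : ℝ)) = 1) {a₀ a : α} (ha₀ : a₀ ∈ S)
    (h0 : f a₀ = 0) (ha : a ∈ S) : f a = 0 := by
  rw [← h0]
  refine hS.constant_of_mapsTo (T := (AddSubgroup.zmultiples (2 * Real.pi) : Set ℝ))
    ⟨inferInstanceAs (DiscreteTopology (AddSubgroup.zmultiples (2 * Real.pi)))⟩ hf (fun b hb => ?_) ha ha₀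
  obtain ⟨n, hn⟩ := Complex.exp_eq_one_iff.1 (h b hb)
  refine ⟨n, ?_⟩
  have h1 : (f b : ℂ) = ((n * (2 * Real.pi) : ℝ) : ℂ) := by
    apply mul_left_cancel₀ Complex.I_ne_zero
    rw [hn]
    push_cast
    ring
  simpa using (Complex.ofReal_injective h1).symm

section Subgroups

open Topology

variable {E : Type*} [NormedAddCommGroup E] [NormedSpace ℝ E] [FiniteDimensional ℝ E]
  [CompleteSpace E] {G : Type*} [TopologicalSpace G] [ChartedSpace E G] [Group G]
  [LieGroup 𝓘(ℝ, E) ∞ G] [T2Space G] {d : ℕ}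

/-! ### Polynomial functions -/

variable (E) in
/-- The continuous functions on `G` that are polynomial along the cosets of one-parameter
subgroups. -/
structure IsPolyFun (f : G → ℝ) : Prop where
  continuous : Continuous f
  mem_polyCurve : ∀ (a b : G) (Z : LieAlg E G),
    (fun t : ℝ => f (a * lieExp (t • Z) * b)) ∈ polyCurve ℝ

theorem IsPolyFun.comp_mul_right {f : G → ℝ} (hf : IsPolyFun E f) (b : G) :
    IsPolyFun E fun g => f (g * b) where
  continuous := by
    have := isTopologicalGroup E G
    exact hf.continuous.comp (continuous_mul_const b)
  mem_polyCurve a c Z := by simpa only [mul_assoc] using hf.mem_polyCurve a (c * b) Z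

theorem IsPolyFun.comp_mul_left {f : G → ℝ} (hf : IsPolyFun E f) (b : G) :
    IsPolyFun E fun g => f (b * g) where
  continuous := by
    have := isTopologicalGroup E G
    exact hf.continuous.comp (continuous_const_mul b)
  mem_polyCurve a c Z := by simpa only [mul_assoc] using hf.mem_polyCurve (b * a) c Z

theorem IsPolyFun.comp_inv {f : G → ℝ} (hf : IsPolyFun E f) : IsPolyFun E fun g => f g⁻¹ where
  continuous := by
    have := isTopologicalGroup E G
    exact hf.continuous.comp continuous_inv
  mem_polyCurve a c Z := by
    convert! comp_mul_mem_polyCurve (-1) (hf.mem_polyCurve c⁻¹ a⁻¹ Z) using 3 with t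
    rw [neg_one_mul, neg_smul, lieExp_neg, mul_inv_rev, mul_inv_rev, mul_assoc]

theorem IsPolyFun.sub {f f' : G → ℝ} (hf : IsPolyFun E f) (hf' : IsPolyFun E f') :
    IsPolyFun E fun g => f g - f' g where
  continuous := hf.continuous.sub hf'.continuous
  mem_polyCurve a b Z := sub_mem (hf.mem_polyCurve a b Z) (hf'.mem_polyCurve a b Z)

theorem isPolyFun_const (c : ℝ) : IsPolyFun E fun _ : G => c where
  continuous := continuous_const
  mem_polyCurve _ _ _ := const_mem_polyCurve c

/-- The real valued function `g ↦ ⟨x, log g⟩`, whose exponential is `ξ`. -/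
def logForm (x : Module.Dual ℝ (LieAlg E G)) (g : G) : ℝ := x (lieLog E g)

theorem xi_eq (x : Module.Dual ℝ (LieAlg E G)) (g : G) :
    xi x g = Complex.exp (Complex.I * (logForm x g : ℝ)) := rfl

theorem continuous_dual (x : Module.Dual ℝ (LieAlg E G)) : Continuous (X := E) x :=
  (LinearMap.toContinuousLinearMap (show E →ₗ[ℝ] ℝ from x)).continuous

variable [SimplyConnectedSpace G]

theorem logForm_lieExp (hd : IsNilpotentOfClass E G d) (x : Module.Dual ℝ (LieAlg E G))
    (Z : LieAlg E G) : logForm x (lieExp Z) = x Z := by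
  rw [logForm, lieLog_lieExp hd]

theorem logForm_one (hd : IsNilpotentOfClass E G d) (x : Module.Dual ℝ (LieAlg E G)) :
    logForm x 1 = 0 := by
  rw [logForm, lieLog_one hd, map_zero]

/-- `a exp(tZ) b = (ab) exp(t Ad(b⁻¹)Z)`, whose logarithm is a polynomial curve in `t`. -/
theorem isPolyFun_logForm (hd : IsNilpotentOfClass E G d) (x : Module.Dual ℝ (LieAlg E G)) :
    IsPolyFun E (logForm x) where
  continuous := (continuous_dual x).comp (continuous_lieLog hd)
  mem_polyCurve a b Z := by
    obtain ⟨Y, hY, -, h, -⟩ :=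
      exists_polyCurve_mul_lieExp hd (lieLog E (a * b)) (Ad b⁻¹ Z : LieAlg E G)
    convert! map_mem_polyCurve x hY using 2 with t
    have h1 : a * lieExp (t • Z) * b = lieExp (Y t) := by
      rw [h, lieExp_lieLog hd, ← map_smul, ← conj_lieExp]
      simp [mul_assoc]
    rw [h1, logForm_lieExp hd]

/-! ### Subordinate subgroups -/

variable {x : Module.Dual ℝ (LieAlg E G)} {H : Subgroup G}

/-- The defect of additivity takes values in `2πℤ`, depends continuously on `h`, and vanishes at `h
= 1`; and `H` is connected. -/
theorem IsSubordinate.logForm_mul (hd : IsNilpotentOfClass E G d) (hH : IsSubordinate x H) {h k : G}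
    (hh : h ∈ H) (hk : k ∈ H) : logForm x (h * k) = logForm x h + logForm x k := by
  have h1 := eq_zero_of_isPreconnected hH.isConnected.isPreconnected
    (f := fun h => logForm x (h * k) - logForm x h - logForm x k)
    ((((isPolyFun_logForm hd x).comp_mul_right k).sub (isPolyFun_logForm hd x)).sub
      (isPolyFun_const _)).continuous.continuousOn (fun h hh => ?_) H.one_mem
    (by simp [logForm_one hd]) hh
  · linarith
  · have h2 := hH.map_mul h hh k hk
    simp only [xi_eq] at h2
    push_cast
    rw [mul_sub, mul_sub, Complex.exp_sub, Complex.exp_sub, h2]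
    field_simp [Complex.exp_ne_zero]

theorem lieExp_smul_lieLog_natCast (hd : IsNilpotentOfClass E G d) (g : G) (n : ℕ) :
    lieExp ((n : ℝ) • lieLog E g) = g ^ n := by
  rw [lieExp_nat_smul, lieExp_lieLog hd]

variable (E) in
/-- The Zariski closure of a subgroup. -/
def zariskiClosure (H : Subgroup G) : Subgroup G where
  carrier := {g | ∀ f : G → ℝ, IsPolyFun E f → (∀ h ∈ H, f h = 0) → f g = 0}
  one_mem' _ _ hfH := hfH 1 H.one_mem
  -- For `h ∈ H` the function `f(h ·)` vanishes on `H`, hence at `b`. So `f(· b)` vanishes on `H`,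
  -- hence at `a`.
  mul_mem' {_ b} ha hb _ hf hfH := ha _ (hf.comp_mul_right b) fun h hh =>
    hb _ (hf.comp_mul_left h) fun _ hk => hfH _ (H.mul_mem hh hk)
  inv_mem' ha _ hf hfH := ha _ hf.comp_inv fun _ hh => hfH _ (H.inv_mem hh)

theorem eq_zero_of_mem_zariskiClosure {f : G → ℝ} (hf : IsPolyFun E f) (hfH : ∀ h ∈ H, f h = 0)
    {g : G} (hg : g ∈ zariskiClosure E H) : f g = 0 := hg f hf hfH

theorem isClosed_zariskiClosure : IsClosed (zariskiClosure E H : Set G) := by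
  have : (zariskiClosure E H : Set G) =
      ⋂ (f : G → ℝ) (_ : IsPolyFun E f) (_ : ∀ h ∈ H, f h = 0), {g | f g = 0} := by
    ext g
    simp only [Set.mem_iInter]
    rfl
  rw [this]
  exact isClosed_iInter fun f => isClosed_iInter fun hf => isClosed_iInter fun _ =>
    isClosed_eq hf.continuous continuous_const

/-- A polynomial function that vanishes on `H` vanishes at all powers `gⁿ`. Along `t ↦ exp(t log g)`
it is thus a polynomial with infinitely many zeros. -/
theorem lieExp_smul_mem_zariskiClosure (hd : IsNilpotentOfClass E G d) {g : G}
    (hg : g ∈ zariskiClosure E H) (t : ℝ) : lieExp (t • lieLog E g) ∈ zariskiClosure E H := by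
  intro f hf hfH
  have h1 := hf.mem_polyCurve 1 1 (lieLog E g)
  simp only [one_mul, mul_one] at h1
  refine eq_zero_of_mem_polyCurve_of_nat h1 (fun n => ?_) t
  rw [lieExp_smul_lieLog_natCast hd]
  exact eq_zero_of_mem_zariskiClosure hf hfH (pow_mem hg n)

/-- A subgroup that contains the one-parameter subgroups of its elements is connected. -/
theorem isConnected_of_lieExp_smul_mem (hd : IsNilpotentOfClass E G d) {K : Subgroup G}
    (hK : ∀ g ∈ K, ∀ t : ℝ, lieExp (t • lieLog E g) ∈ K) : IsConnected (K : Set G) := by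
  refine ⟨⟨1, K.one_mem⟩, isPreconnected_of_forall 1 fun g hg => ?_⟩
  refine ⟨Set.range fun t : ℝ => lieExp (t • lieLog E g), ?_, ⟨0, by simp [lieExp_zero]⟩,
    ⟨1, by simp [lieExp_lieLog hd]⟩, isPreconnected_range ?_⟩
  · rintro _ ⟨t, rfl⟩
    exact hK g hg t
  · exact continuous_iff_continuousAt.2 fun t => (hasLogDeriv_lieExp (lieLog E g) t).continuousAt

/-- Additivity of `⟨x, log ·⟩` is a polynomial condition in each variable, so it passes to the
closure first in `h`, then in `k`. -/
theorem IsSubordinate.zariskiClosure (hd : IsNilpotentOfClass E G d) (hH : IsSubordinate x H) :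
    IsSubordinate x (zariskiClosure E H) where
  isClosed := isClosed_zariskiClosure
  isConnected := isConnected_of_lieExp_smul_mem hd fun g hg => lieExp_smul_mem_zariskiClosure hd hg
  map_mul h hh k hk := by
    have hl := isPolyFun_logForm hd x
    have h1 : ∀ k ∈ H, logForm x (h * k) - logForm x h - logForm x k = 0 := fun k hk =>
      eq_zero_of_mem_zariskiClosure (((hl.comp_mul_right k).sub hl).sub (isPolyFun_const _))
        (fun h hh => by rw [hH.logForm_mul hd hh hk]; ring) hh
    have h2 : logForm x (h * k) - logForm x h - logForm x k = 0 :=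
      eq_zero_of_mem_zariskiClosure (((hl.comp_mul_left h).sub (isPolyFun_const _)).sub hl) h1 hk
    have h3 : logForm x (h * k) = logForm x h + logForm x k := by linarith
    rw [xi_eq, h3, xi_eq, xi_eq, ← Complex.exp_add]
    push_cast
    ring_nf

/-- By maximality `H` equals its Zariski closure. This replaces the general theory of closed
connected subgroups. -/
theorem lieExp_smul_mem_of_maximal (hd : IsNilpotentOfClass E G d)
    (hH : Maximal (IsSubordinate x) H) {h : G} (hh : h ∈ H) (t : ℝ) :
    lieExp (t • lieLog E h) ∈ H :=
  hH.2 (hH.1.zariskiClosure hd) (fun _ hk _ _ hfH => hfH _ hk)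
    (lieExp_smul_mem_zariskiClosure hd (fun _ _ hfH => hfH _ hh) t)

theorem mem_of_isClosed_of_hasDerivAt {S : Set E} (hS : IsClosed S) {γ : ℝ → E} {W : E}
    (h : HasDerivAt γ W 0) (hγ : ∀ t : ℝ, t⁻¹ • (γ t - γ 0) ∈ S) : W ∈ S := by
  refine hS.mem_of_tendsto (hasDerivAt_iff_tendsto_slope.1 h) (Filter.Eventually.of_forall fun t => ?_)
  simpa [slope_def_module] using hγ t

theorem mem_of_hasDerivAt_dual {S : Submodule ℝ (LieAlg E G)} {γ : ℝ → LieAlg E G} {W : LieAlg E G}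
    (h : HasDerivAt (F := E) γ W 0) (hγ : ∀ t, γ t - γ 0 ∈ S) : W ∈ S := by
  have hS : IsClosed (X := E) (S : Set (LieAlg E G)) :=
    Submodule.closed_of_finiteDimensional (show Submodule ℝ E from S)
  exact mem_of_isClosed_of_hasDerivAt hS h fun t => S.smul_mem _ (hγ t)

theorem hasDerivAt_expAd_zero (hd : IsNilpotentOfClass E G d) (A B : LieAlg E G) :
    HasDerivAt (F := E) (fun t => expAd d t A B) (⁅A, B⁆ : LieAlg E G) 0 :=
  (hasDerivAt_expAd hd A B 0).congr_deriv (expAd_zero A ⁅A, B⁆)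

/-- The Lie algebra of a closed subgroup that contains the one-parameter subgroups of its
elements. -/
def logSubalgebra (hd : IsNilpotentOfClass E G d) (H : Subgroup G) (hc : IsClosed (H : Set G))
    (hH : ∀ h ∈ H, ∀ t : ℝ, lieExp (t • lieLog E h) ∈ H) : LieSubalgebra ℝ (LieAlg E G) :=
  have hS : IsClosed (X := E) {Z : LieAlg E G | lieExp Z ∈ H} := hc.preimage (continuous_expE hd)
  have hsmul : ∀ (t : ℝ) (Z : LieAlg E G), lieExp Z ∈ H → lieExp (t • Z) ∈ H := fun t Z hZ => by
    simpa [lieLog_lieExp hd] using hH _ hZ t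
  -- `A + B` is the limit of `t⁻¹ log(exp(tA) exp(tB))`, and the set of logarithms is closed and
  -- stable under scaling.
  have hadd : ∀ A B : LieAlg E G, lieExp A ∈ H → lieExp B ∈ H → lieExp (A + B) ∈ H := by
    intro A B hA hB
    have h1 : HasLogDeriv E (fun s : ℝ => lieExp (s • A) * lieExp (s • B)) (A + B : LieAlg E G) 0 := by
      have h2 := (hasLogDeriv_lieExp A 0).mul (hasLogDeriv_lieExp B 0)
      rw [zero_smul, lieExp_zero, inv_one] at h2
      exact ⟨h2.1, h2.2.congr_deriv (congrArg (fun l : E →L[ℝ] E => @HAdd.hAdd E E E _ (l A) B) AdE_one)⟩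
    have h2 := hasDerivAt_lieLog hd h1 (by simp [lieExp_zero])
    refine mem_of_isClosed_of_hasDerivAt hS h2 fun t => ?_
    have h3 : lieExp (t⁻¹ • lieLog E (lieExp (t • A) * lieExp (t • B))) ∈ H :=
      hH _ (H.mul_mem (hsmul t A hA) (hsmul t B hB)) _
    have h4 : lieLog E (lieExp ((0 : ℝ) • A) * lieExp ((0 : ℝ) • B)) = 0 := by
      simp only [zero_smul, lieExp_zero, mul_one, lieLog_one hd]
    have h5 : t⁻¹ • (lieLog E (lieExp (t • A) * lieExp (t • B)) -
        lieLog E (lieExp ((0 : ℝ) • A) * lieExp ((0 : ℝ) • B))) =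
        t⁻¹ • lieLog E (lieExp (t • A) * lieExp (t • B)) := by rw [h4, sub_zero]
    rw [← h5] at h3
    exact h3
  { carrier := {Z | lieExp Z ∈ H}
    zero_mem' := by
      change lieExp (0 : LieAlg E G) ∈ H
      rw [lieExp_zero]
      exact H.one_mem
    add_mem' := fun {A B} => hadd A B
    smul_mem' := hsmul
    -- `[A, B]` is the limit of `t⁻¹ (Ad(exp tA) B - B)`, and conjugation by `exp tA` preserves `H`.
    lie_mem' := fun {A B} hA hB => by
      refine mem_of_isClosed_of_hasDerivAt hS (hasDerivAt_expAd_zero hd A B) fun t => ?_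
      refine hsmul t⁻¹ (expAd d t A B - expAd d 0 A B) ?_
      rw [expAd_zero, ← Ad_lieExp_smul hd, sub_eq_add_neg]
      refine hadd _ _ ?_ (by rw [lieExp_neg]; exact H.inv_mem hB)
      rw [← conj_lieExp]
      exact H.mul_mem (H.mul_mem (hsmul t A hA) hB) (H.inv_mem (hsmul t A hA)) }

/-- The Lie algebra of a maximal subordinate subgroup. -/
def maxSubalgebra (hd : IsNilpotentOfClass E G d) (hH : Maximal (IsSubordinate x) H) :
    LieSubalgebra ℝ (LieAlg E G) :=
  logSubalgebra hd H hH.1.isClosed fun _ hh t => lieExp_smul_mem_of_maximal hd hH hh t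

theorem mem_maxSubalgebra {hd : IsNilpotentOfClass E G d} {hH : Maximal (IsSubordinate x) H}
    {Z : LieAlg E G} : Z ∈ maxSubalgebra hd hH ↔ lieExp Z ∈ H := Iff.rfl

/-- A character is invariant under conjugation, so `⟨x, Ad(exp tA) B⟩ = ⟨x, B⟩`; differentiate at `t
= 0`. -/
theorem dual_lie_eq_zero_of_maximal (hd : IsNilpotentOfClass E G d)
    (hH : Maximal (IsSubordinate x) H) {A B : LieAlg E G} (hA : A ∈ maxSubalgebra hd hH)
    (hB : B ∈ maxSubalgebra hd hH) : x ⁅A, B⁆ = 0 := by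
  refine mem_of_hasDerivAt_dual (S := LinearMap.ker x) (hasDerivAt_expAd_zero hd A B) fun t => ?_
  have hA' := (maxSubalgebra hd hH).smul_mem t hA
  rw [mem_maxSubalgebra] at hA' hB
  have h1 := hH.1.logForm_mul hd (H.mul_mem hA' hB) (H.inv_mem hA')
  have h2 := hH.1.logForm_mul hd hA' hB
  rw [← lieExp_neg, logForm_lieExp hd, h2, lieExp_neg, conj_lieExp, Ad_lieExp_smul hd,
    logForm_lieExp hd, logForm_lieExp hd, logForm_lieExp hd, map_neg] at h1
  rw [LinearMap.mem_ker, map_sub, h1, expAd_zero]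
  ring

/-- The subgroup with a given Lie algebra. -/
def expSubgroup (hd : IsNilpotentOfClass E G d) (T : LieSubalgebra ℝ (LieAlg E G)) :
    Subgroup G where
  carrier := {g | lieLog E g ∈ T}
  one_mem' := by
    change lieLog E (1 : G) ∈ T
    rw [lieLog_one hd]
    exact T.zero_mem
  mul_mem' {a b} ha hb := by
    obtain ⟨C, hC, h⟩ := exists_lieExp_eq_mul hd (lieLog E a) (lieLog E b)
    rw [lieExp_lieLog hd, lieExp_lieLog hd] at hC
    change lieLog E (a * b) ∈ T
    rw [← hC, lieLog_lieExp hd]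
    exact (h T T.toSubmodule ha hb fun v hv w hw => T.lie_mem hv hw).1
  inv_mem' {a} ha := by
    change lieLog E a⁻¹ ∈ T
    rw [← lieExp_lieLog hd a, ← lieExp_neg, lieLog_lieExp hd]
    exact neg_mem ha

/-- By Baker-Campbell-Hausdorff, `log(hk) = log h + log k` modulo the kernel of `x`, because that
kernel contains the brackets of `T`. -/
theorem isSubordinate_expSubgroup (hd : IsNilpotentOfClass E G d)
    {T : LieSubalgebra ℝ (LieAlg E G)} (hT : ∀ v ∈ T, ∀ w ∈ T, x ⁅v, w⁆ = 0) :
    IsSubordinate x (expSubgroup hd T) where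
  isClosed := (Submodule.closed_of_finiteDimensional
    (show Submodule ℝ E from T.toSubmodule)).preimage (continuous_lieLog hd)
  isConnected := isConnected_of_lieExp_smul_mem hd fun g hg t => by
    change lieLog E (lieExp (t • lieLog E g)) ∈ T
    rw [lieLog_lieExp hd]
    exact T.smul_mem t hg
  map_mul h hh k hk := by
    obtain ⟨C, hC, h'⟩ := exists_lieExp_eq_mul hd (lieLog E h) (lieLog E k)
    rw [lieExp_lieLog hd, lieExp_lieLog hd] at hC
    have h1 := (h' T (LinearMap.ker x) hh hk hT).2
    rw [LinearMap.mem_ker, map_sub, map_add, sub_eq_zero] at h1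
    rw [xi_eq, xi_eq, xi_eq, ← Complex.exp_add, ← hC, logForm_lieExp hd, h1, logForm, logForm]
    push_cast
    ring_nf

/-- Maximality of `H`, transferred to the Lie algebra; every later appeal to maximality goes through
this form. -/
theorem le_maxSubalgebra (hd : IsNilpotentOfClass E G d) (hH : Maximal (IsSubordinate x) H)
    {T : LieSubalgebra ℝ (LieAlg E G)} (hle : maxSubalgebra hd hH ≤ T)
    (hT : ∀ v ∈ T, ∀ w ∈ T, x ⁅v, w⁆ = 0) : T ≤ maxSubalgebra hd hH := by
  intro Z hZ
  refine hH.2 (isSubordinate_expSubgroup hd hT) (fun h hh => ?_) ?_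
  · refine hle ?_
    rw [mem_maxSubalgebra, lieExp_lieLog hd]
    exact hh
  · change lieLog E (lieExp Z) ∈ T
    rwa [lieLog_lieExp hd]

end Subgroups

/-! ### States -/

section States

variable {K : Type*} [Group K] {m : K → ℂ}

/-- Positivity for indexed families, in which group elements may repeat. -/
theorem IsState.nonneg_sum {ι : Type*} [Fintype ι] (hm : IsState m) (c : ι → ℂ) (g : ι → K) :
    0 ≤ ∑ i, ∑ j, conj (c i) * c j * m ((g i)⁻¹ * g j) := by
  classical
  have h := hm.nonneg (∑ i, Finsupp.single (g i) (c i))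
  rw [← Finsupp.sum_finsetSum_index (by simp) (fun k a b => by
    simp [add_mul, Finsupp.sum_add])] at h
  refine h.trans_eq (Finset.sum_congr rfl fun i _ => ?_)
  rw [Finsupp.sum_single_index (by simp), ← Finsupp.sum_finsetSum_index (by simp)
    (fun k a b => by ring)]
  exact Finset.sum_congr rfl fun j _ => Finsupp.sum_single_index (by simp)

theorem IsState.map_inv (hm : IsState m) (g : K) : m g⁻¹ = conj (m g) := by
  have h1 := (Complex.le_def.1 (hm.nonneg_sum ![1, 1] ![1, g])).2
  have h2 := (Complex.le_def.1 (hm.nonneg_sum ![1, Complex.I] ![1, g])).2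
  simp [Fin.sum_univ_two, hm.map_one] at h1 h2
  apply Complex.ext
  · simp only [Complex.conj_re]
    linarith
  · simp only [Complex.conj_im]
    linarith

/-- Bessel's inequality. -/
theorem IsState.sum_norm_sq_le (hm : IsState m) {n : ℕ} (k : Fin n → K) (g : K)
    (hk : ∀ i j, i ≠ j → m ((k i)⁻¹ * k j) = 0) : ∑ i, ‖m ((k i)⁻¹ * g)‖ ^ 2 ≤ 1 := by
  -- The vector tested is that of `g` minus its projection onto the span of the orthonormal vectors
  -- of the `k i`.
  have h := hm.nonneg_sum (ι := Option (Fin n))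
    (fun i => i.elim 1 fun i => -m ((k i)⁻¹ * g)) (fun i => i.elim g k)
  have h1 : ∀ i j, m ((k i)⁻¹ * k j) = if i = j then 1 else 0 := by
    intro i j
    split_ifs with hij
    · rw [hij, inv_mul_cancel, hm.map_one]
    · exact hk i j hij
  have h2 : ∀ i, m (g⁻¹ * k i) = conj (m ((k i)⁻¹ * g)) := by
    intro i
    rw [← hm.map_inv, mul_inv_rev, inv_inv]
  have h3 : ∀ i, conj (m ((k i)⁻¹ * g)) * m ((k i)⁻¹ * g) = ((‖m ((k i)⁻¹ * g)‖ ^ 2 : ℝ) : ℂ) :=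
    fun i => by rw [Complex.conj_mul']; norm_cast
  have h4 : ∀ i, m ((k i)⁻¹ * g) * conj (m ((k i)⁻¹ * g)) = ((‖m ((k i)⁻¹ * g)‖ ^ 2 : ℝ) : ℂ) :=
    fun i => by rw [mul_comm, h3]
  simp only [Fintype.sum_option, Option.elim_none, Option.elim_some, inv_mul_cancel, hm.map_one,
    h1, h2, _root_.map_one, one_mul, mul_one, mul_ite, mul_zero, Finset.sum_ite_eq, Finset.mem_univ,
    if_true, map_neg, neg_mul, mul_neg, neg_neg, h4, h3,
    Finset.sum_neg_distrib, neg_add_cancel, Finset.sum_const_zero, add_zero] at h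
  have h5 : (0 : ℝ) ≤ 1 + -∑ i, ‖m ((k i)⁻¹ * g)‖ ^ 2 := by exact_mod_cast h
  linarith

theorem IsState.eq_zero_of_forall_norm_eq (hm : IsState m) (k : ℕ → K) (g : K)
    (hk : ∀ i j, i ≠ j → m ((k i)⁻¹ * k j) = 0) (hg : ∀ i, ‖m ((k i)⁻¹ * g)‖ = ‖m g‖) :
    m g = 0 := by
  by_contra h0
  have hpos : 0 < ‖m g‖ ^ 2 := by positivity
  obtain ⟨n, hn⟩ := exists_nat_gt (1 / ‖m g‖ ^ 2)
  have h := hm.sum_norm_sq_le (n := n) (fun i => k i) g fun i j hij =>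
    hk i j fun h => hij (Fin.ext h)
  simp only [hg, Finset.sum_const, Finset.card_univ, Fintype.card_fin, nsmul_eq_mul] at h
  rw [div_lt_iff₀ hpos] at hn
  linarith

/-- Equality in the Cauchy-Schwarz inequality: when `|m h| = 1`, the vector `δ_{h⁻¹} - conj(m h)
δ_1` has norm zero, hence is orthogonal to `δ_g`. -/
theorem IsState.map_mul_of_norm_eq_one (hm : IsState m) {h : K} (hh : ‖m h‖ = 1) (g : K) :
    m (h * g) = m h * m g := by
  have h2 : m h * conj (m h) = 1 := by rw [Complex.mul_conj', hh]; simp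
  obtain ⟨D, hD⟩ : ∃ D, D = m (h * g) - m h * m g := ⟨_, rfl⟩
  have hD' : conj D = conj (m (h * g)) - conj (m h) * conj (m g) := by
    rw [hD, map_sub, map_mul]
  by_contra hne
  have hpos : 0 < ‖D‖ ^ 2 := by
    have : D ≠ 0 := hD ▸ sub_ne_zero.2 hne
    positivity
  -- Positivity is tested on `δ_g - sD (δ_{h⁻¹} - conj(m h) δ_1)`. The term quadratic in `s` drops
  -- out, and an affine function of `s` that is never negative is constant.
  have key : ∀ s : ℝ, 0 ≤ 1 - 2 * s * ‖D‖ ^ 2 := fun s => by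
    have h1 := hm.nonneg_sum ![-s * D, s * D * conj (m h), 1] ![h⁻¹, 1, g]
    have h3 : m (g⁻¹ * h⁻¹) = conj (m (h * g)) := by rw [← mul_inv_rev, hm.map_inv]
    simp only [Fin.sum_univ_three, Matrix.cons_val_zero, Matrix.cons_val_one, Matrix.cons_val,
      inv_inv, mul_inv_cancel, hm.map_one, mul_one, inv_one, one_mul, inv_mul_cancel, hm.map_inv,
      h3, map_mul, map_neg, Complex.conj_ofReal, Complex.conj_conj, _root_.map_one] at h1
    have h4 : (0 : ℂ) ≤ ((1 - 2 * s * ‖D‖ ^ 2 : ℝ) : ℂ) := by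
      refine h1.trans_eq ?_
      push_cast
      rw [← Complex.mul_conj']
      linear_combination (-(s ^ 2 * D * conj D)) * h2 + s * conj D * hD + s * D * hD'
    exact_mod_cast h4
  have h5 := key (1 / ‖D‖ ^ 2)
  rw [mul_assoc, one_div_mul_cancel hpos.ne'] at h5
  linarith

end States

/-! ### Consequences of maximality, normalizers, and uniqueness of the state -/

section Normalizer

open Topology

variable {E : Type*} [NormedAddCommGroup E] [NormedSpace ℝ E] [FiniteDimensional ℝ E]
  [CompleteSpace E] {G : Type*} [TopologicalSpace G] [ChartedSpace E G] [Group G]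
  [LieGroup 𝓘(ℝ, E) ∞ G] [T2Space G] [SimplyConnectedSpace G] {d : ℕ}
  {x : Module.Dual ℝ (LieAlg E G)} {H : Subgroup G}

theorem Ad_lie (hd : IsNilpotentOfClass E G d) (g : G) (W Z : LieAlg E G) :
    Ad g ⁅W, Z⁆ = ⁅Ad g W, Ad g Z⁆ := by
  have h1 : HasDerivAt (F := E) (fun t => Ad g (expAd d t W Z)) (Ad g ⁅W, Z⁆) 0 :=
    (show E →L[ℝ] E from Ad g).hasFDerivAt.comp_hasDerivAt 0 (hasDerivAt_expAd_zero hd W Z)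
  have h2 : (fun t => Ad g (expAd d t W Z)) = fun t => expAd d t (Ad g W) (Ad g Z) := by
    funext t
    rw [← Ad_lieExp_smul hd, ← Ad_lieExp_smul hd, ← map_smul, ← conj_lieExp, ← Ad_mul_apply,
      ← Ad_mul_apply, inv_mul_cancel_right]
  rw [h2] at h1
  exact h1.unique (hasDerivAt_expAd_zero hd (Ad g W) (Ad g Z))

/-- The `Z ∈ 𝔤` whose hamiltonian is constant on the coadjoint orbit of `x`. -/
def orbitKernel (x : Module.Dual ℝ (LieAlg E G)) : Submodule ℝ (LieAlg E G) where
  carrier := {Z | ∀ g : G, x (Ad g Z) = x Z}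
  zero_mem' g := by simp
  add_mem' {A B} hA hB g := by rw [map_add, map_add, hA g, hB g, map_add]
  smul_mem' a Z hZ g := by rw [map_smul, map_smul, hZ g, map_smul]

theorem mem_orbitKernel {Z : LieAlg E G} :
    Z ∈ orbitKernel x ↔ ∀ g : G, x (Ad g Z) = x Z := Iff.rfl

theorem dual_lie_eq_zero_of_mem_orbitKernel (hd : IsNilpotentOfClass E G d) {Z : LieAlg E G}
    (hZ : Z ∈ orbitKernel x) (W : LieAlg E G) : x ⁅W, Z⁆ = 0 :=
  mem_of_hasDerivAt_dual (S := LinearMap.ker x) (hasDerivAt_expAd_zero hd W Z) fun t => by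
    rw [LinearMap.mem_ker, map_sub, expAd_zero, ← Ad_lieExp_smul hd, mem_orbitKernel.1 hZ, sub_self]

/-- `x` kills brackets with the kernel, and the kernel is stable under `Ad`. So `⟨x, Ad g [W, Z]⟩`
and `⟨x, [W, Z]⟩` both vanish. -/
theorem lie_mem_orbitKernel (hd : IsNilpotentOfClass E G d) {Z : LieAlg E G}
    (hZ : Z ∈ orbitKernel x) (W : LieAlg E G) : ⁅W, Z⁆ ∈ orbitKernel x := fun g => by
  have h : Ad g Z ∈ orbitKernel x := fun g' => by rw [← Ad_mul_apply, hZ, hZ]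
  rw [Ad_lie hd, dual_lie_eq_zero_of_mem_orbitKernel hd h, dual_lie_eq_zero_of_mem_orbitKernel hd hZ]

/-- The kernel `N` is an ideal with `⟨x, [𝔤, N]⟩ = 0`, so `𝔥 + N` is a subalgebra on whose brackets
`x` vanishes. -/
theorem orbitKernel_le_maxSubalgebra (hd : IsNilpotentOfClass E G d)
    (hH : Maximal (IsSubordinate x) H) : orbitKernel x ≤ (maxSubalgebra hd hH).toSubmodule := by
  have h1 : ∀ v : LieAlg E G, ∀ w ∈ orbitKernel x,
      ⁅v, w⁆ ∈ (maxSubalgebra hd hH).toSubmodule ⊔ orbitKernel x := fun v w hw =>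
    Submodule.mem_sup_right (lie_mem_orbitKernel hd hw v)
  have h2 := le_maxSubalgebra hd hH
    (T := supSubalgebra (maxSubalgebra hd hH) (orbitKernel x) (fun v _ => h1 v) (fun v _ => h1 v))
    (fun Z hZ => Submodule.mem_sup_left (S := (maxSubalgebra hd hH).toSubmodule) hZ) ?_
  · exact fun Z hZ => h2 (Submodule.mem_sup_right (S := (maxSubalgebra hd hH).toSubmodule) hZ)
  · intro v hv w hw
    obtain ⟨a, ha, b, hb, rfl⟩ := Submodule.mem_sup.1 hv
    obtain ⟨a', ha', b', hb', rfl⟩ := Submodule.mem_sup.1 hw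
    rw [lie_add, add_lie, map_add, map_add, dual_lie_eq_zero_of_mem_orbitKernel hd hb',
      dual_lie_eq_zero_of_maximal hd hH ha ha', ← lie_skew, map_neg,
      dual_lie_eq_zero_of_mem_orbitKernel hd hb]
    simp

theorem eq_of_forall_exp_eq {a b : ℝ}
    (h : ∀ s : ℝ, Complex.exp (Complex.I * (s * a : ℝ)) = Complex.exp (Complex.I * (s * b : ℝ))) :
    a = b := by
  have h1 := eq_zero_of_isPreconnected (isPreconnected_univ (α := ℝ)) (f := fun s => s * a - s * b)
    (by fun_prop) (fun s _ => by
      push_cast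
      have := h s
      push_cast at this
      rw [mul_sub, Complex.exp_sub, this, div_self (Complex.exp_ne_zero _)])
    (Set.mem_univ 0) (by simp) (Set.mem_univ 1)
  linarith

/-- The elements that normalize a maximal subordinate subgroup and its character belong to it. -/
theorem mem_of_conj_mem_of_xi_eq (hd : IsNilpotentOfClass E G d)
    (hH : Maximal (IsSubordinate x) H) {g : G} (h1 : ∀ h ∈ H, g * h * g⁻¹ ∈ H)
    (h2 : ∀ h ∈ H, xi x (g * h * g⁻¹) = xi x h) : g ∈ H := by
  set W := lieLog E g with hW
  set T := maxSubalgebra hd hH with hT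
  have hAd : ∀ Z ∈ T, Ad g Z ∈ T ∧ x (Ad g Z) = x Z := by
    intro Z hZ
    refine ⟨?_, eq_of_forall_exp_eq fun s => ?_⟩
    · rw [mem_maxSubalgebra, ← conj_lieExp]
      exact h1 _ hZ
    · have h3 := h2 _ (T.smul_mem s hZ)
      rw [conj_lieExp, xi_eq, xi_eq, logForm_lieExp hd, logForm_lieExp hd, map_smul, map_smul,
        map_smul] at h3
      exact h3
  have hpow : ∀ Z ∈ T, ∀ n : ℕ, expAd d n W Z ∈ T ∧ x (expAd d n W Z) = x Z := by
    intro Z hZ n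
    rw [← Ad_lieExp_smul hd, hW, lieExp_smul_lieLog_natCast hd]
    induction n with
    | zero => rw [pow_zero, Ad_one_apply]; exact ⟨hZ, rfl⟩
    | succ n ih =>
      rw [pow_succ', Ad_mul_apply]
      exact ⟨(hAd _ ih.1).1, (hAd _ ih.1).2.trans ih.2⟩
  have hpoly : ∀ Z, (fun t => expAd d t W Z) ∈ polyCurve (LieAlg E G) := fun Z => by
    simpa only [expAd_smul] using
      expAd_mem_polyCurve d 1 (smul_mem_polyCurve W) (const_mem_polyCurve Z)
  -- Both conditions are polynomial in `t` and hold at the natural numbers, by taking powers of `g`.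
  -- Differentiating at `t = 0` then shows that `W` normalizes `T` and that `x` kills `[W, T]`, so
  -- `T + ℝW` is covered by maximality.
  have hflow : ∀ Z ∈ T, ∀ t : ℝ, expAd d t W Z ∈ T ∧ x (expAd d t W Z) = x Z := by
    intro Z hZ t
    constructor
    · refine mem_of_forall_dual (S := T.toSubmodule) fun l hl => ?_
      exact eq_zero_of_mem_polyCurve_of_nat (map_mem_polyCurve l (hpoly Z))
        (fun n => hl _ (hpow Z hZ n).1) t
    · have h3 := eq_zero_of_mem_polyCurve_of_nat
        (sub_mem (map_mem_polyCurve x (hpoly Z)) (const_mem_polyCurve (x Z)))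
        (fun n => sub_eq_zero.2 (hpow Z hZ n).2) t
      exact sub_eq_zero.1 h3
  have hlie : ∀ Z ∈ T, ⁅W, Z⁆ ∈ T ∧ x ⁅W, Z⁆ = 0 := by
    intro Z hZ
    constructor
    · refine mem_of_hasDerivAt_dual (S := T.toSubmodule) (hasDerivAt_expAd_zero hd W Z) fun t => ?_
      exact sub_mem (hflow Z hZ t).1 (hflow Z hZ 0).1
    · refine mem_of_hasDerivAt_dual (S := LinearMap.ker x) (hasDerivAt_expAd_zero hd W Z)
        fun t => ?_
      rw [LinearMap.mem_ker, map_sub, (hflow Z hZ t).2, (hflow Z hZ 0).2, sub_self]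
  have h3 := le_maxSubalgebra hd hH
    (T := supSubalgebra T (ℝ ∙ W)
      (fun v hv w hw => by
        obtain ⟨a, rfl⟩ := Submodule.mem_span_singleton.1 hw
        rw [lie_smul, ← lie_skew]
        exact Submodule.mem_sup_left (Submodule.smul_mem _ a (neg_mem (hlie v hv).1)))
      (fun v hv w hw => by
        obtain ⟨a, rfl⟩ := Submodule.mem_span_singleton.1 hw
        obtain ⟨b, rfl⟩ := Submodule.mem_span_singleton.1 hv
        rw [lie_smul, smul_lie, lie_self, smul_zero, smul_zero]
        exact zero_mem _))
    (fun Z hZ => Submodule.mem_sup_left (S := T.toSubmodule) hZ) ?_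
  · have h4 : W ∈ T := h3 (Submodule.mem_sup_right (S := T.toSubmodule)
      (Submodule.mem_span_singleton_self W))
    rwa [mem_maxSubalgebra, hW, lieExp_lieLog hd] at h4
  · intro v hv w hw
    obtain ⟨a, ha, b, hb, rfl⟩ := Submodule.mem_sup.1 hv
    obtain ⟨a', ha', b', hb', rfl⟩ := Submodule.mem_sup.1 hw
    obtain ⟨r, rfl⟩ := Submodule.mem_span_singleton.1 hb
    obtain ⟨r', rfl⟩ := Submodule.mem_span_singleton.1 hb'
    rw [lie_add, add_lie, add_lie, map_add, map_add, map_add, dual_lie_eq_zero_of_maximal hd hH ha ha',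
      smul_lie, map_smul, (hlie a' ha').2, lie_smul, ← lie_skew, smul_neg, map_neg, map_smul,
      (hlie a ha).2, lie_smul, smul_lie, lie_self]
    simp

theorem norm_xi (g : G) : ‖xi x g‖ = 1 := by
  rw [xi_eq, mul_comm, Complex.norm_exp_ofReal_mul_I]

variable {m : G → ℂ}

/-- A state that extends the character of a maximal subordinate subgroup vanishes on the rest of the
normalizer of a subgroup, when it does so on that subgroup. -/
theorem eq_zero_of_mem_normalizer (hd : IsNilpotentOfClass E G d)
    (hH : Maximal (IsSubordinate x) H) (hm : IsState m) (hmH : ∀ h ∈ H, m h = xi x h)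
    {K : Subgroup G} (hHK : H ≤ K) (hK : ∀ g ∈ K, g ∉ H → m g = 0) {g : G}
    (hg : g ∈ Subgroup.normalizer (K : Set G)) (hgH : g ∉ H) : m g = 0 := by
  have hl : ∀ h ∈ H, ∀ g, m (h * g) = xi x h * m g := fun h hh g => by
    rw [hm.map_mul_of_norm_eq_one (by rw [hmH h hh, norm_xi]), hmH h hh]
  have hr : ∀ h ∈ H, ∀ g, m (g * h) = m g * xi x h := fun h hh g => by
    have h1 := hl h⁻¹ (H.inv_mem hh) g⁻¹
    rw [← mul_inv_rev, hm.map_inv, hm.map_inv, ← hmH _ (H.inv_mem hh), hm.map_inv, hmH h hh,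
      ← map_mul, mul_comm] at h1
    exact (starRingEnd ℂ).injective h1
  by_cases hc : ∀ h ∈ H, g * h * g⁻¹ ∈ H
  · by_contra hm0
    refine hgH (mem_of_conj_mem_of_xi_eq hd hH hc fun h hh => ?_)
    -- `m(gh)` is computed in two ways, as `m(ghg⁻¹ · g)` and as `m(g · h)`.
    have h1 := hl _ (hc h hh) g
    rw [inv_mul_cancel_right, hr h hh, mul_comm] at h1
    exact (mul_right_cancel₀ hm0 h1).symm
  · push Not at hc
    obtain ⟨h, hh, hc⟩ := hc
    set h' := g * h * g⁻¹ with hh'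
    have hK' : h' ∈ K := (Subgroup.mem_normalizer_iff.1 hg h).1 (hHK hh)
    -- `log H` is a vector space, so `H` contains the roots of its elements.
    have hpow : ∀ n : ℕ, n ≠ 0 → h' ^ n ∉ H := by
      intro n hn hmem
      rw [← lieExp_smul_lieLog_natCast (E := E) hd] at hmem
      have h1 := (maxSubalgebra hd hH).smul_mem (n : ℝ)⁻¹ hmem
      rw [smul_smul, inv_mul_cancel₀ (by exact_mod_cast hn), one_smul, mem_maxSubalgebra,
        lieExp_lieLog hd] at h1
      exact hc h1
    -- Quotients of distinct powers of `h'` lie in `K` but not in `H`, so `m` vanishes on them and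
    -- Bessel's inequality applies. All its terms equal `|m(g)|²`, because `h'ⁿ g = g hⁿ`.
    refine hm.eq_zero_of_forall_norm_eq (fun n => (h' ^ n)⁻¹) g (fun i j hij => ?_) fun n => ?_
    · refine hK _ (K.mul_mem (by simpa using K.pow_mem hK' i) (K.inv_mem (K.pow_mem hK' j))) ?_
      rw [inv_inv]
      rcases lt_or_gt_of_ne hij with hlt | hlt
      · intro hmem
        refine hpow (j - i) (by omega) ?_
        have h1 := H.inv_mem hmem
        rwa [mul_inv_rev, inv_inv, ← pow_sub _ hlt.le] at h1
      · intro hmem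
        refine hpow (i - j) (by omega) ?_
        rwa [← pow_sub _ hlt.le] at hmem
    · have h1 : h' ^ n * g = g * h ^ n := by
        rw [hh', conj_pow, inv_mul_cancel_right]
      rw [inv_inv, h1, hr _ (H.pow_mem hh n), norm_mul, norm_xi, mul_one]

/-- In a nilpotent group, the iterated normalizers of a subgroup exhaust the group. -/
theorem lieExp_mem_iterate_normalizer (hd : IsNilpotentOfClass E G d) (H : Subgroup G) (n : ℕ)
    {Z : LieAlg E G} (hn : n ≤ d)
    (hZ : Z ∈ LieModule.lowerCentralSeries ℝ (LieAlg E G) (LieAlg E G) (d - n)) :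
    lieExp Z ∈ (fun K : Subgroup G => Subgroup.normalizer (K : Set G))^[n] H := by
  induction n generalizing Z with
  | zero =>
    rw [Nat.sub_zero, show LieModule.lowerCentralSeries ℝ (LieAlg E G) (LieAlg E G) d = ⊥ from hd,
      LieSubmodule.mem_bot] at hZ
    rw [hZ, lieExp_zero]
    exact one_mem _
  | succ n ih =>
    have hsucc : d - n = d - (n + 1) + 1 := by omega
    have hlie : ∀ v : LieAlg E G, ∀ w ∈
        LieModule.lowerCentralSeries ℝ (LieAlg E G) (LieAlg E G) (d - (n + 1)),
        ⁅v, w⁆ ∈ LieModule.lowerCentralSeries ℝ (LieAlg E G) (LieAlg E G) (d - n) := by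
      intro v w hw
      rw [hsucc, LieModule.lowerCentralSeries_succ]
      exact LieSubmodule.lie_mem_lie (LieSubmodule.mem_top v) hw
    have hle : LieModule.lowerCentralSeries ℝ (LieAlg E G) (LieAlg E G) (d - n) ≤
        LieModule.lowerCentralSeries ℝ (LieAlg E G) (LieAlg E G) (d - (n + 1)) :=
      LieModule.antitone_lowerCentralSeries ℝ _ _ (by omega)
    let T : LieSubalgebra ℝ (LieAlg E G) :=
      { toSubmodule := (LieModule.lowerCentralSeries ℝ (LieAlg E G) (LieAlg E G) (d - (n + 1))).toSubmodule
        lie_mem' := fun {v w} _ hw => hle (hlie v w hw) }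
    rw [Function.iterate_succ_apply', Subgroup.mem_normalizer_iff]
    intro g
    have h1 : Z - Ad g Z ∈ LieModule.lowerCentralSeries ℝ (LieAlg E G) (LieAlg E G) (d - n) := by
      rw [← lieExp_lieLog (E := E) hd g, Ad_lieExp hd, expAd_apply, Finset.sum_range_succ']
      have h2 : ∀ j, ((LieAlgebra.ad ℝ _ (lieLog E g)) ^ (j + 1)) Z ∈
          LieModule.lowerCentralSeries ℝ (LieAlg E G) (LieAlg E G) (d - n) := by
        intro j
        induction j with
        | zero => simpa using hlie _ _ hZ
        | succ j ih =>
          rw [pow_succ', Module.End.mul_apply]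
          exact hlie _ _ (hle ih)
      have h3 := neg_mem (sum_mem (t := Finset.range d) fun j _ =>
        Submodule.smul_mem _ (1 ^ (j + 1) / (j + 1).factorial : ℝ) (h2 j))
      convert! h3 using 1
      simp
    -- The logarithm of this commutator is `Z - Ad g Z` modulo brackets, and both lie in the next
    -- term of the lower central series. By induction the commutator is in the `n`-th normalizer, so
    -- conjugation by `exp Z` changes `g` only by an element of it.
    have h2 : lieExp Z * g * (lieExp Z)⁻¹ * g⁻¹ ∈
        (fun K : Subgroup G => Subgroup.normalizer (K : Set G))^[n] H := by
      have h3 : lieExp Z * g * (lieExp Z)⁻¹ * g⁻¹ = lieExp Z * lieExp (-Ad g Z) := by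
        rw [← map_neg, ← conj_lieExp, lieExp_neg]
        simp only [mul_assoc]
      obtain ⟨C, hC, h4⟩ := exists_lieExp_eq_mul hd Z (-Ad g Z)
      have h5 : Ad g Z ∈ T := by
        have h5 := sub_mem hZ (hle h1)
        rwa [sub_sub_cancel] at h5
      have h6 := (h4 T (LieModule.lowerCentralSeries ℝ (LieAlg E G) (LieAlg E G) (d - n)).toSubmodule
        hZ (neg_mem h5) fun v _ w hw => hlie v w hw).2
      rw [h3, ← hC]
      refine ih (by omega) ?_
      have h7 := add_mem h6 h1
      rwa [← sub_eq_add_neg, sub_add_cancel] at h7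
    have h3 : lieExp Z * g * (lieExp Z)⁻¹ = lieExp Z * g * (lieExp Z)⁻¹ * g⁻¹ * g := by simp
    rw [h3]
    exact (Subgroup.mul_mem_cancel_left _ h2).symm

/-- Uniqueness of the state. -/
theorem eq_zero_of_notMem (hd : IsNilpotentOfClass E G d)
    (hH : Maximal (IsSubordinate x) H) (hm : IsState m) (hmH : ∀ h ∈ H, m h = xi x h)
    {g : G} (hgH : g ∉ H) : m g = 0 := by
  have h : ∀ n, H ≤ (fun K : Subgroup G => Subgroup.normalizer (K : Set G))^[n] H ∧
      ∀ g ∈ (fun K : Subgroup G => Subgroup.normalizer (K : Set G))^[n] H, g ∉ H → m g = 0 := by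
    intro n
    induction n with
    | zero => exact ⟨le_rfl, fun g h1 h2 => (h2 h1).elim⟩
    | succ n ih =>
      rw [Function.iterate_succ_apply']
      exact ⟨ih.1.trans Subgroup.le_normalizer,
        fun g h1 h2 => eq_zero_of_mem_normalizer hd hH hm hmH ih.1 ih.2 h1 h2⟩
  refine (h d).2 g ?_ hgH
  rw [← lieExp_lieLog (E := E) hd g]
  exact lieExp_mem_iterate_normalizer hd H d le_rfl (by simp)

end Normalizer

/-! ### Means of exponential polynomials -/

section Mean

open Topology Filter Polynomial

/-- Integration by parts: on the dilated interval `[T, 2T]`, with `T` large, the phase has no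
critical points, and both `1/(u p'(u))` and `p''/p'²` are small. -/
theorem tendsto_integral_exp_polynomial {p : ℝ[X]} (hp : p.natDegree ≠ 0) :
    Tendsto (fun T : ℝ => ∫ s in (1 : ℝ)..2, Complex.exp (Complex.I * (p.eval (T * s) : ℝ))) atTop
      (𝓝 0) := by
  have hp' : derivative p ≠ 0 := fun h => hp (derivative_eq_zero.1 h)
  have h1 : Tendsto (fun u => (derivative (derivative p)).eval u / (derivative p ^ 2).eval u) atTop
      (𝓝 0) := by
    refine div_tendsto_atTop_zero_of_degree_lt _ _ ((degree_derivative_lt hp').trans_le ?_)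
    rw [sq]
    exact degree_le_mul_left _ hp'
  have h2 : Tendsto (fun u => (1 : ℝ[X]).eval u / (X * derivative p).eval u) atTop (𝓝 0) := by
    refine div_tendsto_atTop_zero_of_degree_lt _ _ ?_
    rw [degree_one, degree_mul, degree_X, degree_eq_natDegree hp']
    exact_mod_cast Nat.lt_of_lt_of_le Nat.zero_lt_one (Nat.le_add_right 1 _)
  have h3 : ∀ᶠ u in atTop, (derivative p).eval u ≠ 0 := eventually_atTop_not_isRoot _ hp'
  rw [Metric.tendsto_atTop]
  intro ε hε
  obtain ⟨U, hU⟩ := eventually_atTop.1 (((Metric.tendsto_nhds.1 h1 (ε / 6) (by positivity)).and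
    (Metric.tendsto_nhds.1 h2 (ε / 6) (by positivity))).and h3)
  refine ⟨max U 1, fun T hT => ?_⟩
  have hT1 : 1 ≤ T := (le_max_right _ _).trans hT
  have hTs : ∀ s ∈ Set.Icc (1 : ℝ) 2, U ≤ T * s := fun s hs =>
    ((le_max_left _ _).trans hT).trans (le_mul_of_one_le_right (by linarith) hs.1)
  let e : ℝ → ℂ := fun s => Complex.exp (Complex.I * (p.eval (T * s) : ℝ))
  -- `F` is the approximate primitive of `e`, with error `r`. Each boundary value is at most `ε/3`,
  -- because `1/(T p'(Ts))` is `s ≤ 2` times `1/(Ts p'(Ts))`; the error contributes `ε/6`.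
  let F : ℝ → ℂ := fun s => e s / (Complex.I * (T * (derivative p).eval (T * s) : ℝ))
  let r : ℝ → ℂ := fun s => e s * ((derivative (derivative p)).eval (T * s) /
    (derivative p ^ 2).eval (T * s) : ℝ) * Complex.I
  have hnorm : ∀ s, ‖e s‖ = 1 := fun s => by
    simp only [e]
    rw [mul_comm, Complex.norm_exp_ofReal_mul_I]
  have hpoly : ∀ (q : ℝ[X]) (s : ℝ), HasDerivAt (fun s : ℝ => q.eval (T * s))
      (T * (derivative q).eval (T * s)) s := fun q s => by
    have := (q.hasDerivAt (T * s)).comp s ((hasDerivAt_id s).const_mul T)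
    simpa [mul_comm, Function.comp_def] using this
  have he : ∀ s, HasDerivAt e (e s * (Complex.I * (T * (derivative p).eval (T * s) : ℝ))) s :=
    fun s => (((hpoly p s).ofReal_comp).const_mul Complex.I).cexp
  have hF : ∀ s ∈ Set.uIcc (1 : ℝ) 2, HasDerivAt F (e s + r s) s := by
    intro s hs
    rw [Set.uIcc_of_le one_le_two] at hs
    have hne := (hU _ (hTs s hs)).2
    have hT0 : T ≠ 0 := by positivity
    have hd : HasDerivAt (fun s : ℝ => Complex.I * ((T * (derivative p).eval (T * s) : ℝ) : ℂ))
        (Complex.I * ((T * (T * (derivative (derivative p)).eval (T * s)) : ℝ) : ℂ)) s :=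
      ((((hpoly _ s).const_mul T).ofReal_comp).const_mul Complex.I)
    refine ((he s).div hd ?_).congr_deriv ?_
    · exact mul_ne_zero Complex.I_ne_zero (by exact_mod_cast mul_ne_zero hT0 hne)
    · have hne' : (((derivative p).eval (T * s) : ℝ) : ℂ) ≠ 0 := by exact_mod_cast hne
      have hT0' : (T : ℂ) ≠ 0 := by exact_mod_cast hT0
      simp only [r, eval_pow]
      push_cast
      field_simp
      ring_nf
      simp only [Complex.I_sq]
      ring
  have hcont : ∀ (q : ℝ[X]), Continuous fun s : ℝ => q.eval (T * s) := fun q =>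
    continuous_iff_continuousAt.2 fun s => (hpoly q s).continuousAt
  have hec : Continuous e := continuous_iff_continuousAt.2 fun s => (he s).continuousAt
  have hrc : ContinuousOn r (Set.uIcc 1 2) := by
    refine (hec.continuousOn.mul (Complex.continuous_ofReal.comp_continuousOn
      ((hcont _).continuousOn.div (hcont _).continuousOn fun s hs => ?_))).mul continuousOn_const
    rw [Set.uIcc_of_le one_le_two] at hs
    rw [eval_pow]
    exact pow_ne_zero 2 (hU _ (hTs s hs)).2
  have hint := intervalIntegral.integral_eq_sub_of_hasDerivAt hF
    ((hec.continuousOn.add hrc).intervalIntegrable)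
  rw [intervalIntegral.integral_add (hec.intervalIntegrable 1 2) hrc.intervalIntegrable] at hint
  have hr : ‖∫ s in (1 : ℝ)..2, r s‖ ≤ ε / 6 := by
    have := intervalIntegral.norm_integral_le_of_norm_le_const (a := (1 : ℝ)) (b := 2) (f := r)
      (C := ε / 6) fun s hs => by
        rw [Set.uIoc_of_le one_le_two] at hs
        have h4 := (hU _ (hTs s ⟨hs.1.le, hs.2⟩)).1.1
        simp only [r]
        rw [norm_mul, norm_mul, hnorm, Complex.norm_I, one_mul, mul_one, Complex.norm_real]
        rw [dist_zero_right] at h4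
        exact h4.le
    norm_num at this
    exact this
  have hFs : ∀ s ∈ Set.Icc (1 : ℝ) 2, ‖F s‖ ≤ ε / 3 := by
    intro s hs
    have h4 := (hU _ (hTs s hs)).1.2
    rw [dist_zero_right, eval_one, eval_mul, eval_X, norm_div, norm_one, norm_mul, norm_mul] at h4
    simp only [F]
    rw [norm_div, hnorm, norm_mul, Complex.norm_I, one_mul, Complex.norm_real, norm_mul]
    have hs0 : ‖s‖ ≤ 2 := by rw [Real.norm_eq_abs, abs_of_nonneg (by linarith [hs.1])]; exact hs.2
    have hs1 : 0 < ‖s‖ := norm_pos_iff.2 (by linarith [hs.1])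
    have h5 : 1 / (‖T‖ * ‖(derivative p).eval (T * s)‖) =
        ‖s‖ * (1 / (‖T‖ * ‖s‖ * ‖(derivative p).eval (T * s)‖)) := by
      field_simp
    rw [h5]
    calc ‖s‖ * _ ≤ 2 * (ε / 6) := mul_le_mul hs0 h4.le (by positivity) (by norm_num)
      _ = ε / 3 := by ring
  have hfin : (∫ s in (1 : ℝ)..2, e s) = F 2 - F 1 - ∫ s in (1 : ℝ)..2, r s := by
    rw [← hint]; ring
  rw [dist_zero_right]
  change ‖∫ s in (1 : ℝ)..2, e s‖ < ε
  rw [hfin]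
  have b1 := hFs 2 (by norm_num)
  have b2 := hFs 1 (by norm_num)
  have b3 := norm_sub_le (F 2 - F 1) (∫ s in (1 : ℝ)..2, r s)
  have b4 := norm_sub_le (F 2) (F 1)
  linarith

open Classical in
theorem tendsto_integral_exp_polyCurve {p : ℝ → ℝ} (hp : p ∈ polyCurve ℝ) :
    Tendsto (fun T : ℝ => ∫ s in (1 : ℝ)..2, Complex.exp (Complex.I * (p (T * s) : ℝ))) atTop
      (𝓝 (if ∀ t, p t = p 0 then Complex.exp (Complex.I * (p 0 : ℝ)) else 0)) := by
  split_ifs with h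
  · simp_rw [fun T s : ℝ => h (T * s)]
    norm_num
  · obtain ⟨q, hq⟩ := exists_polynomial_of_mem_polyCurve hp
    simp_rw [hq]
    refine tendsto_integral_exp_polynomial fun h0 => h fun t => ?_
    rw [natDegree_eq_zero] at h0
    obtain ⟨a, rfl⟩ := h0
    simp [hq]

theorem continuous_of_mem_polyCurve {p : ℝ → ℝ} (hp : p ∈ polyCurve ℝ) : Continuous p := by
  obtain ⟨q, hq⟩ := exists_polynomial_of_mem_polyCurve hp
  exact (funext hq : p = _) ▸ q.continuous

open Classical in
theorem tendsto_integral_sum_exp {ι : Type*} (s : Finset ι) (c : ι → ℂ) {p : ι → ℝ → ℝ}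
    (hp : ∀ i, p i ∈ polyCurve ℝ) :
    Tendsto (fun T : ℝ => ∫ u in (1 : ℝ)..2, ∑ i ∈ s, c i * Complex.exp (Complex.I * (p i (T * u) : ℝ)))
      atTop (𝓝 (∑ i ∈ s, c i * if ∀ t, p i t = p i 0 then
        Complex.exp (Complex.I * (p i 0 : ℝ)) else 0)) := by
  have h : ∀ T : ℝ, (∫ u in (1 : ℝ)..2, ∑ i ∈ s, c i * Complex.exp (Complex.I * (p i (T * u) : ℝ))) =
      ∑ i ∈ s, c i * ∫ u in (1 : ℝ)..2, Complex.exp (Complex.I * (p i (T * u) : ℝ)) := by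
    intro T
    rw [intervalIntegral.integral_finsetSum]
    · simp_rw [intervalIntegral.integral_const_mul]
    · intro i _
      have := continuous_of_mem_polyCurve (hp i)
      exact Continuous.intervalIntegrable (by fun_prop) _ _
  simp_rw [h]
  exact tendsto_finsetSum _ fun i _ => (tendsto_integral_exp_polyCurve (hp i)).const_mul _

end Mean

/-! ### Følner sets in abelian groups -/

section Folner

variable {A : Type*} [AddCommGroup A]

open Classical in
/-- The sums `∑ a j • z j` with `0 ≤ a j ≤ N`. -/
def sumBox {n : ℕ} (z : Fin n → A) (N : ℕ) : Finset A :=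
  (Finset.univ : Finset (Fin n → Fin (N + 1))).image fun a => ∑ j, (a j : ℕ) • z j

theorem mem_sumBox {n : ℕ} {z : Fin n → A} {N : ℕ} {v : A} :
    v ∈ sumBox z N ↔ ∃ a : Fin n → ℕ, (∀ j, a j ≤ N) ∧ ∑ j, a j • z j = v := by
  classical
  simp only [sumBox, Finset.mem_image, Finset.mem_univ, true_and]
  constructor
  · rintro ⟨a, rfl⟩
    exact ⟨fun j => a j, fun j => Nat.le_of_lt_succ (a j).2, rfl⟩
  · rintro ⟨a, ha, rfl⟩
    exact ⟨fun j => ⟨a j, Nat.lt_succ_of_le (ha j)⟩, rfl⟩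

theorem card_sumBox_le {n : ℕ} (z : Fin n → A) (N : ℕ) : (sumBox z N).card ≤ (N + 1) ^ n := by
  classical
  refine Finset.card_image_le.trans ?_
  simp

theorem sumBox_subset_succ {n : ℕ} (z : Fin n → A) (N : ℕ) : sumBox z N ⊆ sumBox z (N + 1) := by
  intro v hv
  obtain ⟨a, ha, rfl⟩ := mem_sumBox.1 hv
  exact mem_sumBox.2 ⟨a, fun j => (ha j).trans (Nat.le_succ N), rfl⟩

theorem add_mem_sumBox_succ {n : ℕ} {z : Fin n → A} {N : ℕ} (i : Fin n) {v : A}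
    (hv : v ∈ sumBox z N) : z i + v ∈ sumBox z (N + 1) := by
  obtain ⟨a, ha, rfl⟩ := mem_sumBox.1 hv
  refine mem_sumBox.2 ⟨fun j => a j + if j = i then 1 else 0, fun j => ?_, ?_⟩
  · have := ha j
    dsimp only
    split_ifs <;> omega
  · simp [add_smul, Finset.sum_add_distrib, add_comm]

theorem zero_mem_sumBox {n : ℕ} (z : Fin n → A) (N : ℕ) : 0 ∈ sumBox z N :=
  mem_sumBox.2 ⟨0, by simp, by simp⟩

/-- Otherwise the boxes would grow exponentially, while their size is at most `(N + 1)ⁿ`. -/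
theorem exists_card_sumBox_succ_le {n : ℕ} (z : Fin n → A) {ε : ℝ} (hε : 0 < ε) :
    ∃ N, ((sumBox z (N + 1)).card : ℝ) ≤ (1 + ε) * (sumBox z N).card := by
  by_contra! h
  have hne : (sumBox z 0).Nonempty := ⟨0, zero_mem_sumBox z 0⟩
  have h1 : ∀ N : ℕ, (1 + ε) ^ N ≤ (sumBox z N).card := by
    intro N
    induction N with
    | zero => 
      rw [pow_zero]
      exact_mod_cast hne.card_pos
    | succ N ih =>
      rw [pow_succ']
      exact (mul_le_mul_of_nonneg_left ih (by positivity)).trans (h N).le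
  have h2 := tendsto_pow_const_div_const_pow_of_one_lt n (r := 1 + ε) (by linarith)
  have h3 := (h2.comp (Filter.tendsto_add_atTop_nat 1)).eventually_lt_const
    (show (0 : ℝ) < 1 / (1 + ε) by positivity)
  obtain ⟨N, hN⟩ := h3.exists
  simp only [Function.comp] at hN
  rw [div_lt_div_iff₀ (by positivity) (by positivity), pow_succ, one_mul] at hN
  have h4 : ((sumBox z N).card : ℝ) ≤ ((N + 1 : ℕ) : ℝ) ^ n := by exact_mod_cast card_sumBox_le z N
  have h5 := lt_of_mul_lt_mul_right hN (by positivity)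
  exact absurd (h5.trans_le (h1 N)) (not_lt.2 h4)

open Classical in
/-- The abelian group generated by `z` has almost invariant finite sets. -/
theorem exists_almost_invariant {n : ℕ} (z : Fin n → A) {ε : ℝ} (hε : 0 < ε) :
    ∃ S : Finset A, S.Nonempty ∧ (∀ v ∈ S, v ∈ AddSubgroup.closure (Set.range z)) ∧
      ∀ i, (1 - ε) * S.card ≤ (S.filter fun v => z i + v ∈ S).card := by
  obtain ⟨N, hN⟩ := exists_card_sumBox_succ_le z hε
  refine ⟨sumBox z N, ⟨0, zero_mem_sumBox z N⟩, fun v hv => ?_, fun i => ?_⟩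
  · obtain ⟨a, -, rfl⟩ := mem_sumBox.1 hv
    exact sum_mem fun j _ => nsmul_mem (AddSubgroup.subset_closure (Set.mem_range_self j)) _
  · have h1 := Finset.card_filter_add_card_filter_not (s := sumBox z N)
      (fun v => z i + v ∈ sumBox z N)
    -- Translation by `z i` injects the elements that leave the box into the part of the next box
    -- outside this one.
    have h2 : ((sumBox z N).filter fun v => z i + v ∉ sumBox z N).card + (sumBox z N).card ≤
        (sumBox z (N + 1)).card := by
      have h3 : (((sumBox z N).filter fun v => z i + v ∉ sumBox z N).image (z i + ·)).card =
          ((sumBox z N).filter fun v => z i + v ∉ sumBox z N).card :=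
        Finset.card_image_of_injective _ (add_right_injective (z i))
      rw [← h3, ← Finset.card_union_of_disjoint]
      · refine Finset.card_le_card (Finset.union_subset ?_ (sumBox_subset_succ z N))
        intro w hw
        obtain ⟨v, hv, rfl⟩ := Finset.mem_image.1 hw
        exact add_mem_sumBox_succ i (Finset.mem_filter.1 hv).1
      · rw [Finset.disjoint_left]
        intro w hw
        obtain ⟨v, hv, rfl⟩ := Finset.mem_image.1 hw
        exact (Finset.mem_filter.1 hv).2
    have h4 : (((sumBox z N).filter fun v => z i + v ∈ sumBox z N).card : ℝ) +
        ((sumBox z N).filter fun v => z i + v ∉ sumBox z N).card = (sumBox z N).card := by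
      exact_mod_cast h1
    have h5 : (((sumBox z N).filter fun v => z i + v ∉ sumBox z N).card : ℝ) + (sumBox z N).card ≤
        (sumBox z (N + 1)).card := by exact_mod_cast h2
    linarith

end Folner

section Existence

open Topology

/-! ### Extension by zero of a character -/

/-- The sum equals the sum, over the classes `k` of `q`, of `|Σ_{q i = k} a i|²`. -/
theorem sum_sum_ite_nonneg {ι κ : Type*} [DecidableEq κ] (s : Finset ι) (q : ι → κ) (a : ι → ℂ) :
    0 ≤ ∑ i ∈ s, ∑ j ∈ s, if q i = q j then conj (a i) * a j else 0 := by
  have h1 : ∀ i ∈ s, ∀ j ∈ s, (if q i = q j then conj (a i) * a j else 0) =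
      ∑ k ∈ s.image q, conj (if q i = k then a i else 0) * if q j = k then a j else 0 := by
    intro i hi j _
    rw [Finset.sum_eq_single (q i)]
    · by_cases h : q i = q j <;> simp [h, eq_comm]
    · intro k _ hk
      simp [hk.symm]
    · exact fun h => absurd (Finset.mem_image_of_mem q hi) h
  have h : ∑ i ∈ s, ∑ j ∈ s, (if q i = q j then conj (a i) * a j else 0) =
      ∑ k ∈ s.image q, conj (∑ i ∈ s, if q i = k then a i else 0) *
        ∑ i ∈ s, if q i = k then a i else 0 := by
    rw [Finset.sum_congr rfl fun i hi => Finset.sum_congr rfl (h1 i hi)]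
    simp only [map_sum, Finset.sum_mul_sum]
    exact (Finset.sum_congr rfl fun i _ => Finset.sum_comm).trans Finset.sum_comm
  rw [h]
  exact Finset.sum_nonneg fun k _ => by
    rw [Complex.conj_mul']
    positivity

/-- After `g` is written as a coset representative times an element of `S`, the kernel `m(g⁻¹h)`
vanishes between different cosets and has rank one on each. This is a coefficient of the
representation induced from `χ`. -/
theorem isState_of_character {K : Type*} [Group K] (S : Subgroup K) (χ : K → ℂ) (h1 : χ 1 = 1)
    (hmul : ∀ g ∈ S, ∀ h ∈ S, χ (g * h) = χ g * χ h) (hn : ∀ g, ‖χ g‖ = 1) (m : K → ℂ)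
    (hS : ∀ g ∈ S, m g = χ g) (hS' : ∀ g ∉ S, m g = 0) : IsState m := by
  classical
  refine ⟨by rw [hS 1 S.one_mem, h1], fun c => ?_⟩
  have hinv : ∀ g ∈ S, χ g⁻¹ = conj (χ g) := by
    intro g hg
    have h2 := hmul g hg g⁻¹ (S.inv_mem hg)
    rw [mul_inv_cancel, h1] at h2
    have h3 : χ g * conj (χ g) = 1 := by rw [Complex.mul_conj', hn]; simp
    have h4 : χ g ≠ 0 := by
      intro h
      have := hn g
      rw [h, norm_zero] at this
      exact zero_ne_one this
    exact mul_left_cancel₀ h4 (h2.symm.trans h3.symm)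
  let r : K → K := fun g => (QuotientGroup.mk g : K ⧸ S).out
  have hr : ∀ g, (r g)⁻¹ * g ∈ S := fun g =>
    QuotientGroup.eq.1 (QuotientGroup.out_eq' (QuotientGroup.mk g : K ⧸ S))
  have key : ∀ g h, m (g⁻¹ * h) = if (QuotientGroup.mk g : K ⧸ S) = QuotientGroup.mk h then
      conj (χ ((r g)⁻¹ * g)) * χ ((r h)⁻¹ * h) else 0 := by
    intro g h
    split_ifs with hgh
    · rw [hS _ (QuotientGroup.eq.1 hgh), ← hinv _ (hr g),
        ← hmul _ (S.inv_mem (hr g)) _ (hr h)]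
      have h2 : r g = r h := congrArg Quotient.out hgh
      rw [h2]
      congr 1
      group
    · exact hS' _ fun h2 => hgh (QuotientGroup.eq.2 h2)
  have h2 := sum_sum_ite_nonneg c.support (fun g => (QuotientGroup.mk g : K ⧸ S))
    (fun g => c g * χ ((r g)⁻¹ * g))
  refine h2.trans_eq (Finset.sum_congr rfl fun g _ => Finset.sum_congr rfl fun h _ => ?_)
  simp only [key]
  split_ifs
  · rw [map_mul]
    ring
  · rw [mul_zero]

theorem IsState.restrict {K : Type*} [Group K] {m : K → ℂ} (hm : IsState m) (S : Subgroup K) :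
    IsState fun h : S => m h := by
  refine ⟨hm.map_one, fun c => ?_⟩
  have h := hm.nonneg_sum (fun i : c.support => c i) (fun i : c.support => ((i : S) : K))
  refine h.trans_eq ?_
  simp only [Finsupp.sum]
  rw [← Finset.sum_coe_sort c.support]
  refine Finset.sum_congr rfl fun i _ => ?_
  rw [← Finset.sum_coe_sort c.support]
  rfl

variable {E : Type*} [NormedAddCommGroup E] [NormedSpace ℝ E] [FiniteDimensional ℝ E]
  [CompleteSpace E] {G : Type*} [TopologicalSpace G] [ChartedSpace E G] [Group G]
  [LieGroup 𝓘(ℝ, E) ∞ G] [T2Space G] {d : ℕ} {x : Module.Dual ℝ (LieAlg E G)} {H : Subgroup G}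

theorem coAd_mul (g h : G) (x : Module.Dual ℝ (LieAlg E G)) : coAd g (coAd h x) = coAd (g * h) x := by
  refine LinearMap.ext fun Z => ?_
  change x (Ad h⁻¹ (Ad g⁻¹ Z)) = x (Ad (g * h)⁻¹ Z)
  rw [mul_inv_rev, Ad_mul_apply]

theorem coAd_mem {X : Set (Module.Dual ℝ (LieAlg E G))} (hX : IsCoadjointOrbit X) (hx : x ∈ X)
    (g : G) : coAd g x ∈ X := by
  obtain ⟨x₀, rfl⟩ := hX
  obtain ⟨h, rfl⟩ := hx
  exact ⟨g * h, (coAd_mul g h x₀).symm⟩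

theorem bddAbove_image_exponential_sum (X : Set (Module.Dual ℝ (LieAlg E G))) {n : ℕ}
    (c : Fin n → ℂ) (Z : Fin n → LieAlg E G) : BddAbove ((fun y : Module.Dual ℝ (LieAlg E G) =>
      ‖∑ j, c j * Complex.exp (Complex.I * (y (Z j) : ℝ))‖) '' X) := by
  refine ⟨∑ j, ‖c j‖, ?_⟩
  rintro _ ⟨y, -, rfl⟩
  refine (norm_sum_le _ _).trans (Finset.sum_le_sum fun j _ => ?_)
  rw [norm_mul, mul_comm Complex.I, Complex.norm_exp_ofReal_mul_I, mul_one]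

/-! ### Generic directions -/

theorem polyCurve_Ad_lieExp (hd : IsNilpotentOfClass E G d) (x : Module.Dual ℝ (LieAlg E G))
    (W Z : LieAlg E G) : (fun t : ℝ => x (Ad (lieExp (t • W)) Z)) ∈ polyCurve ℝ := by
  have h := expAd_mem_polyCurve d 1 (smul_mem_polyCurve W) (const_mem_polyCurve Z)
  convert! map_mem_polyCurve x h using 2 with t
  rw [← Ad_lieExp hd]

/-- A finite number of polynomial functions of `W`, none identically zero, have a common point where
none vanishes. -/
theorem exists_generic_direction [SimplyConnectedSpace G] (hd : IsNilpotentOfClass E G d)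
    (F : Finset (LieAlg E G)) :
    ∃ W : LieAlg E G, ∀ Z ∈ F, x (Ad (lieExp W) Z) = x Z → Z ∈ orbitKernel x := by
  classical
  induction F using Finset.induction_on with
  | empty => exact ⟨0, by simp⟩
  | insert Z F _ ih =>
    obtain ⟨W, hW⟩ := ih
    by_cases hZ : Z ∈ orbitKernel x
    · refine ⟨W, fun Z' hZ' h => ?_⟩
      rcases Finset.mem_insert.1 hZ' with rfl | hZ'
      · exact hZ
      · exact hW Z' hZ' h
    · obtain ⟨g, hg⟩ : ∃ g : G, x (Ad g Z) ≠ x Z := by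
        rw [mem_orbitKernel] at hZ
        push Not at hZ
        exact hZ
      -- The line from `W`, good for the elements of `F`, to `log g`, good for `Z`. Each polynomial
      -- is nonzero at one end, hence has finitely many zeros on the line.
      let γ : ℝ → LieAlg E G := fun s => W + s • (lieLog E g - W)
      have hγ : γ ∈ polyCurve (LieAlg E G) :=
        add_mem (const_mem_polyCurve W) (smul_mem_polyCurve (lieLog E g - W))
      have h1 : ∀ Z', (fun s => x (Ad (lieExp (γ s)) Z') - x Z') ∈ polyCurve ℝ := fun Z' => by
        simp only [Ad_lieExp hd]
        exact sub_mem (map_mem_polyCurve x (expAd_mem_polyCurve d 1 hγ (const_mem_polyCurve Z')))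
          (const_mem_polyCurve (x Z'))
      have h2 : ∀ Z' ∈ insert Z F, Z' ∉ orbitKernel x →
          {s | x (Ad (lieExp (γ s)) Z') - x Z' = 0}.Finite := by
        intro Z' hZ' hK
        by_contra hinf
        have h3 := eq_zero_of_mem_polyCurve (h1 Z') hinf (fun _ ht => ht)
        rcases Finset.mem_insert.1 hZ' with rfl | hZ'
        · have h4 := h3 1
          simp only [γ, one_smul, add_sub_cancel, lieExp_lieLog hd] at h4
          exact hg (sub_eq_zero.1 h4)
        · have h4 := h3 0
          simp only [γ, zero_smul, add_zero] at h4
          exact hK (hW Z' hZ' (sub_eq_zero.1 h4))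
      have h3 : (⋃ Z' ∈ (insert Z F).filter (· ∉ orbitKernel x),
          {s | x (Ad (lieExp (γ s)) Z') - x Z' = 0}).Finite :=
        Set.Finite.biUnion (Finset.finite_toSet _) fun Z' hZ' =>
          h2 Z' (Finset.mem_filter.1 hZ').1 (Finset.mem_filter.1 hZ').2
      obtain ⟨s, hs⟩ := h3.infinite_compl.nonempty
      refine ⟨γ s, fun Z' hZ' h => ?_⟩
      by_contra hK
      exact hs (Set.mem_biUnion (Finset.mem_filter.2 ⟨hZ', hK⟩) (sub_eq_zero.2 h))

-- For generic `W`, being constant along `exp(tW)` is the same as being constant on the whole orbit,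
-- so a mean along one curve detects `orbitKernel`.
open Classical in
theorem ite_generic [SimplyConnectedSpace G] {W Z : LieAlg E G}
    (hW : x (Ad (lieExp W) Z) = x Z → Z ∈ orbitKernel x) :
    (if ∀ t : ℝ, x (Ad (lieExp (t • W)) Z) = x (Ad (lieExp ((0 : ℝ) • W)) Z) then
      Complex.exp (Complex.I * (x (Ad (lieExp ((0 : ℝ) • W)) Z) : ℝ)) else 0) =
    if Z ∈ orbitKernel x then Complex.exp (Complex.I * (x Z : ℝ)) else 0 := by
  have h0 : Ad (lieExp ((0 : ℝ) • W)) Z = Z := by rw [zero_smul, lieExp_zero, Ad_one_apply]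
  simp only [h0]
  refine if_congr ⟨fun h => hW ?_, fun h t => h _⟩ rfl rfl
  simpa using h 1

/-! ### The inequality -/

-- Both sides are means along `t ↦ exp(tW)`, with `W` generic for all the frequencies that occur: on
-- the left of `f |Q|²`, on the right of `M |Q|²`, and `|f| ≤ M` throughout. The means only count
-- the frequencies that lie in `orbitKernel`.
open Classical Filter in
theorem norm_sum_card_le [SimplyConnectedSpace G] (hd : IsNilpotentOfClass E G d) {n : ℕ}
    (c : Fin n → ℂ) (Z : Fin n → LieAlg E G) {M : ℝ}
    (hM : ∀ g : G, ‖∑ j, c j * Complex.exp (Complex.I * (x (Ad g (Z j)) : ℝ))‖ ≤ M) {κ : Type*}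
    (S : Finset κ) (u : κ → LieAlg E G) :
    ‖∑ j, c j * Complex.exp (Complex.I * (x (Z j) : ℝ)) *
      (((S ×ˢ S).filter fun a => Z j + (u a.1 - u a.2) ∈ orbitKernel x).card : ℂ)‖ ≤
      M * ((S ×ˢ S).filter fun a => u a.1 - u a.2 ∈ orbitKernel x).card := by
  obtain ⟨W, hW⟩ := exists_generic_direction (x := x) hd
    (((S ×ˢ S).image fun a => u a.1 - u a.2) ∪
      ((Finset.univ ×ˢ (S ×ˢ S)).image fun b : Fin n × κ × κ => Z b.1 + (u b.2.1 - u b.2.2)))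
  let p : LieAlg E G → ℝ → ℝ := fun V t => x (Ad (lieExp (t • W)) V)
  let e : ℝ → ℂ := fun r => Complex.exp (Complex.I * (r : ℝ))
  have e_add : ∀ r s, e (r + s) = e r * e s := fun r s => by
    simp only [e]
    rw [← Complex.exp_add]
    push_cast
    ring_nf
  have e_conj : ∀ r, conj (e r) = e (-r) := fun r => by
    simp only [e]
    rw [← Complex.exp_conj]
    simp
  have p_add : ∀ V V' t, p (V + V') t = p V t + p V' t := fun V V' t => by simp [p]
  have p_sub : ∀ V V' t, p (V - V') t = p V t - p V' t := fun V V' t => by simp [p]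
  have hp : ∀ V, p V ∈ polyCurve ℝ := fun V => polyCurve_Ad_lieExp hd x W V
  have hpc : ∀ V, Continuous (p V) := fun V => continuous_of_mem_polyCurve (hp V)
  -- The factors `e(-x(u a))` normalize each exponential to the value `1` at `t = 0`, so that every
  -- surviving term of `|Q|²` has mean exactly `1`.
  let Q : ℝ → ℂ := fun t => ∑ a ∈ S, e (-x (u a)) * e (p (u a) t)
  let f : ℝ → ℂ := fun t => ∑ j, c j * e (p (Z j) t)
  have hec : Continuous e := by fun_prop
  have hQc : Continuous Q := by fun_prop
  have hfc : Continuous f := by fun_prop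
  have hQ2 : ∀ t, ((‖Q t‖ ^ 2 : ℝ) : ℂ) =
      ∑ a ∈ S ×ˢ S, e (-x (u a.1 - u a.2)) * e (p (u a.1 - u a.2) t) := by
    intro t
    have : ((‖Q t‖ ^ 2 : ℝ) : ℂ) = Q t * conj (Q t) := by
      rw [Complex.mul_conj']
      norm_cast
    rw [this, Finset.sum_product]
    simp only [Q, map_sum, Finset.sum_mul_sum]
    refine Finset.sum_congr rfl fun a _ => Finset.sum_congr rfl fun b _ => ?_
    rw [map_mul, e_conj, e_conj, p_sub, ← e_add, ← e_add, ← e_add, ← e_add, map_sub]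
    ring_nf
  have hfQ : ∀ t, f t * ((‖Q t‖ ^ 2 : ℝ) : ℂ) = ∑ b ∈ Finset.univ ×ˢ (S ×ˢ S),
      (c b.1 * e (-x (u b.2.1 - u b.2.2))) * e (p (Z b.1 + (u b.2.1 - u b.2.2)) t) := by
    intro t
    rw [Finset.sum_product, hQ2]
    simp only [f, Finset.sum_mul_sum]
    refine Finset.sum_congr rfl fun j _ => Finset.sum_congr rfl fun a _ => ?_
    rw [p_add, e_add]
    ring
  have lim1 := tendsto_integral_sum_exp (S ×ˢ S) (fun a => e (-x (u a.1 - u a.2)))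
    (p := fun a => p (u a.1 - u a.2)) fun a => hp _
  have lim2 := tendsto_integral_sum_exp (Finset.univ ×ˢ (S ×ˢ S))
    (fun b : Fin n × κ × κ => c b.1 * e (-x (u b.2.1 - u b.2.2)))
    (p := fun b => p (Z b.1 + (u b.2.1 - u b.2.2))) fun a => hp _
  have val1 : (∑ a ∈ S ×ˢ S, e (-x (u a.1 - u a.2)) *
      if ∀ t, p (u a.1 - u a.2) t = p (u a.1 - u a.2) 0 then
        Complex.exp (Complex.I * (p (u a.1 - u a.2) 0 : ℝ)) else 0) =
      (((S ×ˢ S).filter fun a => u a.1 - u a.2 ∈ orbitKernel x).card : ℂ) := by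
    rw [Finset.card_filter]
    push_cast
    refine Finset.sum_congr rfl fun a ha => ?_
    simp only [p]
    rw [ite_generic (hW _ (Finset.mem_union_left _ (Finset.mem_image_of_mem _ ha)))]
    split_ifs
    · change e _ * e _ = 1
      rw [← e_add, neg_add_cancel]
      simp [e]
    · rw [mul_zero]
  have val2 : (∑ b ∈ Finset.univ ×ˢ (S ×ˢ S), (c b.1 * e (-x (u b.2.1 - u b.2.2))) *
      if ∀ t, p (Z b.1 + (u b.2.1 - u b.2.2)) t = p (Z b.1 + (u b.2.1 - u b.2.2)) 0 then
        Complex.exp (Complex.I * (p (Z b.1 + (u b.2.1 - u b.2.2)) 0 : ℝ)) else 0) =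
      ∑ j, c j * Complex.exp (Complex.I * (x (Z j) : ℝ)) *
        (((S ×ˢ S).filter fun a => Z j + (u a.1 - u a.2) ∈ orbitKernel x).card : ℂ) := by
    rw [Finset.sum_product]
    refine Finset.sum_congr rfl fun j _ => ?_
    rw [Finset.card_filter]
    push_cast
    rw [Finset.mul_sum]
    refine Finset.sum_congr rfl fun a ha => ?_
    simp only [p]
    rw [ite_generic (hW _ (Finset.mem_union_right _ (Finset.mem_image.2
      ⟨(j, a), Finset.mem_product.2 ⟨Finset.mem_univ _, ha⟩, rfl⟩)))]
    split_ifs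
    · change c j * e _ * e _ = c j * e _ * 1
      rw [mul_assoc, ← e_add, mul_one, map_add]
      congr 2
      ring
    · rw [mul_zero, mul_zero]
  rw [val1] at lim1
  rw [val2] at lim2
  have hle : ∀ T : ℝ, ‖∫ s in (1 : ℝ)..2, f (T * s) * ((‖Q (T * s)‖ ^ 2 : ℝ) : ℂ)‖ ≤
      M * (∫ s in (1 : ℝ)..2, ((‖Q (T * s)‖ ^ 2 : ℝ) : ℂ)).re := by
    intro T
    rw [intervalIntegral.integral_ofReal, Complex.ofReal_re,
      ← intervalIntegral.integral_const_mul]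
    refine (intervalIntegral.norm_integral_le_integral_norm one_le_two).trans
      (intervalIntegral.integral_mono_on one_le_two
        (Continuous.intervalIntegrable (by fun_prop) _ _)
        (Continuous.intervalIntegrable (by fun_prop) _ _) fun s _ => ?_)
    rw [norm_mul, Complex.norm_real, Real.norm_of_nonneg (by positivity)]
    exact mul_le_mul_of_nonneg_right (hM _) (by positivity)
  simp only [hfQ] at hle
  simp only [hQ2] at hle
  have h1 := le_of_tendsto_of_tendsto' lim2.norm
    (((Complex.continuous_re.tendsto _).comp lim1).const_mul M) hle
  simpa using h1

open Classical in
/-- The inequality that makes the extension by zero of the character a quantum state. -/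
theorem norm_sum_ite_le [SimplyConnectedSpace G] (hd : IsNilpotentOfClass E G d)
    (hH : Maximal (IsSubordinate x) H) {n : ℕ} (c : Fin n → ℂ) (Z : Fin n → LieAlg E G) {M : ℝ}
    (hM : ∀ g : G, ‖∑ j, c j * Complex.exp (Complex.I * (x (Ad g (Z j)) : ℝ))‖ ≤ M) :
    ‖∑ j, if Z j ∈ maxSubalgebra hd hH then c j * Complex.exp (Complex.I * (x (Z j) : ℝ)) else 0‖ ≤
      M := by
  let N := orbitKernel x
  let q : LieAlg E G → LieAlg E G ⧸ N := Submodule.Quotient.mk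
  let u : (LieAlg E G ⧸ N) → LieAlg E G := Quotient.out
  have hu : ∀ a, q (u a) = a := fun a => Quotient.out_eq a
  have hq : ∀ V : LieAlg E G, q V = 0 ↔ V ∈ N := fun V => Submodule.Quotient.mk_eq_zero N
  have hNT := orbitKernel_le_maxSubalgebra hd hH
  set T := maxSubalgebra hd hH
  refine le_of_forall_pos_le_add fun δ hδ => ?_
  set C := ∑ j, ‖c j‖
  have hC : 0 ≤ C := Finset.sum_nonneg fun j _ => norm_nonneg _
  set ε := δ / (C + 1)
  have hε : 0 < ε := by positivity
  -- Only the classes of those `Z j` that lie in `T` are asked to move `S` little; the others are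
  -- replaced by `0`, so that `S` stays inside `T/N`.
  obtain ⟨S, hS, hSc, hSi⟩ := exists_almost_invariant
    (fun j => if Z j ∈ T then q (Z j) else 0) hε
  have huT : ∀ a ∈ S, u a ∈ T := by
    intro a ha
    have h1 : AddSubgroup.closure (Set.range fun j => if Z j ∈ T then q (Z j) else 0) ≤
        (T.toSubmodule.map N.mkQ).toAddSubgroup := by
      rw [AddSubgroup.closure_le]
      rintro _ ⟨j, rfl⟩
      dsimp only
      split_ifs with h
      · exact Submodule.mem_map_of_mem h
      · exact zero_mem _
    obtain ⟨V, hV, hVa⟩ := Submodule.mem_map.1 (h1 (hSc a ha))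
    have h2 : u a - V ∈ N := (Submodule.Quotient.eq N).1 ((hu a).trans hVa.symm)
    have h3 := add_mem (hNT h2) hV
    rwa [sub_add_cancel] at h3
  -- Representatives of distinct classes differ by an element outside `N`, so the mean of `|Q|²` is
  -- the number of elements of `S`.
  have hcard1 : (S ×ˢ S).filter (fun a => u a.1 - u a.2 ∈ N) = S.diag := by
    ext ⟨a, b⟩
    rw [Finset.mem_filter, Finset.mem_product, Finset.mem_diag, ← Submodule.Quotient.eq N]
    change (_ ∧ q (u a) = q (u b)) ↔ _
    rw [hu, hu]
    constructor
    · rintro ⟨⟨h1, -⟩, h2⟩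
      exact ⟨h1, h2⟩
    · rintro ⟨h1, h2⟩
      dsimp only at h1 h2
      exact ⟨⟨h1, h2 ▸ h1⟩, h2⟩
  let r : Fin n → ℕ := fun j => ((S ×ˢ S).filter fun a => Z j + (u a.1 - u a.2) ∈ N).card
  have hr : ∀ j, r j = (S.filter fun a => q (Z j) + a ∈ S).card := by
    intro j
    have h1 : ∀ a b, Z j + (u a - u b) ∈ N ↔ q (Z j) + a = b := by
      intro a b
      have h2 : q (Z j + (u a - u b)) = q (Z j) + (q (u a) - q (u b)) := rfl
      rw [← hq, h2, hu, hu, ← add_sub_assoc, sub_eq_zero]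
    refine Finset.card_bij' (fun a _ => a.1) (fun a _ => (a, q (Z j) + a)) ?_ ?_ ?_ ?_
    · rintro ⟨a, b⟩ hab
      rw [Finset.mem_filter, Finset.mem_product, h1] at hab
      exact Finset.mem_filter.2 ⟨hab.1.1, hab.2 ▸ hab.1.2⟩
    · intro a ha
      rw [Finset.mem_filter] at ha
      exact Finset.mem_filter.2 ⟨Finset.mem_product.2 ha, (h1 _ _).2 rfl⟩
    · rintro ⟨a, b⟩ hab
      rw [Finset.mem_filter, h1] at hab
      exact Prod.ext rfl hab.2
    · exact fun _ _ => rfl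
  -- Since `N ⊆ T` and the representatives of `S` lie in `T`, a frequency that starts outside `T`
  -- cannot be moved into `N`.
  have hr0 : ∀ j, Z j ∉ T → r j = 0 := by
    intro j hj
    refine Finset.card_eq_zero.2 (Finset.filter_eq_empty_iff.2 fun a ha h => hj ?_)
    rw [Finset.mem_product] at ha
    have h1 := sub_mem (hNT h) (sub_mem (huT _ ha.1) (huT _ ha.2))
    rwa [add_sub_cancel_right] at h1
  have hr1 : ∀ j, Z j ∈ T → (1 - ε) * S.card ≤ r j := by
    intro j hj
    have := hSi j
    rw [if_pos hj] at this
    rwa [hr]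
  have hr2 : ∀ j, r j ≤ S.card := fun j => by
    rw [hr]
    exact Finset.card_filter_le _ _
  have key := norm_sum_card_le (x := x) hd c Z hM S u
  rw [show (S ×ˢ S).filter (fun a => u a.1 - u a.2 ∈ orbitKernel x) = S.diag from hcard1,
    Finset.diag_card] at key
  have hS0 : 0 < (S.card : ℝ) := by exact_mod_cast hS.card_pos
  let w : Fin n → ℂ := fun j => c j * Complex.exp (Complex.I * (x (Z j) : ℝ))
  have hw : ∀ j, ‖w j‖ = ‖c j‖ := fun j => by
    simp only [w]
    rw [norm_mul, mul_comm Complex.I, Complex.norm_exp_ofReal_mul_I, mul_one]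
  -- After division by the size of `S`, the counts `r j` are within `ε` of the indicator of `Z j ∈
  -- T`. The choice `ε = δ/(C + 1)` keeps the total error below `δ`.
  have hdiff : ∀ j, ‖(if Z j ∈ T then w j else 0) * (S.card : ℂ) - w j * (r j : ℂ)‖ ≤
      ‖c j‖ * (ε * S.card) := by
    intro j
    split_ifs with h
    · rw [← mul_sub, norm_mul, hw]
      refine mul_le_mul_of_nonneg_left ?_ (norm_nonneg _)
      have h1 := hr1 j h
      have h2 : (r j : ℝ) ≤ S.card := by exact_mod_cast hr2 j
      have h3 : ((S.card : ℂ) - (r j : ℂ)) = ((S.card - r j : ℝ) : ℂ) := by push_cast; rfl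
      rw [h3, Complex.norm_real, Real.norm_of_nonneg (by linarith)]
      linarith
    · rw [hr0 j h]
      simp only [zero_mul, Nat.cast_zero, mul_zero, sub_zero, norm_zero]
      positivity
  have h1 : ‖(∑ j, if Z j ∈ T then w j else 0) * (S.card : ℂ)‖ ≤ (M + δ) * S.card := by
    have h2 : (∑ j, if Z j ∈ T then w j else 0) * (S.card : ℂ) = (∑ j, w j * (r j : ℂ)) +
        ∑ j, ((if Z j ∈ T then w j else 0) * (S.card : ℂ) - w j * (r j : ℂ)) := by
      rw [Finset.sum_mul, ← Finset.sum_add_distrib]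
      simp
    rw [h2]
    refine (norm_add_le _ _).trans ?_
    rw [add_mul]
    refine add_le_add key ((norm_sum_le _ _).trans ((Finset.sum_le_sum fun j _ => hdiff j).trans ?_))
    rw [← Finset.sum_mul, ← mul_assoc]
    refine mul_le_mul_of_nonneg_right ?_ hS0.le
    change C * (δ / (C + 1)) ≤ δ
    rw [mul_div_assoc', div_le_iff₀ (by positivity)]
    nlinarith
  rw [norm_mul, Complex.norm_natCast] at h1
  exact le_of_mul_le_mul_right h1 hS0

end Existence

/-! ### The two halves of the theorem -/

section Main

variable {E : Type*} [NormedAddCommGroup E] [NormedSpace ℝ E] [FiniteDimensional ℝ E]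
  [CompleteSpace E] {G : Type*} [TopologicalSpace G] [ChartedSpace E G] [Group G]
  [LieGroup 𝓘(ℝ, E) ∞ G] [T2Space G] [SimplyConnectedSpace G] {d : ℕ}
  {X : Set (Module.Dual ℝ (LieAlg E G))} {x : Module.Dual ℝ (LieAlg E G)} {H : Subgroup G}
  {m : G → ℂ}

theorem xi_lieExp (hd : IsNilpotentOfClass E G d) (Z : LieAlg E G) :
    xi x (lieExp Z) = Complex.exp (Complex.I * (x Z : ℝ)) := by
  rw [xi_eq, logForm_lieExp hd]

theorem isState_of_eq_xi (hd : IsNilpotentOfClass E G d) (hH : Maximal (IsSubordinate x) H)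
    (hm : ∀ g ∈ H, m g = xi x g) (hm' : ∀ g ∉ H, m g = 0) : IsState m :=
  isState_of_character H (xi x) (by rw [xi_eq, logForm_one hd]; simp) hH.1.map_mul
    (fun g => norm_xi g) m hm hm'

theorem isQuantumState_of_eq_xi (hd : IsNilpotentOfClass E G d) (hX : IsCoadjointOrbit X)
    (hx : x ∈ X) (hH : Maximal (IsSubordinate x) H) (hm : ∀ g ∈ H, m g = xi x g)
    (hm' : ∀ g ∉ H, m g = 0) : IsQuantumState X m where
  isState := isState_of_eq_xi hd hH hm hm'
  norm_le n c Z k hk _ := by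
    classical
    have h1 : ∀ j, c j * m (k j) = if Z j ∈ maxSubalgebra hd hH then
        c j * Complex.exp (Complex.I * (x (Z j) : ℝ)) else 0 := by
      intro j
      rw [hk j]
      split_ifs with h
      · rw [hm _ h, xi_lieExp hd]
      · rw [hm' _ h, mul_zero]
    simp only [h1]
    refine norm_sum_ite_le hd hH c Z fun g => ?_
    refine le_csSup (bddAbove_image_exponential_sum X c Z) ⟨_, coAd_mem hX hx g⁻¹, ?_⟩
    simp only [coAd, inv_inv]
    rfl

theorem isLocalizedAt_of_eq_xi (hd : IsNilpotentOfClass E G d) (hH : Maximal (IsSubordinate x) H)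
    (hm : ∀ g ∈ H, m g = xi x g) (hm' : ∀ g ∉ H, m g = 0) :
    IsLocalizedAt H {restrictDual H x} m where
  isState := (isState_of_eq_xi hd hH hm hm').restrict H
  norm_le n c Z k hk _ := by
    rw [Set.image_singleton, csSup_singleton]
    refine (congrArg norm (Finset.sum_congr rfl fun j _ => ?_)).le
    rw [hm _ (k j).2, hk j, xi_lieExp hd]
    rfl

theorem eq_xi_of_isLocalizedAt (hd : IsNilpotentOfClass E G d) (hH : Maximal (IsSubordinate x) H)
    (hm : IsLocalizedAt H {restrictDual H x} m) {h : G} (hh : h ∈ H) : m h = xi x h := by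
  let Z : subgroupLieAlg E H := ⟨lieLog E h, LieSubalgebra.subset_lieSpan fun t =>
    lieExp_smul_mem_of_maximal hd hH hh t⟩
  -- On the one-point orbit the right hand side is `|ξ(h) - ξ(h)| = 0`, so that `ξ(h) m(1) - m(h)`
  -- vanishes.
  have h1 := hm.norm_le 2 ![xi x h, -1] ![0, Z] ![1, ⟨h, hh⟩] (fun j => by
    fin_cases j
    · exact lieExp_zero.symm
    · exact (lieExp_lieLog hd h).symm) (fun i j y _ => by
    fin_cases i <;> fin_cases j <;> simp)
  rw [Set.image_singleton, csSup_singleton] at h1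
  have h2 : m 1 = 1 := hm.isState.map_one
  have h3 : Complex.exp (Complex.I * (restrictDual H x Z : ℝ)) = xi x h := rfl
  simp [Fin.sum_univ_two, h2, h3] at h1
  exact (sub_eq_zero.1 (by simpa [sub_eq_add_neg] using h1)).symm

end Main

end LieQuantum

end

theorem theorem6p3
    {E : Type*} [NormedAddCommGroup E] [NormedSpace ℝ E] [FiniteDimensional ℝ E] [CompleteSpace E]
    {G : Type*} [TopologicalSpace G] [ChartedSpace E G] [Group G] [LieGroup 𝓘(ℝ, E) ∞ G]
    [T2Space G] [SimplyConnectedSpace G]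
    (hnil : ∀ Z : LieQuantum.LieAlg E G, IsNilpotent (LieAlgebra.ad ℝ (LieQuantum.LieAlg E G) Z))
    (X : Set (Module.Dual ℝ (LieQuantum.LieAlg E G))) (hX : LieQuantum.IsCoadjointOrbit X)
    (x : Module.Dual ℝ (LieQuantum.LieAlg E G)) (hx : x ∈ X)
    (H : Subgroup G) (hH : Maximal (LieQuantum.IsSubordinate x) H) :
    (∃! m : G → ℂ, LieQuantum.IsQuantumState X m ∧
      LieQuantum.IsLocalizedAt H {LieQuantum.restrictDual H x} m) ∧
    ∀ m : G → ℂ, LieQuantum.IsQuantumState X m →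
      LieQuantum.IsLocalizedAt H {LieQuantum.restrictDual H x} m →
        (∀ g ∈ H, m g = LieQuantum.xi x g) ∧ ∀ g ∉ H, m g = 0 := by
  classical
  obtain ⟨d, hd⟩ := LieQuantum.exists_isNilpotentOfClass hnil
  have key : ∀ m : G → ℂ, LieQuantum.IsQuantumState X m →
      LieQuantum.IsLocalizedAt H {LieQuantum.restrictDual H x} m →
        (∀ g ∈ H, m g = LieQuantum.xi x g) ∧ ∀ g ∉ H, m g = 0 := fun m hm hl =>
    have h1 : ∀ g ∈ H, m g = LieQuantum.xi x g := fun g hg =>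
      LieQuantum.eq_xi_of_isLocalizedAt hd hH hl hg
    ⟨h1, fun g hg => LieQuantum.eq_zero_of_notMem hd hH hm.isState h1 hg⟩
  refine ⟨⟨fun g => if g ∈ H then LieQuantum.xi x g else 0, ⟨?_, ?_⟩, fun m hm => ?_⟩, key⟩
  · exact LieQuantum.isQuantumState_of_eq_xi hd hX hx hH (fun g hg => if_pos hg)
      fun g hg => if_neg hg
  · exact LieQuantum.isLocalizedAt_of_eq_xi hd hH (fun g hg => if_pos hg) fun g hg => if_neg hg
  · obtain ⟨h1, h2⟩ := key m hm.1 hm.2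
    funext g
    split_ifs with hg
    · exact h1 g hg
    · exact h2 g hg
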